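/- Let $N\ge 1$ and $m\ge 2$, and let $T_1,\dots,T_m$ be non-singular linear maps on $\mathbb R^N$ with $\|T_i\|<1$ for all $i$. For a finite word $\mathbf i=(i_1,\dots,i_k)$ over $\{1,\dots,m\}$ write $|\mathbf i|=k$ and $T_{\mathbf i}=T_{i_1}\cdots T_{i_k}$. For a linear map $T$ with singular values $\alpha_1\ge\dots\ge\alpha_N$ let $\phi^s(T)=\alpha_1\cdots\alpha_{j-1}\alpha_j^{\,s-j+1}$ if $0<s\le N$, where $j$ is the integer with $j-1<s\le j$, and $\phi^s(T)=(\alpha_1\cdots\alpha_N)^{s/N}$ if $s>N$. Let $p_1,\dots,p_m>0$ with $\sum_i p_i=1$, and let $\mu$ be the Bernoulli measure on $I_\infty=\{1,\dots,m\}^{\mathbb N}$, that is, the Borel measure giving the cylinder $C_{\mathbf i}$ of all infinite words starting with $\mathbf i=(i_1,\dots,i_k)$ the mass $p_{\mathbf i}=p_{i_1}\cdots p_{i_k}$. Let $\omega=\{\omega_{\mathbf i}\}$, indexed by all finite words $\mathbf i$, be a family of independent identically distributed random vectors with values in a bounded subset of $\mathbb R^N$, whose common distribution is absolutely continuous with respect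 to $N$-dimensional Lebesgue measure. Let $$\Pi^\omega(i_1,i_2,\dots)=\omega_{i_1}+T_{i_1}\omega_{i_1,i_2}+T_{i_1}T_{i_2}\omega_{i_1,i_2,i_3}+\cdots,$$ and let $\mu^\omega$ be the image of $\mu$ under $\Pi^\omega$. For a finite Borel measure $\tau$ of bounded support on $\mathbb R^N$ and $q>1$ let $\underline D_q(\tau)$ and $\overline D_q(\tau)$ be the lower and upper limits, as $r\to0^+$, of $\dfrac{\log\sum_C\tau(C)^q}{(q-1)\log r}$, where the sum is over the cubes $C=\prod_{l=1}^N[j_lr,(j_l+1)r)$, $j_l\in\mathbb Z$, with $\tau(C)>0$; if they agree, their common value is $D_q(\tau)$. Then for every $q>1$ there is a unique positive number $d_q$ with $$\lim_{k\to\infty}\Big(\sum_{|\mathbf i|=k}\phi^{d_q}(T_{\mathbf i})^{1-q}\,p_{\mathbf i}^{\,q}\Big)^{1/k}=1,$$ and, almost surely, for all $q>1$ simultaneously, $D_q(\mu^\omega)$ exists and $$D_q(\mu^\omega)=\underline D_q(\mu^\omega)=\overline D_q(\mu^\omega)=\min\{d_q,N\}.$$ -/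

import Mathlib

open MeasureTheory Filter Topology

noncomputable section

namespace AlmostSelfAffine

/-- Euclidean space `ℝ^N`. -/
abbrev E (N : ℕ) : Type := EuclideanSpace ℝ (Fin N)

/-- The singular value function `φ^s(T)`. With singular values `α₁ ≥ α₂ ≥ … ≥ α_N`, it is
`α₁ ⋯ α_{j-1} α_j^{s-j+1}` for `0 ≤ s ≤ N`, where `j - 1 < s ≤ j`, that is `j = ⌈s⌉`, and
`(α₁ ⋯ α_N)^{s/N}` for `s > N`. Mathlib numbers singular values from `0`, so that
`α_j` is `singularValues (j - 1)`. For `s = 0` the value is `1`. -/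
def singularValueFunction {N : ℕ} (s : ℝ) (T : E N →L[ℝ] E N) : ℝ :=
  let α : ℕ → ℝ := (T : E N →ₗ[ℝ] E N).singularValues
  if s ≤ N then
    (∏ i ∈ Finset.range (⌈s⌉₊ - 1), α i) * α (⌈s⌉₊ - 1) ^ (s - ((⌈s⌉₊ - 1 : ℕ) : ℝ))
  else
    (∏ i ∈ Finset.range N, α i) ^ (s / N)

/-- The composition `T_{i₁} T_{i₂} ⋯ T_{i_k}` along a finite word; the identity for the empty
word. -/
def wordMap {N m : ℕ} (T : Fin m → E N →L[ℝ] E N) (w : List (Fin m)) : E N →L[ℝ] E N :=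
  (w.map T).prod

/-- The curtailment `𝐢|_k = (i₁, …, i_k)` of an infinite word. -/
def curtail {m : ℕ} (i : ℕ → Fin m) (k : ℕ) : List (Fin m) :=
  List.ofFn fun j : Fin k => i j

/-- The cylinder `C_𝐰` of the infinite words that start with the finite word `𝐰`. -/
def cylinder {m k : ℕ} (w : Fin k → Fin m) : Set (ℕ → Fin m) :=
  {i | ∀ j : Fin k, i j = w j}

/-- The Bernoulli measure on the code space with weights `p`: the law of a sequence of independent
letters, each distributed according to `p`. -/
def bernoulliMeasure {m : ℕ} (p : PMF (Fin m)) : Measure (ℕ → Fin m) :=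
  Measure.infinitePi fun _ : ℕ => p.toMeasure

/-- The law of the family `ω = (ω_𝐢)` of displacements, indexed by all finite words, which are
independent and identically distributed with law `ν`. -/
def displacementLaw (m : ℕ) {N : ℕ} (ν : Measure (E N)) [IsProbabilityMeasure ν] :
    Measure (List (Fin m) → E N) :=
  Measure.infinitePi fun _ : List (Fin m) => ν

/-- The projection `Π^ω(𝐢) = ω_{i₁} + T_{i₁} ω_{i₁ i₂} + T_{i₁} T_{i₂} ω_{i₁ i₂ i₃} + ⋯`. -/
def projection {N m : ℕ} (T : Fin m → E N →L[ℝ] E N) (ω : List (Fin m) → E N)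
    (i : ℕ → Fin m) : E N :=
  ∑' k : ℕ, wordMap T (curtail i k) (ω (curtail i (k + 1)))

/-- The image `μ^ω` of a measure `μ` on the code space under the projection `Π^ω`. -/
def projectedMeasure {N m : ℕ} (T : Fin m → E N →L[ℝ] E N) (μ : Measure (ℕ → Fin m))
    (ω : List (Fin m) → E N) : Measure (E N) :=
  μ.map (projection T ω)

/-- The half-open `r`-mesh cube `[j₁ r, (j₁ + 1) r) × ⋯ × [j_N r, (j_N + 1) r)`. -/
def meshCube {N : ℕ} (r : ℝ) (j : Fin N → ℤ) : Set (E N) :=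
  {x | ∀ l, x l ∈ Set.Ico (j l * r) ((j l + 1) * r)}

/-- The moment sum `M_r(q) = ∑ τ(C)^q` over the `r`-mesh cubes `C`. Cubes of measure zero
contribute nothing when `q > 0`. -/
def momentSum {N : ℕ} (τ : Measure (E N)) (q r : ℝ) : ℝ :=
  ∑' j : Fin N → ℤ, τ.real (meshCube r j) ^ q

/-- The lower generalised `q`-dimension, the lower limit of `log M_r(q) / ((q - 1) log r)`
as `r → 0+`. -/
def lowerDim {N : ℕ} (q : ℝ) (τ : Measure (E N)) : EReal :=
  liminf (fun r : ℝ => ((Real.log (momentSum τ q r) / ((q - 1) * Real.log r) : ℝ) : EReal))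
    (𝓝[>] 0)

/-- The upper generalised `q`-dimension, the upper limit of `log M_r(q) / ((q - 1) log r)`
as `r → 0+`. -/
def upperDim {N : ℕ} (q : ℝ) (τ : Measure (E N)) : EReal :=
  limsup (fun r : ℝ => ((Real.log (momentSum τ q r) / ((q - 1) * Real.log r) : ℝ) : EReal))
    (𝓝[>] 0)

/-- The sum `∑_{|𝐢| = k} φ^s(T_𝐢)^{1-q} μ(C_𝐢)^q` over the words of length `k`. -/
def levelSum {N m : ℕ} (T : Fin m → E N →L[ℝ] E N) (μ : Measure (ℕ → Fin m)) (q s : ℝ)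
    (k : ℕ) : ℝ :=
  ∑ w : Fin k → Fin m,
    singularValueFunction s (wordMap T (List.ofFn w)) ^ (1 - q) * μ.real (cylinder w) ^ q

/-- The equation `lim_k (∑_{|𝐢| = k} φ^s(T_𝐢)^{1-q} μ(C_𝐢)^q)^{1/k} = 1`, together with `s > 0`,
which determines `s = d_q(T₁, …, T_m; μ)`. -/
def IsCriticalExponent {N m : ℕ} (T : Fin m → E N →L[ℝ] E N) (μ : Measure (ℕ → Fin m))
    (q s : ℝ) : Prop :=
  0 < s ∧ Tendsto (fun k : ℕ => levelSum T μ q s k ^ (1 / (k : ℝ))) atTop (𝓝 1)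

end AlmostSelfAffine

end

/-!
Let `P_q(s) = lim_k (1/k) log ∑_{|𝐢| = k} φ^s(T_𝐢)^{1-q} p_𝐢^q` be the pressure; it is continuous
and strictly increasing in `s`, and `d_q` is its zero.

*Lower bound.* Suppose `s < N` and `P_q(s) < 0`. Two infinite words whose longest common beginning
is `𝐢` have projections differing by `T_𝐢` of a vector that contains the independent displacement
of the first differing letter. Since `{z | ‖T_𝐢 z‖ ≤ r}` meets a ball in volume
`O(∏_l min(1, r / α_l)) = O(r^s / φ^s(T_𝐢))`, splitting off one letter at a time bounds the expected
`(q-1)`-th correlation moment at scale `r` by `r^{s(q-1)}` times the convergent series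
`∑_𝐢 φ^s(T_𝐢)^{1-q} p_𝐢^q`. The law of the displacements need not have a bounded density, but the
set where the density exceeds a large constant has so little mass that the recursion absorbs its
contribution. Borel–Cantelli along `r = 2^{-n}` and rational `q, s` give the bound almost surely for
all parameters.

*Upper bound.* This holds for every bounded family of displacements. If `P_q(s) > 0`, explore the
tree of words until `α_{⌈s⌉}(T_𝐢)` drops to `r`. The projected cylinder of such a word `𝐢` meets
`O(r^{-s} φ^s(T_𝐢))` mesh cubes, so by the power mean inequality it contributes at least a multiple
of `r^{s(q-1)} φ^s(T_𝐢)^{1-q} p_𝐢^q` to the moment sum, and these terms add up to at least `1`. The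
bound `N` comes from counting the mesh cubes that meet the bounded support.
-/

open scoped ENNReal

namespace AlmostSelfAffine

section SingularValues

open Module InnerProductSpace

theorem abs_inner_orthonormalBasis_le_norm {ι V : Type*} [Fintype ι] [NormedAddCommGroup V]
    [InnerProductSpace ℝ V] (e : OrthonormalBasis ι ℝ V) (i : ι) (x : V) :
    |⟪e i, x⟫_ℝ| ≤ ‖x‖ := by
  simpa [e.orthonormal.1 i] using abs_real_inner_le_norm (e i) x

theorem exists_linearIsometry_apply_basisFun_eq {V : Type*} [NormedAddCommGroup V]
    [InnerProductSpace ℝ V] {j : ℕ} {v : Fin j → V} (hv : Orthonormal ℝ v) :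
    ∃ g : EuclideanSpace ℝ (Fin j) →ₗᵢ[ℝ] V,
      ∀ i, g (EuclideanSpace.basisFun (Fin j) ℝ i) = v i := by
  let b := EuclideanSpace.basisFun (Fin j) ℝ
  let g : EuclideanSpace ℝ (Fin j) →ₗ[ℝ] V := b.toBasis.constr ℝ v
  have hg : ∀ i, g (b i) = v i := fun i => by
    simpa only [b.coe_toBasis] using b.toBasis.constr_basis ℝ v i
  have hgv : g ∘ b.toBasis = v := funext fun i => by
    simpa only [b.coe_toBasis, Function.comp_apply] using hg i
  exact ⟨g.isometryOfOrthonormal (v := b.toBasis) (by simp) (by rwa [hgv]), hg⟩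

variable {U V W : Type*} [NormedAddCommGroup U] [InnerProductSpace ℝ U] [FiniteDimensional ℝ U]
  [NormedAddCommGroup V] [InnerProductSpace ℝ V] [FiniteDimensional ℝ V]
  [NormedAddCommGroup W] [InnerProductSpace ℝ W] [FiniteDimensional ℝ W]

/-- The orthonormal basis `e` consists of right singular vectors of `f`: the images `f (e i)` are
orthogonal, and their lengths are the singular values in decreasing order. -/
def IsSingularBasis {n : ℕ} (f : U →ₗ[ℝ] V) (e : OrthonormalBasis (Fin n) ℝ U) : Prop :=
  ∀ i j : Fin n, ⟪f (e i), f (e j)⟫_ℝ = if i = j then f.singularValues i ^ 2 else 0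

theorem exists_isSingularBasis (f : U →ₗ[ℝ] V) {n : ℕ} (hn : finrank ℝ U = n) :
    ∃ e : OrthonormalBasis (Fin n) ℝ U, IsSingularBasis f e := by
  refine ⟨f.isSymmetric_adjoint_comp_self.eigenvectorBasis hn, fun i j => ?_⟩
  rw [← LinearMap.adjoint_inner_left, ← LinearMap.comp_apply,
    LinearMap.IsSymmetric.apply_eigenvectorBasis, f.sq_singularValues_fin hn,
    RCLike.ofReal_real_eq_id, id_eq, inner_smul_left, conj_trivial, OrthonormalBasis.inner_eq_ite]
  split_ifs <;> simp

namespace IsSingularBasis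

variable {n : ℕ} {f : U →ₗ[ℝ] V} {e : OrthonormalBasis (Fin n) ℝ U}

theorem norm_sq_apply (he : IsSingularBasis f e) (x : U) :
    ‖f x‖ ^ 2 = ∑ i : Fin n, f.singularValues i ^ 2 * ⟪e i, x⟫_ℝ ^ 2 := by
  have hx : f x = ∑ i, ⟪e i, x⟫_ℝ • f (e i) := by
    conv_lhs => rw [← e.sum_repr' x]
    simp
  rw [← real_inner_self_eq_norm_sq, hx, sum_inner]
  refine Finset.sum_congr rfl fun i _ => ?_
  rw [inner_sum, Finset.sum_eq_single i]
  · rw [inner_smul_left, inner_smul_right, he, if_pos rfl, conj_trivial]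
    ring
  · intro j _ hj
    rw [inner_smul_left, inner_smul_right, he, if_neg hj.symm, mul_zero, mul_zero]
  · simp

theorem norm_apply (he : IsSingularBasis f e) (i : Fin n) : ‖f (e i)‖ = f.singularValues i := by
  rw [← sq_eq_sq₀ (norm_nonneg _) (f.singularValues_nonneg _), ← real_inner_self_eq_norm_sq, he,
    if_pos rfl]

theorem norm_sq_apply_le (he : IsSingularBasis f e) {i : ℕ} {x : U}
    (hx : ∀ k : Fin n, k.1 < i → ⟪e k, x⟫_ℝ = 0) :
    ‖f x‖ ^ 2 ≤ f.singularValues i ^ 2 * ‖x‖ ^ 2 := by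
  rw [he.norm_sq_apply, ← e.sum_sq_inner_right, Finset.mul_sum]
  refine Finset.sum_le_sum fun k _ => ?_
  by_cases hk : k.1 < i
  · simp [hx k hk]
  · gcongr
    · exact f.singularValues_nonneg _
    · exact f.singularValues_antitone (not_lt.1 hk)

theorem le_norm_sq_apply (he : IsSingularBasis f e) {i : ℕ} {x : U}
    (hx : ∀ k : Fin n, i < k.1 → ⟪e k, x⟫_ℝ = 0) :
    f.singularValues i ^ 2 * ‖x‖ ^ 2 ≤ ‖f x‖ ^ 2 := by
  rw [he.norm_sq_apply, ← e.sum_sq_inner_right, Finset.mul_sum]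
  refine Finset.sum_le_sum fun k _ => ?_
  by_cases hk : i < k.1
  · simp [hx k hk]
  · gcongr
    · exact f.singularValues_nonneg _
    · exact f.singularValues_antitone (not_lt.1 hk)

theorem singularValues_mul_abs_inner_le (he : IsSingularBasis f e) (x : U) (i : Fin n) :
    f.singularValues i * |⟪e i, x⟫_ℝ| ≤ ‖f x‖ := by
  refine le_of_sq_le_sq ?_ (norm_nonneg _)
  rw [mul_pow, sq_abs, he.norm_sq_apply]
  exact Finset.single_le_sum (f := fun i : Fin n => f.singularValues i ^ 2 * ⟪e i, x⟫_ℝ ^ 2)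
    (fun i _ => by positivity) (Finset.mem_univ i)

theorem exists_orthonormalBasis_apply_eq_smul (he : IsSingularBasis f e) (hV : finrank ℝ V = n) :
    ∃ b : OrthonormalBasis (Fin n) ℝ V, ∀ i : Fin n, f (e i) = f.singularValues i • b i := by
  let S : Set (Fin n) := {i | f.singularValues i ≠ 0}
  have hortho : Orthonormal ℝ (S.domRestrict fun i => (f.singularValues i)⁻¹ • f (e i)) := by
    rw [orthonormal_iff_ite]
    rintro ⟨i, hi : f.singularValues i ≠ 0⟩ ⟨j, -⟩
    simp only [Set.domRestrict_apply, inner_smul_left, inner_smul_right, he i j, conj_trivial,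
      Subtype.mk.injEq]
    split_ifs with hij
    · subst hij
      field_simp
    · simp
  obtain ⟨b, hb⟩ := hortho.exists_orthonormalBasis_extension_of_card_eq (by simpa using hV)
  refine ⟨b, fun i => ?_⟩
  by_cases hi : f.singularValues i = 0
  · rw [hi, zero_smul, ← norm_eq_zero, he.norm_apply, hi]
  · rw [hb i hi, smul_inv_smul₀ hi]

end IsSingularBasis

theorem exists_orthonormalBasis_abs_inner_apply_le (f : U →ₗ[ℝ] V) {n : ℕ}
    (hU : finrank ℝ U = n) (hV : finrank ℝ V = n) :
    ∃ b : OrthonormalBasis (Fin n) ℝ V, ∀ (i : Fin n) (x : U),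
      |⟪b i, f x⟫_ℝ| ≤ f.singularValues i * ‖x‖ := by
  obtain ⟨e, he⟩ := exists_isSingularBasis f hU
  obtain ⟨b, hb⟩ := he.exists_orthonormalBasis_apply_eq_smul hV
  refine ⟨b, fun i x => ?_⟩
  have hinner : ⟪b i, f x⟫_ℝ = f.singularValues i * ⟪e i, x⟫_ℝ := by
    conv_lhs => rw [← e.sum_repr' x]
    simp [hb, inner_sum, inner_smul_right, b.inner_eq_ite, mul_comm]
  rw [hinner, abs_mul, abs_of_nonneg (f.singularValues_nonneg i)]
  exact mul_le_mul_of_nonneg_left (abs_inner_orthonormalBasis_le_norm e i x)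
    (f.singularValues_nonneg i)

theorem exists_norm_eq_one_norm_apply_eq_singularValues (f : U →ₗ[ℝ] V) {i : ℕ}
    (hi : i < finrank ℝ U) : ∃ x, ‖x‖ = 1 ∧ ‖f x‖ = f.singularValues i := by
  obtain ⟨e, he⟩ := exists_isSingularBasis f rfl
  exact ⟨e ⟨i, hi⟩, e.orthonormal.1 _, he.norm_apply ⟨i, hi⟩⟩

theorem exists_ne_zero_inner_eq_zero (S : Submodule ℝ V) {n : ℕ}
    (e : OrthonormalBasis (Fin n) ℝ V) (a : OrthonormalBasis (Fin (finrank ℝ S)) ℝ S) {i : ℕ}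
    (hi : i < finrank ℝ S) :
    ∃ x : S, x ≠ 0 ∧ (∀ k : Fin n, k.1 < i → ⟪e k, (x : V)⟫_ℝ = 0) ∧
      ∀ k : Fin (finrank ℝ S), i < k.1 → ⟪a k, x⟫_ℝ = 0 := by
  have hn : finrank ℝ S ≤ n := by
    rw [← Fintype.card_fin n, ← finrank_eq_card_basis e.toBasis]
    exact S.finrank_le
  -- The conditions are `finrank S - 1` linear equations on `S`.
  let M : S →ₗ[ℝ] (Fin (finrank ℝ S - 1) → ℝ) := LinearMap.pi fun k =>
    if k.1 < i then (innerₗ V (e ⟨k.1, by omega⟩)) ∘ₗ S.subtype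
      else innerₗ S (a ⟨k.1 + 1, by omega⟩)
  have hker : LinearMap.ker M ≠ ⊥ :=
    LinearMap.ker_ne_bot_of_finrank_lt (by rw [finrank_fin_fun]; omega)
  obtain ⟨x, hx, hx0⟩ := Submodule.exists_mem_ne_zero_of_ne_bot hker
  have hM : ∀ k, M x k = 0 := fun k => by rw [LinearMap.mem_ker.1 hx]; rfl
  refine ⟨x, hx0, fun k hk => ?_, fun k hk => ?_⟩
  · simpa [M, hk] using hM ⟨k.1, by omega⟩
  · have hlt : ¬ (k.1 - 1 < i) := by omega
    have hsucc : k.1 - 1 + 1 = k.1 := by omega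
    simpa [M, hlt, hsucc] using hM ⟨k.1 - 1, by omega⟩

theorem singularValues_domRestrict_le (f : V →ₗ[ℝ] W) (S : Submodule ℝ V) {i : ℕ}
    (hi : i < finrank ℝ S) : (f.domRestrict S).singularValues i ≤ f.singularValues i := by
  obtain ⟨a, ha⟩ := exists_isSingularBasis (f.domRestrict S) rfl
  obtain ⟨e, he⟩ := exists_isSingularBasis f rfl
  obtain ⟨x, hx0, hxe, hxa⟩ := exists_ne_zero_inner_eq_zero S e a hi
  have hsq : (f.domRestrict S).singularValues i ^ 2 * ‖x‖ ^ 2 ≤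
      f.singularValues i ^ 2 * ‖x‖ ^ 2 :=
    (ha.le_norm_sq_apply hxa).trans (he.norm_sq_apply_le hxe)
  exact le_of_sq_le_sq (le_of_mul_le_mul_right hsq (by positivity)) (f.singularValues_nonneg _)

theorem normDet_domRestrict_le (f : V →ₗ[ℝ] W) (S : Submodule ℝ V) :
    (f.domRestrict S).normDet ≤ ∏ i ∈ Finset.range (finrank ℝ S), f.singularValues i := by
  rw [LinearMap.normDet_eq_prod_singularValues]
  exact Finset.prod_le_prod (fun i _ => LinearMap.singularValues_nonneg _ _)
    fun i hi => singularValues_domRestrict_le f S (Finset.mem_range.1 hi)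

theorem exists_linearIsometry_normDet_comp_eq (f : V →ₗ[ℝ] W) {j : ℕ} (hj : j ≤ finrank ℝ V) :
    ∃ g : EuclideanSpace ℝ (Fin j) →ₗᵢ[ℝ] V,
      (f ∘ₗ g.toLinearMap).normDet = ∏ i ∈ Finset.range j, f.singularValues i := by
  obtain ⟨e, he⟩ := exists_isSingularBasis f rfl
  obtain ⟨g, hg⟩ := exists_linearIsometry_apply_basisFun_eq
    (e.orthonormal.comp _ (Fin.castLE_injective hj))
  refine ⟨g, ?_⟩
  have hgram : Matrix.gram ℝ (fun i => (f ∘ₗ g.toLinearMap) (EuclideanSpace.basisFun _ ℝ i)) =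
      Matrix.diagonal fun i : Fin j => f.singularValues i ^ 2 := by
    ext i k
    rw [Matrix.gram_apply, LinearMap.comp_apply, LinearMap.comp_apply,
      LinearIsometry.coe_toLinearMap, hg, hg, Function.comp_apply, Function.comp_apply, he,
      Matrix.diagonal_apply]
    simp
  have hsq := (f ∘ₗ g.toLinearMap).normDet_sq_eq_det_gram (EuclideanSpace.basisFun (Fin j) ℝ)
  rw [hgram, Matrix.det_diagonal, Finset.prod_pow,
    Fin.prod_univ_eq_prod_range (fun i => f.singularValues i) j] at hsq
  exact (sq_eq_sq₀ (LinearMap.normDet_nonneg _)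
    (Finset.prod_nonneg fun i _ => f.singularValues_nonneg i)).1 hsq

theorem normDet_comp_le (f : U →ₗ[ℝ] V) (g : V →ₗ[ℝ] W) :
    (g ∘ₗ f).normDet ≤ (∏ i ∈ Finset.range (finrank ℝ U), g.singularValues i) * f.normDet := by
  rw [LinearMap.normDet_comp]
  by_cases hf : f.normDet = 0
  · simp [hf]
  · have hrank : finrank ℝ f.range = finrank ℝ U := (f.normDet_ne_zero_tfae.out 0 2).1 hf
    rw [← hrank]
    exact mul_le_mul_of_nonneg_right (normDet_domRestrict_le g _) f.normDet_nonneg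

theorem prod_singularValues_comp_le (f : U →ₗ[ℝ] V) (g : V →ₗ[ℝ] W) {j : ℕ}
    (hj : j ≤ finrank ℝ U) :
    ∏ i ∈ Finset.range j, (g ∘ₗ f).singularValues i ≤
      (∏ i ∈ Finset.range j, g.singularValues i) * ∏ i ∈ Finset.range j, f.singularValues i := by
  obtain ⟨ι, hι⟩ := exists_linearIsometry_normDet_comp_eq (g ∘ₗ f) hj
  have hg := normDet_comp_le (f ∘ₗ ι.toLinearMap) g
  have hf := normDet_comp_le ι.toLinearMap f
  rw [finrank_euclideanSpace_fin] at hf hg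
  rw [ι.normDet_eq_one, mul_one] at hf
  rw [← hι, LinearMap.comp_assoc]
  exact hg.trans (mul_le_mul_of_nonneg_left hf
    (Finset.prod_nonneg fun i _ => g.singularValues_nonneg i))

end SingularValues

theorem prod_rpow_le_rpow_sum {ι : Type*} {F : Finset ι} {x w : ι → ℝ} {a : ℝ} (ha : 0 ≤ a)
    (hx : ∀ i ∈ F, 0 ≤ x i) (hxa : ∀ i ∈ F, x i ≤ a) (hw : ∀ i ∈ F, 0 ≤ w i) :
    ∏ i ∈ F, x i ^ w i ≤ a ^ ∑ i ∈ F, w i := by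
  rw [Real.rpow_sum_of_nonneg ha hw]
  exact Finset.prod_le_prod (fun i hi => Real.rpow_nonneg (hx i hi) _)
    fun i hi => Real.rpow_le_rpow (hx i hi) (hxa i hi) (hw i hi)

theorem rpow_sum_le_prod_rpow {ι : Type*} {F : Finset ι} {x w : ι → ℝ} {c : ℝ} (hc : 0 ≤ c)
    (hcx : ∀ i ∈ F, c ≤ x i) (hw : ∀ i ∈ F, 0 ≤ w i) :
    c ^ ∑ i ∈ F, w i ≤ ∏ i ∈ F, x i ^ w i := by
  rw [Real.rpow_sum_of_nonneg hc hw]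
  exact Finset.prod_le_prod (fun i _ => Real.rpow_nonneg hc _)
    fun i hi => Real.rpow_le_rpow hc (hcx i hi) (hw i hi)

section SingularValueFunction

open Module

variable {N : ℕ} {A B : E N →L[ℝ] E N} {s h a c : ℝ} {i : ℕ}

/-- The singular values of a continuous linear map of `ℝ^N`, numbered from `0`. -/
noncomputable abbrev singularValue (A : E N →L[ℝ] E N) (i : ℕ) : ℝ :=
  (A : E N →ₗ[ℝ] E N).singularValues i

theorem singularValue_nonneg (A : E N →L[ℝ] E N) (i : ℕ) : 0 ≤ singularValue A i :=
  LinearMap.singularValues_nonneg _ _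

theorem singularValue_antitone (A : E N →L[ℝ] E N) : Antitone (singularValue A) :=
  LinearMap.singularValues_antitone _

theorem singularValue_pos (hA : Function.Injective A) (hi : i < N) : 0 < singularValue A i :=
  (LinearMap.injective_iff_forall_lt_finrank_singularValues_pos (A : E N →ₗ[ℝ] E N)).1 hA i
    (by simpa using hi)

theorem singularValue_le_norm (A : E N →L[ℝ] E N) (i : ℕ) : singularValue A i ≤ ‖A‖ := by
  by_cases hi : i < finrank ℝ (E N)
  · obtain ⟨x, hx, hAx⟩ :=
      exists_norm_eq_one_norm_apply_eq_singularValues (A : E N →ₗ[ℝ] E N) hi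
    rw [singularValue, ← hAx]
    simpa [hx] using A.le_opNorm x
  · rw [singularValue, LinearMap.singularValues_of_finrank_le _ (not_lt.1 hi)]
    exact norm_nonneg _

theorem le_singularValue (hc : ∀ x, c * ‖x‖ ≤ ‖A x‖) (hi : i < N) : c ≤ singularValue A i := by
  obtain ⟨x, hx, hAx⟩ :=
    exists_norm_eq_one_norm_apply_eq_singularValues (A : E N →ₗ[ℝ] E N) (i := i) (by simpa using hi)
  simpa [hx, ← hAx] using hc x

theorem singularValue_one (hi : i < N) : singularValue (1 : E N →L[ℝ] E N) i = 1 :=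
  le_antisymm ((singularValue_le_norm _ _).trans ContinuousLinearMap.norm_id_le)
    (le_singularValue (fun x => by simp) hi)

theorem prod_singularValue_nonneg (A : E N →L[ℝ] E N) (j : ℕ) :
    0 ≤ ∏ i ∈ Finset.range j, singularValue A i :=
  Finset.prod_nonneg fun i _ => singularValue_nonneg A i

theorem prod_singularValue_mul_le (A B : E N →L[ℝ] E N) {j : ℕ} (hj : j ≤ N) :
    ∏ i ∈ Finset.range j, singularValue (A * B) i ≤
      (∏ i ∈ Finset.range j, singularValue A i) * ∏ i ∈ Finset.range j, singularValue B i :=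
  prod_singularValues_comp_le (B : E N →ₗ[ℝ] E N) (A : E N →ₗ[ℝ] E N) (by simpa using hj)

/-- The exponents `e_i(s)` for which `φ^s(A) = ∏_{i < N} α_i ^ e_i(s)`: for `s ≤ N` the exponent `s`
is spent on the largest singular values first, at most `1` on each, and for `s > N` it is spread
evenly. -/
noncomputable def singularValueExponent (N : ℕ) (s : ℝ) (i : ℕ) : ℝ :=
  if s ≤ N then max 0 (min 1 (s - i)) else s / N

theorem singularValueExponent_nonneg (hs : 0 < s) (i : ℕ) : 0 ≤ singularValueExponent N s i := by
  unfold singularValueExponent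
  split_ifs
  · exact le_max_left _ _
  · positivity

theorem singularValueExponent_le_one (hs : s ≤ N) (i : ℕ) : singularValueExponent N s i ≤ 1 := by
  rw [singularValueExponent, if_pos hs]
  exact max_le zero_le_one (min_le_left _ _)

theorem monotone_singularValueExponent (hi : i < N) :
    Monotone fun s => singularValueExponent N s i := by
  have hN : (0 : ℝ) < N := by exact_mod_cast (Nat.zero_le i).trans_lt hi
  intro s t hst
  simp only [singularValueExponent]
  split_ifs with hs ht ht
  · gcongr
  · refine max_le ?_ ((min_le_left _ _).trans ?_)
    · exact div_nonneg (hN.le.trans (not_le.1 ht).le) hN.le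
    · rw [one_le_div hN]
      exact (not_le.1 ht).le
  · exact absurd (hst.trans ht) hs
  · gcongr

theorem singularValueExponent_eq_one (hs : s ≤ N) (hi : (i : ℝ) + 1 ≤ s) :
    singularValueExponent N s i = 1 := by
  rw [singularValueExponent, if_pos hs, min_eq_left (by linarith), max_eq_right zero_le_one]

theorem singularValueExponent_eq_sub (hs : s ≤ N) (hi : (i : ℝ) ≤ s) (hi' : s ≤ i + 1) :
    singularValueExponent N s i = s - i := by
  rw [singularValueExponent, if_pos hs, min_eq_right (by linarith), max_eq_right (by linarith)]

theorem singularValueExponent_eq_zero (hs : s ≤ N) (hi : s ≤ i) :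
    singularValueExponent N s i = 0 := by
  rw [singularValueExponent, if_pos hs, min_eq_right (by linarith), max_eq_left (by linarith)]

theorem sum_singularValueExponent (hN : 1 ≤ N) (hs : 0 < s) :
    ∑ i ∈ Finset.range N, singularValueExponent N s i = s := by
  by_cases hsN : s ≤ N
  · have htelescope : ∀ i : ℕ,
        singularValueExponent N s i = min s ((i + 1 : ℕ) : ℝ) - min s (i : ℝ) := by
      intro i
      rw [singularValueExponent, if_pos hsN]
      push_cast
      grind
    simp only [htelescope]
    rw [Finset.sum_range_sub (fun i : ℕ => min s (i : ℝ)), min_eq_left hsN, Nat.cast_zero,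
      min_eq_right hs.le, sub_zero]
  · have hN0 : (N : ℝ) ≠ 0 := by positivity
    simp only [singularValueExponent, if_neg hsN, Finset.sum_const, Finset.card_range,
      nsmul_eq_mul]
    field_simp

theorem exists_ceil_eq_add_one (hs : 0 < s) : ∃ k : ℕ, ⌈s⌉₊ = k + 1 ∧ k < s ∧ s ≤ k + 1 := by
  obtain ⟨k, hk⟩ := Nat.exists_eq_succ_of_ne_zero (Nat.ceil_pos.2 hs).ne'
  refine ⟨k, hk, Nat.lt_ceil.1 (by omega), ?_⟩
  exact_mod_cast hk ▸ Nat.le_ceil s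

theorem singularValueFunction_eq_prod (A : E N →L[ℝ] E N) (hs : 0 < s) :
    singularValueFunction s A =
      ∏ i ∈ Finset.range N, singularValue A i ^ singularValueExponent N s i := by
  unfold singularValueFunction
  dsimp only
  split_ifs with hsN
  · obtain ⟨k, hk, hks, hsk⟩ := exists_ceil_eq_add_one hs
    have hkN : k + 1 ≤ N := hk ▸ Nat.ceil_le.2 hsN
    have htail : ∏ i ∈ Finset.Ico (k + 1) N, singularValue A i ^ singularValueExponent N s i = 1 :=
      Finset.prod_eq_one fun i hi => by
        have hki : (k : ℝ) + 1 ≤ i := by exact_mod_cast (Finset.mem_Ico.1 hi).1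
        rw [singularValueExponent_eq_zero hsN (hsk.trans hki), Real.rpow_zero]
    rw [hk, Nat.add_sub_cancel, ← Finset.prod_range_mul_prod_Ico _ hkN, htail, mul_one,
      Finset.prod_range_succ, singularValueExponent_eq_sub hsN hks.le hsk]
    congr 1
    refine Finset.prod_congr rfl fun i hi => ?_
    have hik : (i : ℝ) + 1 ≤ k := by exact_mod_cast Finset.mem_range.1 hi
    rw [singularValueExponent_eq_one hsN (hik.trans hks.le), Real.rpow_one]
  · rw [← Real.finsetProd_rpow _ _ fun i _ => singularValue_nonneg A i]
    simp only [singularValueExponent, if_neg hsN]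

theorem singularValueFunction_pos (hA : Function.Injective A) (hs : 0 < s) :
    0 < singularValueFunction s A := by
  rw [singularValueFunction_eq_prod A hs]
  exact Finset.prod_pos fun i hi =>
    Real.rpow_pos_of_pos (singularValue_pos hA (Finset.mem_range.1 hi)) _

theorem singularValueFunction_nonneg (A : E N →L[ℝ] E N) (hs : 0 < s) :
    0 ≤ singularValueFunction s A := by
  rw [singularValueFunction_eq_prod A hs]
  exact Finset.prod_nonneg fun i _ => Real.rpow_nonneg (singularValue_nonneg A i) _

theorem singularValueFunction_one (hs : 0 < s) :
    singularValueFunction s (1 : E N →L[ℝ] E N) = 1 := by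
  rw [singularValueFunction_eq_prod _ hs]
  refine Finset.prod_eq_one fun i hi => ?_
  rw [singularValue_one (Finset.mem_range.1 hi), Real.one_rpow]

theorem singularValueFunction_le_rpow (hN : 1 ≤ N) (hs : 0 < s) (ha : ‖A‖ ≤ a) :
    singularValueFunction s A ≤ a ^ s := by
  rw [singularValueFunction_eq_prod A hs]
  nth_rw 2 [← sum_singularValueExponent hN hs]
  exact prod_rpow_le_rpow_sum ((norm_nonneg A).trans ha) (fun i _ => singularValue_nonneg A i)
    (fun i _ => (singularValue_le_norm A i).trans ha) fun i _ => singularValueExponent_nonneg hs i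

theorem rpow_le_singularValueFunction (hN : 1 ≤ N) (hs : 0 < s) (hc0 : 0 ≤ c)
    (hc : ∀ x, c * ‖x‖ ≤ ‖A x‖) : c ^ s ≤ singularValueFunction s A := by
  rw [singularValueFunction_eq_prod A hs]
  nth_rw 1 [← sum_singularValueExponent hN hs]
  exact rpow_sum_le_prod_rpow hc0 (fun i hi => le_singularValue hc (Finset.mem_range.1 hi))
    fun i _ => singularValueExponent_nonneg hs i

theorem singularValueFunction_add (A : E N →L[ℝ] E N) (hs : 0 < s) (hh : 0 ≤ h) :
    singularValueFunction (s + h) A = singularValueFunction s A * ∏ i ∈ Finset.range N,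
      singularValue A i ^ (singularValueExponent N (s + h) i - singularValueExponent N s i) := by
  rw [singularValueFunction_eq_prod A hs,
    singularValueFunction_eq_prod A (add_pos_of_pos_of_nonneg hs hh), ← Finset.prod_mul_distrib]
  refine Finset.prod_congr rfl fun i hi => ?_
  rw [← Real.rpow_add_of_nonneg (singularValue_nonneg A i) (singularValueExponent_nonneg hs i)
    (sub_nonneg.2 (monotone_singularValueExponent (Finset.mem_range.1 hi)
      (le_add_of_nonneg_right hh))), add_sub_cancel]

theorem sum_singularValueExponent_sub (hN : 1 ≤ N) (hs : 0 < s) (hh : 0 ≤ h) :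
    ∑ i ∈ Finset.range N, (singularValueExponent N (s + h) i - singularValueExponent N s i) =
      h := by
  rw [Finset.sum_sub_distrib, sum_singularValueExponent hN hs,
    sum_singularValueExponent hN (add_pos_of_pos_of_nonneg hs hh), add_sub_cancel_left]

theorem singularValueFunction_add_le (hN : 1 ≤ N) (hs : 0 < s) (hh : 0 ≤ h) (ha : ‖A‖ ≤ a) :
    singularValueFunction (s + h) A ≤ singularValueFunction s A * a ^ h := by
  rw [singularValueFunction_add A hs hh]
  refine mul_le_mul_of_nonneg_left ?_ (singularValueFunction_nonneg A hs)
  conv_rhs => rw [← sum_singularValueExponent_sub hN hs hh]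
  exact prod_rpow_le_rpow_sum ((norm_nonneg A).trans ha) (fun i _ => singularValue_nonneg A i)
    (fun i _ => (singularValue_le_norm A i).trans ha) fun i hi => sub_nonneg.2
      (monotone_singularValueExponent (Finset.mem_range.1 hi) (le_add_of_nonneg_right hh))

theorem le_singularValueFunction_add (hN : 1 ≤ N) (hs : 0 < s) (hh : 0 ≤ h) (hc0 : 0 ≤ c)
    (hc : ∀ x, c * ‖x‖ ≤ ‖A x‖) :
    singularValueFunction s A * c ^ h ≤ singularValueFunction (s + h) A := by
  rw [singularValueFunction_add A hs hh]
  refine mul_le_mul_of_nonneg_left ?_ (singularValueFunction_nonneg A hs)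
  conv_lhs => rw [← sum_singularValueExponent_sub hN hs hh]
  exact rpow_sum_le_prod_rpow hc0 (fun i hi => le_singularValue hc (Finset.mem_range.1 hi))
    fun i hi => sub_nonneg.2
      (monotone_singularValueExponent (Finset.mem_range.1 hi) (le_add_of_nonneg_right hh))

theorem singularValueFunction_eq_interpolate (A : E N →L[ℝ] E N) {k : ℕ} (hk : k < s)
    (hsk : s ≤ k + 1) (hsN : s ≤ N) :
    singularValueFunction s A = (∏ i ∈ Finset.range k, singularValue A i) ^ (1 - (s - k)) *
      (∏ i ∈ Finset.range (k + 1), singularValue A i) ^ (s - k) := by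
  have hceil : ⌈s⌉₊ = k + 1 := by
    rw [Nat.ceil_eq_iff k.succ_ne_zero]
    exact ⟨by simpa using hk, by exact_mod_cast hsk⟩
  rw [Finset.prod_range_succ, Real.mul_rpow (prod_singularValue_nonneg A k)
      (singularValue_nonneg A k), ← mul_assoc,
    ← Real.rpow_add_of_nonneg (prod_singularValue_nonneg A k) (by linarith) (by linarith),
    sub_add_cancel, Real.rpow_one]
  simp only [singularValueFunction, if_pos hsN, hceil, Nat.add_sub_cancel]

theorem singularValueFunction_mul_le (A B : E N →L[ℝ] E N) (hs : 0 < s) :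
    singularValueFunction s (A * B) ≤ singularValueFunction s A * singularValueFunction s B := by
  have rpow_mul_le : ∀ (j : ℕ) (t : ℝ), j ≤ N → 0 ≤ t →
      (∏ i ∈ Finset.range j, singularValue (A * B) i) ^ t ≤
        (∏ i ∈ Finset.range j, singularValue A i) ^ t *
          (∏ i ∈ Finset.range j, singularValue B i) ^ t := fun j t hj ht => by
    rw [← Real.mul_rpow (prod_singularValue_nonneg A j) (prod_singularValue_nonneg B j)]
    exact Real.rpow_le_rpow (prod_singularValue_nonneg _ j) (prod_singularValue_mul_le A B hj) ht
  by_cases hsN : s ≤ N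
  · obtain ⟨k, hk, hks, hsk⟩ := exists_ceil_eq_add_one hs
    have hkN : k + 1 ≤ N := hk ▸ Nat.ceil_le.2 hsN
    rw [singularValueFunction_eq_interpolate _ hks hsk hsN,
      singularValueFunction_eq_interpolate _ hks hsk hsN,
      singularValueFunction_eq_interpolate _ hks hsk hsN, mul_mul_mul_comm]
    have hnonneg : ∀ (C : E N →L[ℝ] E N) (j : ℕ) (t : ℝ),
        0 ≤ (∏ i ∈ Finset.range j, singularValue C i) ^ t := fun C j t =>
      Real.rpow_nonneg (prod_singularValue_nonneg C j) t
    exact mul_le_mul (rpow_mul_le k _ (by omega) (by linarith))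
      (rpow_mul_le (k + 1) _ hkN (by linarith)) (hnonneg _ _ _)
      (mul_nonneg (hnonneg _ _ _) (hnonneg _ _ _))
  · simp only [singularValueFunction, if_neg hsN]
    exact rpow_mul_le N _ le_rfl (by positivity)

theorem exists_injective_mul_eq_one (hA : Function.Injective A) :
    ∃ B : E N →L[ℝ] E N, Function.Injective B ∧ A * B = 1 ∧ B * A = 1 := by
  let e : E N ≃L[ℝ] E N :=
    (LinearEquiv.ofInjectiveEndo (A : E N →ₗ[ℝ] E N) hA).toContinuousLinearEquiv
  exact ⟨e.symm, e.symm.injective, ContinuousLinearMap.ext e.apply_symm_apply,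
    ContinuousLinearMap.ext e.symm_apply_apply⟩

theorem exists_pos_mul_norm_le (hA : Function.Injective A) :
    ∃ c : ℝ, 0 < c ∧ ∀ x, c * ‖x‖ ≤ ‖A x‖ := by
  obtain ⟨K, hK, hAK⟩ := (A : E N →ₗ[ℝ] E N).exists_antilipschitzWith (LinearMap.ker_eq_bot.2 hA)
  refine ⟨(K : ℝ)⁻¹, by positivity, fun x => ?_⟩
  rw [inv_mul_le_iff₀ (by positivity)]
  exact ZeroHomClass.bound_of_antilipschitz (A : E N →ₗ[ℝ] E N) hAK x

theorem exists_singularValueFunction_le_mul (hB : Function.Injective B) (hs : 0 < s) :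
    ∃ K : ℝ, 0 < K ∧ ∀ A : E N →L[ℝ] E N,
      singularValueFunction s A ≤ K * singularValueFunction s (A * B) := by
  obtain ⟨C, hC, hBC, -⟩ := exists_injective_mul_eq_one hB
  refine ⟨singularValueFunction s C, singularValueFunction_pos hC hs, fun A => ?_⟩
  calc singularValueFunction s A = singularValueFunction s (A * B * C) := by
        rw [mul_assoc, hBC, mul_one]
    _ ≤ singularValueFunction s (A * B) * singularValueFunction s C :=
        singularValueFunction_mul_le _ _ hs
    _ = singularValueFunction s C * singularValueFunction s (A * B) := mul_comm _ _

end SingularValueFunction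

section Volume

open Module InnerProductSpace

variable {N : ℕ} {A : E N →L[ℝ] E N} {R r c s : ℝ}

theorem volume_setOf_abs_inner_sub_le (e : OrthonormalBasis (Fin N) ℝ (E N)) (a : Fin N → ℝ)
    {w : Fin N → ℝ} (hw : ∀ i, 0 ≤ w i) :
    volume {z : E N | ∀ i, |⟪e i, z⟫_ℝ - a i| ≤ w i} = ENNReal.ofReal (∏ i, 2 * w i) := by
  have hpres := (PiLp.volume_preserving_ofLp (Fin N)).comp e.measurePreserving_repr
  have hbox : {z : E N | ∀ i, |⟪e i, z⟫_ℝ - a i| ≤ w i} = (WithLp.ofLp ∘ e.repr) ⁻¹'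
      Set.univ.pi fun i => Set.Icc (a i - w i) (a i + w i) := by
    ext z
    simp only [Set.mem_ofPred_eq, Set.mem_preimage, Set.mem_univ_pi, Function.comp_apply,
      e.repr_apply_apply, ← Real.closedBall_eq_Icc, Metric.mem_closedBall, Real.dist_eq]
  rw [hbox, hpres.measure_preimage
      (MeasurableSet.univ_pi fun _ => measurableSet_Icc).nullMeasurableSet,
    Set.pi_univ_Icc, Real.volume_Icc_pi,
    ← ENNReal.ofReal_prod_of_nonneg fun i _ => by linarith [hw i]]
  congr 2
  ext i
  ring

theorem volume_ellipsoid_le_prod_min (hR : 0 ≤ R) (hA : Function.Injective A) (y : E N)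
    (hr : 0 < r) :
    volume {z : E N | ‖z‖ ≤ R ∧ ‖A (y - z)‖ ≤ r} ≤ ENNReal.ofReal
      ((2 * (R + 1)) ^ N * ∏ i ∈ Finset.range N, min 1 (r / singularValue A i)) := by
  obtain ⟨e, he⟩ := exists_isSingularBasis (A : E N →ₗ[ℝ] E N) finrank_euclideanSpace_fin
  have hα : ∀ i : Fin N, 0 < singularValue A i := fun i => singularValue_pos hA i.2
  have hx : ∀ i : Fin N, 0 < r / singularValue A i := fun i => div_pos hr (hα i)
  let a : Fin N → ℝ := fun i => if 1 ≤ r / singularValue A i then 0 else ⟪e i, y⟫_ℝ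
  let w : Fin N → ℝ := fun i => (R + 1) * min 1 (r / singularValue A i)
  have hw : ∀ i, 0 ≤ w i := fun i => mul_nonneg (by linarith) (le_min zero_le_one (hx i).le)
  have hsub : {z : E N | ‖z‖ ≤ R ∧ ‖A (y - z)‖ ≤ r} ⊆ {z | ∀ i, |⟪e i, z⟫_ℝ - a i| ≤ w i} := by
    rintro z ⟨hzR, hzr⟩ i
    by_cases hxi : 1 ≤ r / singularValue A i
    · simp only [a, w, if_pos hxi, min_eq_left hxi, sub_zero, mul_one]
      linarith [abs_inner_orthonormalBasis_le_norm e i z]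
    · have hyz : |⟪e i, z⟫_ℝ - ⟪e i, y⟫_ℝ| ≤ r / singularValue A i := by
        rw [abs_sub_comm, ← inner_sub_right, le_div_iff₀ (hα i), mul_comm]
        exact (he.singularValues_mul_abs_inner_le _ i).trans hzr
      simp only [a, w, if_neg hxi, min_eq_right (not_le.1 hxi).le]
      exact hyz.trans (le_mul_of_one_le_left (hx i).le (by linarith))
  refine (measure_mono hsub).trans_eq ?_
  rw [volume_setOf_abs_inner_sub_le e a hw]
  simp only [w, ← mul_assoc]
  rw [Finset.prod_mul_distrib, Finset.prod_const, Finset.card_univ, Fintype.card_fin,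
    Fin.prod_univ_eq_prod_range (fun i => min 1 (r / singularValue A i)) N]

theorem prod_div_rpow_singularValueExponent (A : E N →L[ℝ] E N) (hN : 1 ≤ N) (hs : 0 < s)
    (hr : 0 < r) :
    ∏ i ∈ Finset.range N, (singularValue A i / r) ^ singularValueExponent N s i =
      singularValueFunction s A / r ^ s := by
  have hrs : r ^ s = ∏ i ∈ Finset.range N, r ^ singularValueExponent N s i := by
    rw [← Real.rpow_sum_of_pos hr, sum_singularValueExponent hN hs]
  rw [singularValueFunction_eq_prod A hs, hrs, ← Finset.prod_div_distrib]
  exact Finset.prod_congr rfl fun i _ => Real.div_rpow (singularValue_nonneg A i) hr.le _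

theorem min_one_le_rpow {x t : ℝ} (hx : 0 ≤ x) (ht0 : 0 ≤ t) (ht1 : t ≤ 1) :
    min 1 x ≤ x ^ t := by
  rcases le_total 1 x with h1x | hx1
  · exact (min_le_left _ _).trans (Real.one_le_rpow h1x ht0)
  · exact (min_le_right _ _).trans (Real.self_le_rpow_of_le_one hx hx1 ht1)

theorem prod_min_le_rpow_div_singularValueFunction (hN : 1 ≤ N) (hs : 0 < s) (hsN : s ≤ N)
    (hr : 0 < r) :
    ∏ i ∈ Finset.range N, min 1 (r / singularValue A i) ≤ r ^ s / singularValueFunction s A := by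
  rw [← inv_div, ← prod_div_rpow_singularValueExponent A hN hs hr, ← Finset.prod_inv_distrib]
  have hx : ∀ i, 0 ≤ r / singularValue A i := fun i =>
    div_nonneg hr.le (singularValue_nonneg A i)
  refine Finset.prod_le_prod (fun i _ => le_min zero_le_one (hx i)) fun i _ => ?_
  rw [← Real.inv_rpow (div_nonneg (singularValue_nonneg A i) hr.le), inv_div]
  exact min_one_le_rpow (hx i) (singularValueExponent_nonneg hs i)
    (singularValueExponent_le_one hsN i)

theorem volume_ellipsoid_le (hN : 1 ≤ N) (hs : 0 < s) (hsN : s ≤ N) (hR : 0 ≤ R)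
    (hA : Function.Injective A) (y : E N) (hr : 0 < r) :
    volume {z : E N | ‖z‖ ≤ R ∧ ‖A (y - z)‖ ≤ r} ≤
      ENNReal.ofReal ((2 * (R + 1)) ^ N * (r ^ s / singularValueFunction s A)) :=
  (volume_ellipsoid_le_prod_min hR hA y hr).trans <| ENNReal.ofReal_le_ofReal <|
    mul_le_mul_of_nonneg_left (prod_min_le_rpow_div_singularValueFunction hN hs hsN hr)
      (by positivity)

theorem mem_meshCube_iff (hr : 0 < r) {j : Fin N → ℤ} {x : E N} :
    x ∈ meshCube r j ↔ ∀ l, ⌊x l / r⌋ = j l := by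
  simp only [meshCube, Set.mem_ofPred_eq, Set.mem_Ico]
  refine forall_congr' fun l => ?_
  rw [Int.floor_eq_iff, le_div_iff₀ hr, div_lt_iff₀ hr]

theorem meshCube_eq_preimage (r : ℝ) (j : Fin N → ℤ) : meshCube r j =
    WithLp.ofLp ⁻¹' (Set.univ.pi fun l => Set.Ico (j l * r) ((j l + 1) * r)) := by
  ext x
  simp [meshCube, Set.mem_pi]

theorem measurableSet_meshCube (r : ℝ) (j : Fin N → ℤ) : MeasurableSet (meshCube r j) := by
  rw [meshCube_eq_preimage]
  exact (PiLp.volume_preserving_ofLp (Fin N)).measurable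
    (MeasurableSet.univ_pi fun _ => measurableSet_Ico)

theorem pairwise_disjoint_meshCube (hr : 0 < r) :
    Pairwise fun j k : Fin N → ℤ => Disjoint (meshCube r j) (meshCube r k) := by
  intro j k hjk
  rw [Set.disjoint_left]
  intro x hxj hxk
  rw [mem_meshCube_iff hr] at hxj hxk
  exact hjk (funext fun l => (hxj l).symm.trans (hxk l))

theorem iUnion_meshCube (hr : 0 < r) : ⋃ j : Fin N → ℤ, meshCube r j = Set.univ :=
  Set.eq_univ_of_forall fun x =>
    Set.mem_iUnion.2 ⟨fun l => ⌊x l / r⌋, (mem_meshCube_iff hr).2 fun _ => rfl⟩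

theorem volume_meshCube (hr : 0 ≤ r) (j : Fin N → ℤ) :
    volume (meshCube r j) = ENNReal.ofReal (r ^ N) := by
  rw [meshCube_eq_preimage, (PiLp.volume_preserving_ofLp (Fin N)).measure_preimage
    (MeasurableSet.univ_pi fun _ => measurableSet_Ico).nullMeasurableSet, Real.volume_pi_Ico]
  simp only [add_mul, add_sub_cancel_left, one_mul, Finset.prod_const, Finset.card_univ,
    Fintype.card_fin]
  rw [ENNReal.ofReal_pow hr]

theorem norm_sub_le_of_mem_meshCube {j : Fin N → ℤ} {x y : E N} (hx : x ∈ meshCube r j)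
    (hy : y ∈ meshCube r j) (hr : 0 ≤ r) : ‖x - y‖ ≤ Real.sqrt N * r := by
  have hcoord : ∀ l ∈ Finset.univ, ‖(x - y) l‖ ^ 2 ≤ r ^ 2 := by
    intro l _
    obtain ⟨hxl, hxu⟩ := hx l
    obtain ⟨hyl, hyu⟩ := hy l
    rw [Real.norm_eq_abs, sq_abs, sq_le_sq, abs_of_nonneg hr, abs_le, PiLp.sub_apply]
    constructor <;> linarith
  rw [EuclideanSpace.norm_eq]
  refine Real.sqrt_le_iff.2 ⟨by positivity, ?_⟩
  rw [mul_pow, Real.sq_sqrt (Nat.cast_nonneg N)]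
  refine (Finset.sum_le_sum hcoord).trans_eq ?_
  simp

theorem card_mul_pow_le_of_biUnion_meshCube_subset (hr : 0 < r) {F : Finset (Fin N → ℤ)}
    {S : Set (E N)} {v : ℝ} (hv : 0 ≤ v) (hS : volume S = ENNReal.ofReal v)
    (hF : ⋃ j ∈ F, meshCube r j ⊆ S) : F.card * r ^ N ≤ v := by
  have hvol := measure_mono (μ := volume) hF
  rw [measure_biUnion_finset (fun a _ b _ hab => pairwise_disjoint_meshCube hr hab)
    (fun b _ => measurableSet_meshCube r b), hS] at hvol
  simp only [volume_meshCube hr.le, Finset.sum_const, nsmul_eq_mul] at hvol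
  rwa [← ENNReal.ofReal_natCast, ← ENNReal.ofReal_mul (Nat.cast_nonneg _),
    ENNReal.ofReal_le_ofReal_iff hv] at hvol

theorem card_meshCube_mul_pow_le (hR : 0 ≤ R) (A : E N →L[ℝ] E N) (y : E N) (hr : 0 < r)
    (F : Finset (Fin N → ℤ)) (hF : ∀ j ∈ F, ∃ x, ‖x‖ ≤ R ∧ y + A x ∈ meshCube r j) :
    F.card * r ^ N ≤ ∏ i : Fin N, 2 * (R * singularValue A i + Real.sqrt N * r) := by
  obtain ⟨f, hf⟩ := exists_orthonormalBasis_abs_inner_apply_le (A : E N →ₗ[ℝ] E N)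
    finrank_euclideanSpace_fin finrank_euclideanSpace_fin
  let w : Fin N → ℝ := fun i => R * singularValue A i + Real.sqrt N * r
  have hw : ∀ i, 0 ≤ w i := fun i => by
    have := singularValue_nonneg A i
    positivity
  refine card_mul_pow_le_of_biUnion_meshCube_subset hr
    (Finset.prod_nonneg fun i _ => mul_nonneg zero_le_two (hw i))
    (volume_setOf_abs_inner_sub_le f (fun i => ⟪f i, y⟫_ℝ) hw) fun z hz i => ?_
  obtain ⟨j, hj, hzj⟩ := Set.mem_iUnion₂.1 hz
  obtain ⟨x, hx, hyx⟩ := hF j hj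
  have hcube : |⟪f i, z - (y + A x)⟫_ℝ| ≤ Real.sqrt N * r :=
    (abs_inner_orthonormalBasis_le_norm f i _).trans (norm_sub_le_of_mem_meshCube hzj hyx hr.le)
  have himage : |⟪f i, A x⟫_ℝ| ≤ R * singularValue A i :=
    (hf i x).trans (by rw [mul_comm]; gcongr; exact singularValue_nonneg A i)
  calc |⟪f i, z⟫_ℝ - ⟪f i, y⟫_ℝ| = |⟪f i, A x⟫_ℝ + ⟪f i, z - (y + A x)⟫_ℝ| := by
        rw [inner_sub_right, inner_add_right]
        ring_nf
    _ ≤ w i := (abs_add_le _ _).trans (add_le_add himage hcube)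

theorem card_meshCube_le (hR : 0 ≤ R) (A : E N →L[ℝ] E N) (y : E N) (hr : 0 < r)
    (F : Finset (Fin N → ℤ)) (hF : ∀ j ∈ F, ∃ x, ‖x‖ ≤ R ∧ y + A x ∈ meshCube r j) :
    (F.card : ℝ) ≤ (2 * (R + Real.sqrt N)) ^ N *
      ∏ i ∈ Finset.range N, max 1 (singularValue A i / r) := by
  have hwidth : ∀ i : Fin N, 2 * (R * singularValue A i + Real.sqrt N * r) ≤
      2 * (R + Real.sqrt N) * max 1 (singularValue A i / r) * r := by
    intro i
    have hα : singularValue A i ≤ max 1 (singularValue A i / r) * r :=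
      (div_le_iff₀ hr).1 (le_max_right _ _)
    have hr' : r ≤ max 1 (singularValue A i / r) * r :=
      le_mul_of_one_le_left hr.le (le_max_left _ _)
    calc 2 * (R * singularValue A i + Real.sqrt N * r) ≤
        2 * (R * (max 1 (singularValue A i / r) * r) +
          Real.sqrt N * (max 1 (singularValue A i / r) * r)) := by gcongr
      _ = _ := by ring
  refine le_of_mul_le_mul_right ((card_meshCube_mul_pow_le hR A y hr F hF).trans
    ((Finset.prod_le_prod (fun i _ => ?_) fun i _ => hwidth i).trans_eq ?_)) (pow_pos hr N)
  · have := singularValue_nonneg A i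
    positivity
  · rw [Finset.prod_mul_distrib, Finset.prod_mul_distrib, Finset.prod_const, Finset.prod_const,
      Finset.card_univ, Fintype.card_fin,
      ← Fin.prod_univ_eq_prod_range (fun i => max 1 (singularValue A i / r))]

theorem max_one_le_inv_mul_rpow {x t : ℝ} (hc : 0 < c) (hc1 : c ≤ 1) (hcx : c ≤ x) (ht0 : 0 ≤ t)
    (ht1 : t ≤ 1) (hxt : x ≤ 1 ∨ t = 1) : max 1 x ≤ c⁻¹ * x ^ t := by
  have hone : 1 ≤ c⁻¹ * x ^ t := by
    rw [inv_mul_eq_div, one_le_div hc]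
    exact (Real.self_le_rpow_of_le_one hc.le hc1 ht1).trans (Real.rpow_le_rpow hc.le hcx ht0)
  refine max_le hone ?_
  rcases hxt with hx1 | rfl
  · exact hx1.trans hone
  · rw [Real.rpow_one]
    exact le_mul_of_one_le_left (hc.le.trans hcx) ((one_le_inv₀ hc).2 hc1)

theorem prod_max_le_inv_pow_mul_singularValueFunction (hN : 1 ≤ N) (hs : 0 < s) (hsN : s ≤ N)
    (hr : 0 < r) (hc : 0 < c) (hc1 : c ≤ 1) {k : ℕ} (hks : k < s) (hsk : s ≤ k + 1)
    (hcA : c * r ≤ singularValue A k) (hAr : singularValue A k ≤ r) :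
    ∏ i ∈ Finset.range N, max 1 (singularValue A i / r) ≤
      c⁻¹ ^ N * (singularValueFunction s A / r ^ s) := by
  have hcN : c⁻¹ ^ N = ∏ _i ∈ Finset.range N, c⁻¹ := by simp
  rw [← prod_div_rpow_singularValueExponent A hN hs hr, hcN, ← Finset.prod_mul_distrib]
  refine Finset.prod_le_prod (fun i _ => le_max_of_le_left zero_le_one) fun i _ => ?_
  have hle : k ≤ i → singularValue A i / r ≤ 1 := fun hki =>
    (div_le_one hr).2 ((singularValue_antitone A hki).trans hAr)
  rcases le_or_gt i k with hik | hki
  · have hci : c ≤ singularValue A i / r :=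
      (le_div_iff₀ hr).2 (hcA.trans (singularValue_antitone A hik))
    refine max_one_le_inv_mul_rpow hc hc1 hci (singularValueExponent_nonneg hs i)
      (singularValueExponent_le_one hsN i) ?_
    rcases hik.lt_or_eq with hlt | rfl
    · have hik' : (i : ℝ) + 1 ≤ k := by exact_mod_cast hlt
      exact Or.inr (singularValueExponent_eq_one hsN (hik'.trans hks.le))
    · exact Or.inl (hle le_rfl)
  · have hki' : (k : ℝ) + 1 ≤ i := by exact_mod_cast hki
    rw [singularValueExponent_eq_zero hsN (hsk.trans hki'), Real.rpow_zero, mul_one]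
    exact (max_le le_rfl (hle hki.le)).trans ((one_le_inv₀ hc).2 hc1)

end Volume

section Words

variable {N m : ℕ} {T : Fin m → E N →L[ℝ] E N} {ρ c : ℝ} {p : PMF (Fin m)} {q s h : ℝ}

/-- The maps `T i` contract by a uniform ratio `ρ < 1`, and shrink no vector by more than the
factor `c`; such `ρ` and `c` exist for any finite family of non-singular contractions. -/
structure NormBounds (T : Fin m → E N →L[ℝ] E N) (ρ c : ℝ) : Prop where
  upper_pos : 0 < ρ
  upper_lt_one : ρ < 1
  norm_le : ∀ i, ‖T i‖ ≤ ρ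
  lower_pos : 0 < c
  lower_lt_one : c < 1
  mul_norm_le : ∀ i x, c * ‖x‖ ≤ ‖T i x‖

theorem exists_normBounds (hT_inj : ∀ i, Function.Injective (T i)) (hT_norm : ∀ i, ‖T i‖ < 1) :
    ∃ ρ c, NormBounds T ρ c := by
  choose κ hκ0 hκ using fun i => exists_pos_mul_norm_le (hT_inj i)
  have hupper : ∀ᶠ ρ in 𝓝[<] (1 : ℝ), ∀ i, ‖T i‖ ≤ ρ := eventually_all.2 fun i =>
    (eventually_ge_nhds (hT_norm i)).filter_mono nhdsWithin_le_nhds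
  have hlower : ∀ᶠ c in 𝓝[>] (0 : ℝ), ∀ i, c ≤ κ i := eventually_all.2 fun i =>
    (eventually_le_nhds (hκ0 i)).filter_mono nhdsWithin_le_nhds
  obtain ⟨ρ, hρ, hρ0, hρ1⟩ := (hupper.and (Ioo_mem_nhdsLT zero_lt_one)).exists
  obtain ⟨c, hc, hc0, hc1⟩ := (hlower.and (Ioo_mem_nhdsGT zero_lt_one)).exists
  exact ⟨ρ, c, hρ0, hρ1, hρ, hc0, hc1, fun i x =>
    (mul_le_mul_of_nonneg_right (hc i) (norm_nonneg x)).trans (hκ i x)⟩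

theorem wordMap_append (T : Fin m → E N →L[ℝ] E N) (u v : List (Fin m)) :
    wordMap T (u ++ v) = wordMap T u * wordMap T v := by
  simp [wordMap]

theorem wordMap_cons (T : Fin m → E N →L[ℝ] E N) (a : Fin m) (v : List (Fin m)) :
    wordMap T (a :: v) = T a * wordMap T v := by
  simp [wordMap]

theorem wordMap_nil (T : Fin m → E N →L[ℝ] E N) : wordMap T [] = 1 := by
  simp [wordMap]

namespace NormBounds

theorem norm_wordMap_le (hT : NormBounds T ρ c) (w : List (Fin m)) :
    ‖wordMap T w‖ ≤ ρ ^ w.length := by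
  induction w with
  | nil =>
    rw [wordMap_nil, List.length_nil, pow_zero]
    exact ContinuousLinearMap.norm_id_le
  | cons a v ih =>
    rw [wordMap_cons, List.length_cons, pow_succ']
    exact (norm_mul_le _ _).trans (mul_le_mul (hT.norm_le a) ih (norm_nonneg _) hT.upper_pos.le)

theorem mul_norm_le_wordMap (hT : NormBounds T ρ c) (w : List (Fin m)) (x : E N) :
    c ^ w.length * ‖x‖ ≤ ‖wordMap T w x‖ := by
  induction w with
  | nil => simp [wordMap_nil]
  | cons a v ih =>
    rw [wordMap_cons, List.length_cons, pow_succ', mul_apply_eq_comp, mul_assoc]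
    exact (mul_le_mul_of_nonneg_left ih hT.lower_pos.le).trans (hT.mul_norm_le a _)

theorem wordMap_injective (hT : NormBounds T ρ c) (w : List (Fin m)) :
    Function.Injective (wordMap T w) := by
  refine (injective_iff_map_eq_zero _).2 fun x hx => norm_le_zero_iff.1 ?_
  have hle := hT.mul_norm_le_wordMap w x
  rw [hx, norm_zero] at hle
  exact nonpos_of_mul_nonpos_right hle (pow_pos hT.lower_pos _)

theorem injective (hT : NormBounds T ρ c) (a : Fin m) : Function.Injective (T a) := by
  simpa [wordMap] using hT.wordMap_injective [a]

theorem mul_injective (hT : NormBounds T ρ c) {A : E N →L[ℝ] E N} (hA : Function.Injective A)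
    (a : Fin m) : Function.Injective (A * T a) :=
  hA.comp (hT.injective a)

end NormBounds

/-- The product `p_𝐢 = p_{i₁} ⋯ p_{i_k}` of the weights along a word. -/
noncomputable def wordWeight (p : PMF (Fin m)) (w : List (Fin m)) : ℝ :=
  (w.map fun i => (p i).toReal).prod

theorem wordWeight_append (p : PMF (Fin m)) (u v : List (Fin m)) :
    wordWeight p (u ++ v) = wordWeight p u * wordWeight p v := by
  simp [wordWeight]

theorem wordWeight_cons (p : PMF (Fin m)) (a : Fin m) (v : List (Fin m)) :
    wordWeight p (a :: v) = (p a).toReal * wordWeight p v := by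
  simp [wordWeight]

theorem wordWeight_nil (p : PMF (Fin m)) : wordWeight p [] = 1 := by
  simp [wordWeight]

theorem weight_pos (hp : ∀ i, 0 < p i) (i : Fin m) : 0 < (p i).toReal :=
  ENNReal.toReal_pos (hp i).ne' (p.apply_ne_top i)

theorem weight_le_one (p : PMF (Fin m)) (i : Fin m) : (p i).toReal ≤ 1 :=
  ENNReal.toReal_le_of_le_ofReal zero_le_one (by simpa using p.coe_le_one i)

theorem sum_pmf (p : PMF (Fin m)) : ∑ i, p i = 1 := by
  rw [← tsum_fintype (L := .unconditional _), p.tsum_coe]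

theorem sum_weight (p : PMF (Fin m)) : ∑ i, (p i).toReal = 1 := by
  rw [← ENNReal.toReal_sum fun i _ => p.apply_ne_top i, sum_pmf, ENNReal.toReal_one]

theorem wordWeight_pos (hp : ∀ i, 0 < p i) (w : List (Fin m)) : 0 < wordWeight p w :=
  List.prod_pos (by simpa using fun i _ => weight_pos hp i)

theorem wordWeight_nonneg (p : PMF (Fin m)) (w : List (Fin m)) : 0 ≤ wordWeight p w :=
  List.prod_nonneg (by simp)

theorem wordWeight_le_one (p : PMF (Fin m)) (w : List (Fin m)) : wordWeight p w ≤ 1 := by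
  induction w with
  | nil => simp [wordWeight_nil]
  | cons a v ih =>
    rw [wordWeight_cons]
    exact mul_le_one₀ (weight_le_one p a) (wordWeight_nonneg p v) ih

theorem wordWeight_ofFn (p : PMF (Fin m)) {k : ℕ} (w : Fin k → Fin m) :
    wordWeight p (List.ofFn w) = ∏ j, (p (w j)).toReal := by
  simp [wordWeight, List.prod_ofFn]

theorem bernoulliMeasure_cylinder (p : PMF (Fin m)) {k : ℕ} (w : Fin k → Fin m) :
    bernoulliMeasure p (cylinder w) = ∏ j, p (w j) := by
  let t : ℕ → Set (Fin m) := fun n => if h : n < k then {w ⟨n, h⟩} else Set.univ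
  have ht : cylinder w = Set.pi (Finset.range k) t := by
    ext i
    simp only [cylinder, Set.mem_ofPred_eq, Set.mem_pi, Finset.coe_range, Set.mem_Iio]
    exact ⟨fun hi n hn => by simpa [t, hn] using hi ⟨n, hn⟩,
      fun hi j => by simpa [t] using hi j j.2⟩
  rw [ht, bernoulliMeasure, Measure.infinitePi_pi _ (fun _ _ => MeasurableSet.of_discrete),
    ← Fin.prod_univ_eq_prod_range (fun n => p.toMeasure (t n)) k]
  exact Finset.prod_congr rfl fun j _ => by simp [t]

theorem bernoulliMeasure_real_cylinder (p : PMF (Fin m)) {k : ℕ} (w : Fin k → Fin m) :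
    (bernoulliMeasure p).real (cylinder w) = wordWeight p (List.ofFn w) := by
  rw [Measure.real, bernoulliMeasure_cylinder, ENNReal.toReal_prod, wordWeight_ofFn]

/-- The term `φ^s(T_𝐢)^{1-q} p_𝐢^q` of a level sum. -/
noncomputable def wordTerm (T : Fin m → E N →L[ℝ] E N) (p : PMF (Fin m)) (q s : ℝ)
    (w : List (Fin m)) : ℝ :=
  singularValueFunction s (wordMap T w) ^ (1 - q) * wordWeight p w ^ q

theorem levelSum_eq (T : Fin m → E N →L[ℝ] E N) (p : PMF (Fin m)) (q s : ℝ) (k : ℕ) :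
    levelSum T (bernoulliMeasure p) q s k =
      ∑ w : Fin k → Fin m, wordTerm T p q s (List.ofFn w) := by
  simp only [levelSum, wordTerm, bernoulliMeasure_real_cylinder]

theorem wordTerm_pos (hT : NormBounds T ρ c) (hp : ∀ i, 0 < p i) (hs : 0 < s)
    (w : List (Fin m)) : 0 < wordTerm T p q s w :=
  mul_pos (Real.rpow_pos_of_pos (singularValueFunction_pos (hT.wordMap_injective w) hs) _)
    (Real.rpow_pos_of_pos (wordWeight_pos hp w) _)

theorem wordTerm_mul_le (hT : NormBounds T ρ c) (hs : 0 < s) (hq : 1 ≤ q) (u v : List (Fin m)) :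
    wordTerm T p q s u * wordTerm T p q s v ≤ wordTerm T p q s (u ++ v) := by
  rw [wordTerm, wordTerm, wordTerm, wordWeight_append, mul_mul_mul_comm,
    ← Real.mul_rpow (singularValueFunction_nonneg _ hs) (singularValueFunction_nonneg _ hs),
    ← Real.mul_rpow (wordWeight_nonneg p u) (wordWeight_nonneg p v)]
  refine mul_le_mul_of_nonneg_right ?_
    (Real.rpow_nonneg (mul_nonneg (wordWeight_nonneg p u) (wordWeight_nonneg p v)) _)
  refine Real.rpow_le_rpow_of_nonpos
    (singularValueFunction_pos (hT.wordMap_injective (u ++ v)) hs) ?_ (by linarith)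
  rw [wordMap_append]
  exact singularValueFunction_mul_le _ _ hs

theorem levelSum_pos (hm : 1 ≤ m) (hT : NormBounds T ρ c) (hp : ∀ i, 0 < p i) (hs : 0 < s)
    (k : ℕ) : 0 < levelSum T (bernoulliMeasure p) q s k := by
  rw [levelSum_eq]
  have : Nonempty (Fin m) := ⟨⟨0, hm⟩⟩
  exact Finset.sum_pos (fun w _ => wordTerm_pos hT hp hs _) Finset.univ_nonempty

theorem levelSum_mul_le (hT : NormBounds T ρ c) (hs : 0 < s) (hq : 1 ≤ q) (k l : ℕ) :
    levelSum T (bernoulliMeasure p) q s k * levelSum T (bernoulliMeasure p) q s l ≤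
      levelSum T (bernoulliMeasure p) q s (k + l) := by
  rw [levelSum_eq, levelSum_eq, levelSum_eq, Finset.sum_mul_sum, ← Fintype.sum_prod_type',
    ← (Fin.appendEquiv k l).sum_comp]
  refine Finset.sum_le_sum fun x _ => ?_
  rw [show List.ofFn (Fin.appendEquiv k l x) = List.ofFn x.1 ++ List.ofFn x.2 from
    List.ofFn_fin_append x.1 x.2]
  exact wordTerm_mul_le hT hs hq _ _

theorem rpow_neg_mul_pow {a : ℝ} (ha : 0 ≤ a) (s t : ℝ) (n : ℕ) :
    (a ^ (-(s * t))) ^ n = ((a ^ n) ^ s) ^ (-t) := by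
  rw [← Real.rpow_natCast, ← Real.rpow_natCast, ← Real.rpow_mul ha, ← Real.rpow_mul ha,
    ← Real.rpow_mul ha]
  congr 1
  ring

theorem mul_wordTerm_le_wordTerm_add (hN : 1 ≤ N) (hT : NormBounds T ρ c) (hs : 0 < s)
    (hq : 1 ≤ q) (hh : 0 ≤ h) (w : List (Fin m)) :
    (ρ ^ (-(h * (q - 1)))) ^ w.length * wordTerm T p q s w ≤ wordTerm T p q (s + h) w := by
  have hρ := hT.upper_pos
  have hφ := singularValueFunction_nonneg (wordMap T w) hs
  rw [rpow_neg_mul_pow hρ.le, wordTerm, wordTerm, ← mul_assoc, neg_sub,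
    ← Real.mul_rpow (by positivity) hφ, mul_comm _ (singularValueFunction s _)]
  exact mul_le_mul_of_nonneg_right (Real.rpow_le_rpow_of_nonpos
    (singularValueFunction_pos (hT.wordMap_injective w) (add_pos_of_pos_of_nonneg hs hh))
    (singularValueFunction_add_le hN hs hh (hT.norm_wordMap_le w)) (by linarith))
    (Real.rpow_nonneg (wordWeight_nonneg p w) _)

theorem wordTerm_add_le (hN : 1 ≤ N) (hT : NormBounds T ρ c) (hs : 0 < s) (hq : 1 ≤ q)
    (hh : 0 ≤ h) (w : List (Fin m)) :
    wordTerm T p q (s + h) w ≤ (c ^ (-(h * (q - 1)))) ^ w.length * wordTerm T p q s w := by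
  have hc := hT.lower_pos
  have hφ := singularValueFunction_pos (hT.wordMap_injective w) hs
  rw [rpow_neg_mul_pow hc.le, wordTerm, wordTerm, ← mul_assoc, neg_sub,
    ← Real.mul_rpow (by positivity) hφ.le, mul_comm _ (singularValueFunction s _)]
  exact mul_le_mul_of_nonneg_right (Real.rpow_le_rpow_of_nonpos (by positivity)
    (le_singularValueFunction_add hN hs hh (by positivity) (hT.mul_norm_le_wordMap w))
    (by linarith)) (Real.rpow_nonneg (wordWeight_nonneg p w) _)

theorem mul_wordWeight_rpow_le_wordTerm (hN : 1 ≤ N) (hT : NormBounds T ρ c) (hs : 0 < s)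
    (hq : 1 ≤ q) (w : List (Fin m)) :
    (ρ ^ (-(s * (q - 1)))) ^ w.length * wordWeight p w ^ q ≤ wordTerm T p q s w := by
  rw [rpow_neg_mul_pow hT.upper_pos.le, wordTerm, neg_sub]
  exact mul_le_mul_of_nonneg_right (Real.rpow_le_rpow_of_nonpos
    (singularValueFunction_pos (hT.wordMap_injective w) hs)
    (singularValueFunction_le_rpow hN hs (hT.norm_wordMap_le w)) (by linarith))
    (Real.rpow_nonneg (wordWeight_nonneg p w) _)

theorem wordTerm_le_mul_wordWeight_rpow (hN : 1 ≤ N) (hT : NormBounds T ρ c) (hs : 0 < s)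
    (hq : 1 ≤ q) (w : List (Fin m)) :
    wordTerm T p q s w ≤ (c ^ (-(s * (q - 1)))) ^ w.length * wordWeight p w ^ q := by
  have hc := hT.lower_pos
  rw [rpow_neg_mul_pow hc.le, wordTerm, neg_sub]
  exact mul_le_mul_of_nonneg_right (Real.rpow_le_rpow_of_nonpos (by positivity)
    (rpow_le_singularValueFunction hN hs (by positivity) (hT.mul_norm_le_wordMap w))
    (by linarith)) (Real.rpow_nonneg (wordWeight_nonneg p w) _)

theorem wordTerm_exponent_add_le (hN : 1 ≤ N) (hT : NormBounds T ρ c) (hp : ∀ i, 0 < p i)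
    (hs : 0 < s) (hh : 0 ≤ h) (w : List (Fin m)) :
    wordTerm T p (q + h) s w ≤ (c ^ (-(s * h))) ^ w.length * wordTerm T p q s w := by
  have hc := hT.lower_pos
  have hφ := singularValueFunction_pos (hT.wordMap_injective w) hs
  have hterm := (wordTerm_pos (q := q) hT hp hs w).le
  have hφh : singularValueFunction s (wordMap T w) ^ (-h) ≤ ((c ^ w.length) ^ s) ^ (-h) :=
    Real.rpow_le_rpow_of_nonpos (by positivity)
      (rpow_le_singularValueFunction hN hs (by positivity) (hT.mul_norm_le_wordMap w))
      (by linarith)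
  have hwh : wordWeight p w ^ h ≤ 1 :=
    Real.rpow_le_one (wordWeight_nonneg p w) (wordWeight_le_one p w) hh
  calc wordTerm T p (q + h) s w = singularValueFunction s (wordMap T w) ^ (-h) *
        wordTerm T p q s w * wordWeight p w ^ h := by
        rw [wordTerm, wordTerm, Real.rpow_add (wordWeight_pos hp w),
          show 1 - (q + h) = (1 - q) + -h by ring, Real.rpow_add hφ]
        ring
    _ ≤ ((c ^ w.length) ^ s) ^ (-h) * wordTerm T p q s w * 1 := by
        gcongr
        exact Real.rpow_nonneg (wordWeight_nonneg p w) _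
    _ = (c ^ (-(s * h))) ^ w.length * wordTerm T p q s w := by
        rw [mul_one, rpow_neg_mul_pow hc.le]

theorem sum_wordWeight_rpow (p : PMF (Fin m)) (q : ℝ) (k : ℕ) :
    ∑ w : Fin k → Fin m, wordWeight p (List.ofFn w) ^ q = (∑ i, (p i).toReal ^ q) ^ k := by
  rw [Fintype.sum_pow]
  refine Finset.sum_congr rfl fun w _ => ?_
  rw [wordWeight_ofFn, ← Real.finsetProd_rpow _ _ fun i _ => by simp]

end Words

section Pressure

variable {N m : ℕ} {T : Fin m → E N →L[ℝ] E N} {ρ c : ℝ} {p : PMF (Fin m)} {q s h : ℝ}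

theorem mul_levelSum_le_levelSum_add (hN : 1 ≤ N) (hT : NormBounds T ρ c) (hs : 0 < s)
    (hq : 1 ≤ q) (hh : 0 ≤ h) (k : ℕ) :
    (ρ ^ (-(h * (q - 1)))) ^ k * levelSum T (bernoulliMeasure p) q s k ≤
      levelSum T (bernoulliMeasure p) q (s + h) k := by
  simp only [levelSum_eq, Finset.mul_sum]
  refine Finset.sum_le_sum fun w _ => ?_
  simpa using mul_wordTerm_le_wordTerm_add hN hT hs hq hh (List.ofFn w)

theorem levelSum_add_le (hN : 1 ≤ N) (hT : NormBounds T ρ c) (hs : 0 < s) (hq : 1 ≤ q)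
    (hh : 0 ≤ h) (k : ℕ) :
    levelSum T (bernoulliMeasure p) q (s + h) k ≤
      (c ^ (-(h * (q - 1)))) ^ k * levelSum T (bernoulliMeasure p) q s k := by
  simp only [levelSum_eq, Finset.mul_sum]
  refine Finset.sum_le_sum fun w _ => ?_
  simpa using wordTerm_add_le hN hT hs hq hh (List.ofFn w)

theorem mul_sum_weight_rpow_pow_le_levelSum (hN : 1 ≤ N) (hT : NormBounds T ρ c) (hs : 0 < s)
    (hq : 1 ≤ q) (k : ℕ) :
    (ρ ^ (-(s * (q - 1)))) ^ k * (∑ i, (p i).toReal ^ q) ^ k ≤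
      levelSum T (bernoulliMeasure p) q s k := by
  simp only [levelSum_eq, ← sum_wordWeight_rpow, Finset.mul_sum]
  refine Finset.sum_le_sum fun w _ => ?_
  simpa using mul_wordWeight_rpow_le_wordTerm hN hT hs hq (List.ofFn w)

theorem levelSum_le_mul_sum_weight_rpow_pow (hN : 1 ≤ N) (hT : NormBounds T ρ c) (hs : 0 < s)
    (hq : 1 ≤ q) (k : ℕ) :
    levelSum T (bernoulliMeasure p) q s k ≤
      (c ^ (-(s * (q - 1)))) ^ k * (∑ i, (p i).toReal ^ q) ^ k := by
  simp only [levelSum_eq, ← sum_wordWeight_rpow, Finset.mul_sum]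
  refine Finset.sum_le_sum fun w _ => ?_
  simpa using wordTerm_le_mul_wordWeight_rpow hN hT hs hq (List.ofFn w)

theorem levelSum_exponent_add_le (hN : 1 ≤ N) (hT : NormBounds T ρ c) (hp : ∀ i, 0 < p i)
    (hs : 0 < s) (hh : 0 ≤ h) (k : ℕ) :
    levelSum T (bernoulliMeasure p) (q + h) s k ≤
      (c ^ (-(s * h))) ^ k * levelSum T (bernoulliMeasure p) q s k := by
  simp only [levelSum_eq, Finset.mul_sum]
  refine Finset.sum_le_sum fun w _ => ?_
  simpa using wordTerm_exponent_add_le (q := q) hN hT hp hs hh (List.ofFn w)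

theorem sum_weight_rpow_pos (hm : 1 ≤ m) (hp : ∀ i, 0 < p i) : 0 < ∑ i, (p i).toReal ^ q := by
  have : Nonempty (Fin m) := ⟨⟨0, hm⟩⟩
  exact Finset.sum_pos (fun i _ => Real.rpow_pos_of_pos (weight_pos hp i) _)
    Finset.univ_nonempty

theorem weight_lt_one (hm : 2 ≤ m) (hp : ∀ i, 0 < p i) (i : Fin m) : (p i).toReal < 1 := by
  have : Nontrivial (Fin m) := Fin.nontrivial_iff_two_le.2 hm
  obtain ⟨j, hj⟩ := exists_ne i
  have hpair : (p i).toReal + (p j).toReal ≤ ∑ k, (p k).toReal := by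
    rw [← Finset.sum_pair (f := fun k => (p k).toReal) hj.symm]
    exact Finset.sum_le_sum_of_subset_of_nonneg (Finset.subset_univ _)
      fun k _ _ => ENNReal.toReal_nonneg
  linarith [weight_pos hp j, sum_weight p]

theorem sum_weight_rpow_lt_one (hm : 2 ≤ m) (hp : ∀ i, 0 < p i) (hq : 1 < q) :
    ∑ i, (p i).toReal ^ q < 1 := by
  have : Nonempty (Fin m) := ⟨⟨0, by omega⟩⟩
  rw [← sum_weight p]
  refine Finset.sum_lt_sum_of_nonempty Finset.univ_nonempty fun i _ => ?_
  simpa using Real.rpow_lt_rpow_of_exponent_gt (weight_pos hp i) (weight_lt_one hm hp i) hq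

/-- The topological pressure `lim_k (1/k) log ∑_{|𝐢| = k} φ^s(T_𝐢)^{1-q} p_𝐢^q`, whose zero in `s`
is the critical exponent `d_q`. -/
noncomputable def pressure (T : Fin m → E N →L[ℝ] E N) (p : PMF (Fin m)) (q s : ℝ) : ℝ :=
  limUnder atTop fun k : ℕ => Real.log (levelSum T (bernoulliMeasure p) q s k) / k

theorem log_levelSum_le (hN : 1 ≤ N) (hm : 1 ≤ m) (hT : NormBounds T ρ c)
    (hp : ∀ i, 0 < p i) (hs : 0 < s) (hq : 1 ≤ q) (k : ℕ) :
    Real.log (levelSum T (bernoulliMeasure p) q s k) ≤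
      k * Real.log (c ^ (-(s * (q - 1))) * ∑ i, (p i).toReal ^ q) := by
  rw [← Real.log_pow, mul_pow]
  exact Real.log_le_log (levelSum_pos hm hT hp hs k)
    (levelSum_le_mul_sum_weight_rpow_pow hN hT hs hq k)

theorem tendsto_pressure (hN : 1 ≤ N) (hm : 1 ≤ m) (hT : NormBounds T ρ c)
    (hp : ∀ i, 0 < p i) (hs : 0 < s) (hq : 1 ≤ q) :
    Tendsto (fun k : ℕ => Real.log (levelSum T (bernoulliMeasure p) q s k) / k) atTop
      (𝓝 (pressure T p q s)) := by
  have hpos := levelSum_pos (q := q) hm hT hp hs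
  have hsub : Subadditive fun k => -Real.log (levelSum T (bernoulliMeasure p) q s k) := by
    intro k l
    have hlog := Real.log_le_log (mul_pos (hpos k) (hpos l)) (levelSum_mul_le hT hs hq k l)
    rw [Real.log_mul (hpos k).ne' (hpos l).ne'] at hlog
    linarith
  have hbdd : BddBelow (Set.range fun k : ℕ =>
      -Real.log (levelSum T (bernoulliMeasure p) q s k) / k) := by
    refine ⟨-|Real.log (c ^ (-(s * (q - 1))) * ∑ i, (p i).toReal ^ q)|, ?_⟩
    rintro _ ⟨k, rfl⟩
    dsimp only
    rw [neg_div]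
    refine neg_le_neg (div_le_of_le_mul₀ k.cast_nonneg (abs_nonneg _) ?_)
    refine (log_levelSum_le hN hm hT hp hs hq k).trans ?_
    rw [mul_comm]
    exact mul_le_mul_of_nonneg_right (le_abs_self _) k.cast_nonneg
  refine tendsto_nhds_limUnder ⟨-hsub.lim, (hsub.tendsto_lim hbdd).neg.congr fun k => ?_⟩
  rw [neg_div, neg_neg]

section GrowthRate

variable {u v : ℕ → ℝ} {x y A : ℝ}

private theorem tendsto_log_pow_mul_div (hA : 0 < A) (hv0 : ∀ k, 0 < v k)
    (hv : Tendsto (fun k : ℕ => Real.log (v k) / k) atTop (𝓝 y)) :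
    Tendsto (fun k : ℕ => Real.log (A ^ k * v k) / k) atTop (𝓝 (Real.log A + y)) := by
  refine (hv.const_add _).congr' ?_
  filter_upwards [eventually_ne_atTop 0] with k hk
  rw [Real.log_mul (pow_pos hA k).ne' (hv0 k).ne', Real.log_pow, add_div,
    mul_div_cancel_left₀ _ (Nat.cast_ne_zero.2 hk)]

theorem log_add_le_of_pow_mul_le (hA : 0 < A) (hv0 : ∀ k, 0 < v k)
    (hu : Tendsto (fun k : ℕ => Real.log (u k) / k) atTop (𝓝 x))
    (hv : Tendsto (fun k : ℕ => Real.log (v k) / k) atTop (𝓝 y))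
    (huv : ∀ k, A ^ k * v k ≤ u k) : Real.log A + y ≤ x :=
  le_of_tendsto_of_tendsto' (tendsto_log_pow_mul_div hA hv0 hv) hu fun k =>
    div_le_div_of_nonneg_right (Real.log_le_log (mul_pos (pow_pos hA k) (hv0 k)) (huv k))
      k.cast_nonneg

theorem le_log_add_of_le_pow_mul (hA : 0 < A) (hu0 : ∀ k, 0 < u k) (hv0 : ∀ k, 0 < v k)
    (hu : Tendsto (fun k : ℕ => Real.log (u k) / k) atTop (𝓝 x))
    (hv : Tendsto (fun k : ℕ => Real.log (v k) / k) atTop (𝓝 y))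
    (huv : ∀ k, u k ≤ A ^ k * v k) : x ≤ Real.log A + y :=
  le_of_tendsto_of_tendsto' hu (tendsto_log_pow_mul_div hA hv0 hv) fun k =>
    div_le_div_of_nonneg_right (Real.log_le_log (hu0 k) (huv k)) k.cast_nonneg

theorem tendsto_log_pow_div (A : ℝ) :
    Tendsto (fun k : ℕ => Real.log (A ^ k) / k) atTop (𝓝 (Real.log A)) := by
  refine tendsto_const_nhds.congr' ?_
  filter_upwards [eventually_ne_atTop 0] with k hk
  rw [Real.log_pow, mul_div_cancel_left₀ _ (Nat.cast_ne_zero.2 hk)]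

end GrowthRate

theorem le_pressure (hN : 1 ≤ N) (hm : 1 ≤ m) (hT : NormBounds T ρ c)
    (hp : ∀ i, 0 < p i) (hs : 0 < s) (hq : 1 ≤ q) :
    -(s * (q - 1)) * Real.log ρ + Real.log (∑ i, (p i).toReal ^ q) ≤ pressure T p q s := by
  rw [← Real.log_rpow hT.upper_pos]
  exact log_add_le_of_pow_mul_le (Real.rpow_pos_of_pos hT.upper_pos _)
    (fun k => pow_pos (sum_weight_rpow_pos hm hp) k) (tendsto_pressure hN hm hT hp hs hq)
    (tendsto_log_pow_div _) (mul_sum_weight_rpow_pow_le_levelSum hN hT hs hq)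

theorem pressure_le (hN : 1 ≤ N) (hm : 1 ≤ m) (hT : NormBounds T ρ c)
    (hp : ∀ i, 0 < p i) (hs : 0 < s) (hq : 1 ≤ q) :
    pressure T p q s ≤ -(s * (q - 1)) * Real.log c + Real.log (∑ i, (p i).toReal ^ q) := by
  rw [← Real.log_rpow hT.lower_pos]
  exact le_log_add_of_le_pow_mul (Real.rpow_pos_of_pos hT.lower_pos _)
    (levelSum_pos hm hT hp hs) (fun k => pow_pos (sum_weight_rpow_pos hm hp) k)
    (tendsto_pressure hN hm hT hp hs hq) (tendsto_log_pow_div _)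
    (levelSum_le_mul_sum_weight_rpow_pow hN hT hs hq)

theorem add_pressure_le_pressure_add (hN : 1 ≤ N) (hm : 1 ≤ m) (hT : NormBounds T ρ c)
    (hp : ∀ i, 0 < p i) (hs : 0 < s) (hq : 1 ≤ q) (hh : 0 ≤ h) :
    -(h * (q - 1)) * Real.log ρ + pressure T p q s ≤ pressure T p q (s + h) := by
  rw [← Real.log_rpow hT.upper_pos]
  exact log_add_le_of_pow_mul_le (Real.rpow_pos_of_pos hT.upper_pos _)
    (levelSum_pos hm hT hp hs) (tendsto_pressure hN hm hT hp (add_pos_of_pos_of_nonneg hs hh) hq)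
    (tendsto_pressure hN hm hT hp hs hq) (mul_levelSum_le_levelSum_add hN hT hs hq hh)

theorem pressure_add_le (hN : 1 ≤ N) (hm : 1 ≤ m) (hT : NormBounds T ρ c)
    (hp : ∀ i, 0 < p i) (hs : 0 < s) (hq : 1 ≤ q) (hh : 0 ≤ h) :
    pressure T p q (s + h) ≤ -(h * (q - 1)) * Real.log c + pressure T p q s := by
  have hsh : 0 < s + h := add_pos_of_pos_of_nonneg hs hh
  rw [← Real.log_rpow hT.lower_pos]
  exact le_log_add_of_le_pow_mul (Real.rpow_pos_of_pos hT.lower_pos _)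
    (levelSum_pos hm hT hp hsh) (levelSum_pos hm hT hp hs)
    (tendsto_pressure hN hm hT hp hsh hq) (tendsto_pressure hN hm hT hp hs hq)
    (levelSum_add_le hN hT hs hq hh)

theorem pressure_exponent_add_le (hN : 1 ≤ N) (hm : 1 ≤ m) (hT : NormBounds T ρ c)
    (hp : ∀ i, 0 < p i) (hs : 0 < s) (hq : 1 ≤ q) (hh : 0 ≤ h) :
    pressure T p (q + h) s ≤ -(s * h) * Real.log c + pressure T p q s := by
  rw [← Real.log_rpow hT.lower_pos]
  exact le_log_add_of_le_pow_mul (Real.rpow_pos_of_pos hT.lower_pos _)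
    (levelSum_pos hm hT hp hs) (levelSum_pos hm hT hp hs)
    (tendsto_pressure hN hm hT hp hs (by linarith)) (tendsto_pressure hN hm hT hp hs hq)
    (levelSum_exponent_add_le hN hT hp hs hh)

theorem strictMonoOn_pressure (hN : 1 ≤ N) (hm : 1 ≤ m) (hT : NormBounds T ρ c)
    (hp : ∀ i, 0 < p i) (hq : 1 < q) : StrictMonoOn (pressure T p q) (Set.Ioi 0) := by
  intro s hs t _ hst
  have hadd := add_pressure_le_pressure_add hN hm hT hp hs hq.le (sub_nonneg.2 hst.le)
  rw [add_sub_cancel] at hadd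
  have hlog := Real.log_neg hT.upper_pos hT.upper_lt_one
  have hpos : 0 < (t - s) * (q - 1) := mul_pos (sub_pos.2 hst) (sub_pos.2 hq)
  nlinarith

theorem dist_pressure_le (hN : 1 ≤ N) (hm : 1 ≤ m) (hT : NormBounds T ρ c)
    (hp : ∀ i, 0 < p i) (hq : 1 ≤ q) {t : ℝ} (hs : 0 < s) (hst : s ≤ t) :
    dist (pressure T p q s) (pressure T p q t) ≤ (q - 1) * -Real.log c * dist s t := by
  have hlower := add_pressure_le_pressure_add hN hm hT hp hs hq (sub_nonneg.2 hst)
  have hupper := pressure_add_le hN hm hT hp hs hq (sub_nonneg.2 hst)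
  rw [add_sub_cancel] at hlower hupper
  have hρ := Real.log_neg hT.upper_pos hT.upper_lt_one
  have hnonneg : 0 ≤ (t - s) * (q - 1) := mul_nonneg (sub_nonneg.2 hst) (sub_nonneg.2 hq)
  rw [dist_comm, dist_comm s, Real.dist_eq, Real.dist_eq, abs_of_nonneg (sub_nonneg.2 hst),
    abs_of_nonneg (by nlinarith)]
  linarith

theorem continuousOn_pressure (hN : 1 ≤ N) (hm : 1 ≤ m) (hT : NormBounds T ρ c)
    (hp : ∀ i, 0 < p i) (hq : 1 ≤ q) : ContinuousOn (pressure T p q) (Set.Ioi 0) := by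
  have hnonneg : 0 ≤ (q - 1) * -Real.log c :=
    mul_nonneg (sub_nonneg.2 hq) (neg_nonneg.2 (Real.log_neg hT.lower_pos hT.lower_lt_one).le)
  refine (LipschitzOnWith.of_dist_le_mul (K := Real.toNNReal ((q - 1) * -Real.log c))
    fun s hs t ht => ?_).continuousOn
  rw [Real.coe_toNNReal _ hnonneg]
  rcases le_total s t with hst | hts
  · exact dist_pressure_le hN hm hT hp hq hs hst
  · rw [dist_comm, dist_comm s]
    exact dist_pressure_le hN hm hT hp hq ht hts

theorem isCriticalExponent_iff (hN : 1 ≤ N) (hm : 1 ≤ m) (hT : NormBounds T ρ c)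
    (hp : ∀ i, 0 < p i) (hq : 1 ≤ q) :
    IsCriticalExponent T (bernoulliMeasure p) q s ↔ 0 < s ∧ pressure T p q s = 0 := by
  refine and_congr_right fun hs => ?_
  have hexp : Tendsto (fun k : ℕ => levelSum T (bernoulliMeasure p) q s k ^ (1 / (k : ℝ))) atTop
      (𝓝 (Real.exp (pressure T p q s))) := by
    refine ((Real.continuous_exp.tendsto _).comp
      (tendsto_pressure hN hm hT hp hs hq)).congr fun k => ?_
    rw [Function.comp_apply, Real.rpow_def_of_pos (levelSum_pos hm hT hp hs k), mul_one_div]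
  constructor
  · intro hlim
    exact (Real.exp_eq_one_iff _).1 (tendsto_nhds_unique hexp hlim)
  · intro hzero
    rwa [hzero, Real.exp_zero] at hexp

theorem exists_pressure_eq_zero (hN : 1 ≤ N) (hm : 2 ≤ m) (hT : NormBounds T ρ c)
    (hp : ∀ i, 0 < p i) (hq : 1 < q) : ∃ s, 0 < s ∧ pressure T p q s = 0 := by
  have hm1 : 1 ≤ m := by omega
  have hq0 : 0 < q - 1 := sub_pos.2 hq
  set Q := Real.log (∑ i, (p i).toReal ^ q)
  have hQ0 : Q < 0 := Real.log_neg (sum_weight_rpow_pos hm1 hp) (sum_weight_rpow_lt_one hm hp hq)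
  have hroot_pos : ∀ {a : ℝ}, 0 < a → a < 1 → 0 < Q / ((q - 1) * Real.log a) := fun ha ha1 =>
    div_pos_of_neg_of_neg hQ0 (mul_neg_of_pos_of_neg hq0 (Real.log_neg ha ha1))
  have hroot : ∀ {a : ℝ}, 0 < a → a < 1 →
      -(Q / ((q - 1) * Real.log a) * (q - 1)) * Real.log a + Q = 0 := by
    intro a ha ha1
    have := (Real.log_neg ha ha1).ne
    have := hq0.ne'
    field_simp
    ring
  have hs := hroot_pos hT.lower_pos hT.lower_lt_one
  have ht := hroot_pos hT.upper_pos hT.upper_lt_one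
  have hle := (pressure_le hN hm1 hT hp hs hq.le).trans_eq (hroot hT.lower_pos hT.lower_lt_one)
  have hge := (hroot hT.upper_pos hT.upper_lt_one).symm.trans_le
    (le_pressure hN hm1 hT hp ht hq.le)
  have hst := ((strictMonoOn_pressure hN hm1 hT hp hq).le_iff_le hs ht).1 (hle.trans hge)
  obtain ⟨d, hd, hd0⟩ := intermediate_value_Icc hst
    ((continuousOn_pressure hN hm1 hT hp hq.le).mono fun x hx => hs.trans_le hx.1) ⟨hle, hge⟩
  exact ⟨d, hs.trans_le hd.1, hd0⟩

end Pressure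

section ProductLaws

variable {ι κ X : Type*}

/-- The infinite word `b j₀ j₁ j₂ …` obtained by prepending the letter `b` to `j`. -/
def consWord (b : X) (j : ℕ → X) : ℕ → X
  | 0 => b
  | n + 1 => j n

theorem preimage_consWord_pi_range (t : ℕ → Set X) (k : ℕ) :
    (fun x : X × (ℕ → X) => consWord x.1 x.2) ⁻¹' Set.pi (Finset.range (k + 1)) t =
      t 0 ×ˢ Set.pi (Finset.range k) fun n => t (n + 1) := by
  ext ⟨b, j⟩
  simp only [Set.mem_preimage, Set.mem_pi, Set.mem_prod, Finset.mem_coe, Finset.mem_range]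
  refine ⟨fun h => ⟨h 0 k.succ_pos, fun n hn => h (n + 1) (Nat.succ_lt_succ hn)⟩, ?_⟩
  rintro ⟨h0, hsucc⟩ (_ | n) hn
  · exact h0
  · exact hsucc n (Nat.lt_of_succ_lt_succ hn)

variable [MeasurableSpace X]

theorem map_comp_infinitePi (ν : Measure X) [IsProbabilityMeasure ν] {f : ι → κ}
    (hf : Function.Injective f) :
    (Measure.infinitePi fun _ : κ => ν).map (fun ω i => ω (f i)) =
      Measure.infinitePi fun _ : ι => ν := by
  refine Measure.eq_infinitePi (μ := fun _ : ι => ν) fun s t ht => ?_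
  rw [Measure.map_apply (by fun_prop) (MeasurableSet.pi s.countable_toSet fun i _ => ht i)]
  have hpre : (fun (ω : κ → X) i => ω (f i)) ⁻¹' Set.pi s t =
      Set.pi (s.map ⟨f, hf⟩) (Function.extend f t fun _ => Set.univ) := by
    ext ω
    simp [Set.mem_pi, hf.extend_apply]
  rw [hpre, Measure.infinitePi_pi, Finset.prod_map]
  · simp [hf.extend_apply]
  · simpa [hf.extend_apply] using fun i _ => ht i

theorem map_ite_mem_prod_infinitePi (ν : Measure X) [IsProbabilityMeasure ν] (S : Set ι)
    [DecidablePred (· ∈ S)] :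
    ((Measure.infinitePi fun _ : ι => ν).prod (Measure.infinitePi fun _ : ι => ν)).map
      (fun x i => if i ∈ S then x.1 i else x.2 i) = Measure.infinitePi fun _ : ι => ν := by
  have hmeas : Measurable fun (x : (ι → X) × (ι → X)) (i : ι) =>
      if i ∈ S then x.1 i else x.2 i := by
    refine measurable_pi_lambda _ fun i => ?_
    split_ifs <;> fun_prop
  refine Measure.eq_infinitePi (μ := fun _ : ι => ν) fun s t ht => ?_
  rw [Measure.map_apply hmeas (MeasurableSet.pi s.countable_toSet fun i _ => ht i)]
  have hpre : (fun (x : (ι → X) × (ι → X)) (i : ι) => if i ∈ S then x.1 i else x.2 i) ⁻¹'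
      Set.pi s t = (Set.pi (s.filter (· ∈ S)) t) ×ˢ (Set.pi (s.filter (· ∉ S)) t) := by
    ext x
    simp only [Set.mem_preimage, Set.mem_pi, Set.mem_prod, Finset.mem_coe, Finset.mem_filter]
    grind
  rw [hpre, Measure.prod_prod, Measure.infinitePi_pi _ fun k _ => ht k,
    Measure.infinitePi_pi _ fun k _ => ht k, Finset.prod_filter_mul_prod_filter_not]

theorem measurable_consWord : Measurable fun x : X × (ℕ → X) => consWord x.1 x.2 := by
  refine measurable_pi_lambda _ fun n => ?_
  cases n with
  | zero => exact measurable_fst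
  | succ n => exact (measurable_pi_apply n).comp measurable_snd

theorem map_consWord_prod_infinitePi (ν : Measure X) [IsProbabilityMeasure ν] :
    (ν.prod (Measure.infinitePi fun _ : ℕ => ν)).map (fun x => consWord x.1 x.2) =
      Measure.infinitePi fun _ : ℕ => ν := by
  classical
  refine Measure.eq_infinitePi (μ := fun _ : ℕ => ν) fun s t ht => ?_
  rw [Measure.map_apply measurable_consWord
    (MeasurableSet.pi s.countable_toSet fun i _ => ht i)]
  obtain ⟨k, hk⟩ : ∃ k, s ⊆ Finset.range (k + 1) :=
    ⟨s.sup id, fun i hi => Finset.mem_range.2 (Nat.lt_succ_of_le (Finset.le_sup (f := id) hi))⟩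
  let t' : ℕ → Set X := fun n => if n ∈ s then t n else Set.univ
  have ht' : ∀ n, MeasurableSet (t' n) := fun n => by
    simp only [t']
    split_ifs
    exacts [ht n, MeasurableSet.univ]
  have hpi : Set.pi s t = Set.pi (Finset.range (k + 1)) t' := by
    ext j
    simp only [Set.mem_pi, Finset.mem_coe, t']
    grind
  have hprod : ∏ i ∈ s, ν (t i) = ∏ i ∈ Finset.range (k + 1), ν (t' i) := by
    rw [← Finset.prod_subset hk fun i _ hi => by simp [t', hi]]
    exact Finset.prod_congr rfl fun i hi => by simp [t', hi]
  rw [hpi, preimage_consWord_pi_range, Measure.prod_prod, hprod, Finset.prod_range_succ',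
    mul_comm, Measure.infinitePi_pi _ fun n _ => ht' (n + 1)]

end ProductLaws

section CodeSpace

variable {N m : ℕ}

instance (p : PMF (Fin m)) : IsProbabilityMeasure (bernoulliMeasure p) := by
  unfold bernoulliMeasure
  infer_instance

instance (ν : Measure (E N)) [IsProbabilityMeasure ν] :
    IsProbabilityMeasure (displacementLaw m ν) := by
  unfold displacementLaw
  infer_instance

theorem lintegral_bernoulliMeasure (p : PMF (Fin m)) {f : (ℕ → Fin m) → ENNReal}
    (hf : Measurable f) :
    ∫⁻ i, f i ∂(bernoulliMeasure p) =
      ∑ b, p b * ∫⁻ j, f (consWord b j) ∂(bernoulliMeasure p) := by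
  conv_lhs => rw [bernoulliMeasure, ← map_consWord_prod_infinitePi]
  rw [lintegral_map hf measurable_consWord, lintegral_prod (fun x => f (consWord x.1 x.2))
    (hf.comp measurable_consWord).aemeasurable, lintegral_fintype]
  refine Finset.sum_congr rfl fun b _ => ?_
  rw [mul_comm, PMF.toMeasure_apply_singleton _ _ (MeasurableSet.singleton b)]
  rfl

theorem bernoulliMeasure_apply (p : PMF (Fin m)) {S : Set (ℕ → Fin m)} (hS : MeasurableSet S) :
    bernoulliMeasure p S = ∑ b, p b * bernoulliMeasure p (consWord b ⁻¹' S) := by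
  have hcons : ∀ b : Fin m, MeasurableSet (consWord b ⁻¹' S) := fun b =>
    measurable_consWord.comp measurable_prodMk_left hS
  have hsum := lintegral_bernoulliMeasure p (measurable_one.indicator hS)
  simp only [lintegral_indicator_one hS] at hsum
  rw [hsum]
  refine Finset.sum_congr rfl fun b _ => ?_
  rw [← lintegral_indicator_one (hcons b)]
  rfl

theorem curtail_consWord (b : Fin m) (j : ℕ → Fin m) (k : ℕ) :
    curtail (consWord b j) (k + 1) = b :: curtail j k := by
  simp [curtail, List.ofFn_succ, consWord]

theorem curtail_zero (j : ℕ → Fin m) : curtail j 0 = [] := by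
  simp [curtail]

theorem length_curtail (j : ℕ → Fin m) (k : ℕ) : (curtail j k).length = k := by
  simp [curtail]

variable {T : Fin m → E N →L[ℝ] E N} {ρ c R : ℝ}

theorem norm_projection_term_le (hT : NormBounds T ρ c) {ω : List (Fin m) → E N}
    (hω : ∀ w, ‖ω w‖ ≤ R) (i : ℕ → Fin m) (k : ℕ) :
    ‖wordMap T (curtail i k) (ω (curtail i (k + 1)))‖ ≤ R * ρ ^ k := by
  refine (ContinuousLinearMap.le_opNorm _ _).trans ?_
  rw [mul_comm]
  have := hT.norm_wordMap_le (curtail i k)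
  rw [length_curtail] at this
  exact mul_le_mul (hω _) this (norm_nonneg _) ((norm_nonneg _).trans (hω []))

theorem summable_projection (hT : NormBounds T ρ c) {ω : List (Fin m) → E N}
    (hω : ∀ w, ‖ω w‖ ≤ R) (i : ℕ → Fin m) :
    Summable fun k : ℕ => wordMap T (curtail i k) (ω (curtail i (k + 1))) :=
  Summable.of_norm_bounded
    ((summable_geometric_of_lt_one hT.upper_pos.le hT.upper_lt_one).mul_left R)
    (norm_projection_term_le hT hω i)

theorem norm_projection_le (hT : NormBounds T ρ c) {ω : List (Fin m) → E N}
    (hω : ∀ w, ‖ω w‖ ≤ R) (i : ℕ → Fin m) : ‖projection T ω i‖ ≤ R * (1 - ρ)⁻¹ := by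
  rw [← tsum_geometric_of_lt_one hT.upper_pos.le hT.upper_lt_one, ← tsum_mul_left]
  exact tsum_of_norm_bounded
    ((summable_geometric_of_lt_one hT.upper_pos.le hT.upper_lt_one).mul_left R).hasSum
    (norm_projection_term_le hT hω i)

theorem projection_consWord (hT : NormBounds T ρ c) {ω : List (Fin m) → E N}
    (hω : ∀ w, ‖ω w‖ ≤ R) (b : Fin m) (j : ℕ → Fin m) :
    projection T ω (consWord b j) = ω [b] + T b (projection T (fun w => ω (b :: w)) j) := by
  unfold projection
  rw [(summable_projection hT hω _).tsum_eq_zero_add,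
    (T b).map_tsum (summable_projection hT (fun w => hω (b :: w)) j)]
  congr 1
  refine tsum_congr fun k => ?_
  rw [curtail_consWord, curtail_consWord, wordMap_cons]
  rfl

/-- The truncated family of displacements, in which vectors of norm more than `R` are replaced by
`0`. It makes the projection measurable and bounded for all `ω`, not only almost surely. -/
noncomputable def clip (R : ℝ) (ω : List (Fin m) → E N) : List (Fin m) → E N :=
  fun w => if ‖ω w‖ ≤ R then ω w else 0

theorem norm_clip_le (hR : 0 ≤ R) (ω : List (Fin m) → E N) (w : List (Fin m)) :
    ‖clip R ω w‖ ≤ R := by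
  unfold clip
  split_ifs with h
  · exact h
  · simpa using hR

theorem clip_eq_self {ω : List (Fin m) → E N} (hω : ∀ w, ‖ω w‖ ≤ R) : clip R ω = ω := by
  ext1 w
  rw [clip, if_pos (hω w)]

theorem measurable_clip_apply (R : ℝ) (w : List (Fin m)) :
    Measurable fun ω : List (Fin m) → E N => clip R ω w := by
  unfold clip
  have h : Measurable fun ω : List (Fin m) → E N => ω w := measurable_pi_apply w
  exact Measurable.ite (measurableSet_le h.norm measurable_const) h measurable_const

/-- The random projection `Π^ω` of the truncated family of displacements. -/
noncomputable def clippedProjection (T : Fin m → E N →L[ℝ] E N) (R : ℝ) (ω : List (Fin m) → E N)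
    (i : ℕ → Fin m) : E N := projection T (clip R ω) i

theorem clippedProjection_consWord (hT : NormBounds T ρ c) (hR : 0 ≤ R) (ω : List (Fin m) → E N)
    (b : Fin m) (j : ℕ → Fin m) :
    clippedProjection T R ω (consWord b j) =
      clip R ω [b] + T b (clippedProjection T R (fun w => ω (b :: w)) j) :=
  projection_consWord hT (norm_clip_le hR ω) b j

theorem measurable_clippedProjection (hT : NormBounds T ρ c) (hR : 0 ≤ R) :
    Measurable fun x : (List (Fin m) → E N) × (ℕ → Fin m) => clippedProjection T R x.1 x.2 := by
  refine measurable_of_tendsto_metrizable (f := fun n x => ∑ k ∈ Finset.range n,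
    wordMap T (curtail x.2 k) (clip R x.1 (curtail x.2 (k + 1)))) (fun n => ?_) ?_
  · refine Finset.measurable_sum _ fun k _ => ?_
    let g : (List (Fin m) → E N) × (Fin (k + 1) → Fin m) → E N := fun y =>
      wordMap T (List.ofFn fun j : Fin k => y.2 j.castSucc) (clip R y.1 (List.ofFn y.2))
    have hg : Measurable g := by
      refine measurable_from_prod_countable_left fun v => ?_
      exact (wordMap T (List.ofFn fun j : Fin k => v j.castSucc)).measurable.comp
        (measurable_clip_apply R (List.ofFn v))
    have hr : Measurable fun x : (List (Fin m) → E N) × (ℕ → Fin m) =>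
        (x.1, fun j : Fin (k + 1) => x.2 j) := by fun_prop
    exact hg.comp hr
  · rw [tendsto_pi_nhds]
    intro x
    exact (summable_projection hT (norm_clip_le hR x.1) x.2).hasSum.tendsto_sum_nat

end CodeSpace

section Transfer

variable {N m : ℕ}

/-- The weighted transfer operator `f ↦ (A ↦ ∑_a p_a^{x+1} f(A T_a))`. -/
noncomputable def transfer (T : Fin m → E N →L[ℝ] E N) (p : PMF (Fin m)) (x : ℝ)
    (f : (E N →L[ℝ] E N) → ℝ≥0∞) (A : E N →L[ℝ] E N) : ℝ≥0∞ :=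
  ∑ a, p a ^ (x + 1) * f (A * T a)

/-- The function `A ↦ φ^s(A)^{-x}`. -/
noncomputable def phiNegPow (s x : ℝ) (A : E N →L[ℝ] E N) : ℝ≥0∞ :=
  ENNReal.ofReal (singularValueFunction s A) ^ (-x)

/-- The `θ`-discounted sum of the iterates of the transfer operator at `φ^s(·)^{-x}`. -/
noncomputable def potential (T : Fin m → E N →L[ℝ] E N) (p : PMF (Fin m)) (s x : ℝ) (θ : ℝ≥0∞)
    (A : E N →L[ℝ] E N) : ℝ≥0∞ :=
  ∑' k : ℕ, θ ^ k * (transfer T p x)^[k] (phiNegPow s x) A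

variable {T : Fin m → E N →L[ℝ] E N} {ρ c : ℝ} {p : PMF (Fin m)} {s x : ℝ} {θ : ℝ≥0∞}

theorem pow_mul_iterate_le_potential (k : ℕ) (A : E N →L[ℝ] E N) :
    θ ^ k * (transfer T p x)^[k] (phiNegPow s x) A ≤ potential T p s x θ A :=
  ENNReal.le_tsum (f := fun k : ℕ => θ ^ k * (transfer T p x)^[k] (phiNegPow s x) A) k

theorem phiNegPow_le_potential (A : E N →L[ℝ] E N) : phiNegPow s x A ≤ potential T p s x θ A := by
  simpa using pow_mul_iterate_le_potential (T := T) (p := p) (s := s) (x := x) (θ := θ) 0 A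

theorem mul_transfer_potential_le (A : E N →L[ℝ] E N) :
    θ * transfer T p x (potential T p s x θ) A ≤ potential T p s x θ A := by
  have hsucc : ∀ k, (transfer T p x)^[k + 1] (phiNegPow s x) A =
      ∑ a, p a ^ (x + 1) * (transfer T p x)^[k] (phiNegPow s x) (A * T a) := fun k => by
    rw [Function.iterate_succ_apply']
    rfl
  calc θ * transfer T p x (potential T p s x θ) A
      = ∑' k : ℕ, θ ^ (k + 1) * (transfer T p x)^[k + 1] (phiNegPow s x) A := by
        simp only [hsucc, transfer, potential, Finset.mul_sum, ← ENNReal.tsum_mul_left]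
        rw [Summable.tsum_finsetSum fun _ _ => ENNReal.summable]
        exact Finset.sum_congr rfl fun a _ => tsum_congr fun k => by ring
    _ ≤ potential T p s x θ A := ENNReal.tsum_comp_le_tsum_of_injective (add_left_injective 1)
        (fun k : ℕ => θ ^ k * (transfer T p x)^[k] (phiNegPow s x) A)

section Recursion

variable {ι X : Type*} [Fintype ι] {F : ι → X → X} {U : Set X} {w : ι → ℝ≥0∞} {J Z : X → ℝ≥0∞}
  {C η : ℝ≥0∞}

theorem le_pow_add_of_le_sum_add (hF : ∀ a, Set.MapsTo (F a) U U) (hJ1 : ∀ A, J A ≤ 1)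
    (hJ : ∀ A ∈ U, J A ≤ (∑ a, w a * J (F a A)) + C * Z A)
    (hZ : ∀ A ∈ U, ∑ a, w a * Z (F a A) ≤ η * Z A) (n : ℕ) {A : X} (hA : A ∈ U) :
    J A ≤ (∑ a, w a) ^ n + C * (∑ k ∈ Finset.range n, η ^ k) * Z A := by
  induction n generalizing A with
  | zero => simpa using hJ1 A
  | succ n ih =>
    set S := ∑ k ∈ Finset.range n, η ^ k
    calc J A ≤ (∑ a, w a * J (F a A)) + C * Z A := hJ A hA
      _ ≤ (∑ a, w a * ((∑ a, w a) ^ n + C * S * Z (F a A))) + C * Z A := by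
          gcongr with a
          exact ih (hF a hA)
      _ = (∑ a, w a) ^ (n + 1) + C * S * (∑ a, w a * Z (F a A)) + C * Z A := by
          simp only [mul_add, Finset.sum_add_distrib]
          rw [← Finset.sum_mul, pow_succ', Finset.mul_sum Finset.univ _ (C * S)]
          congr 2
          exact Finset.sum_congr rfl fun a _ => by ring
      _ ≤ (∑ a, w a) ^ (n + 1) + C * S * (η * Z A) + C * Z A := by
          gcongr
          exact hZ A hA
      _ = (∑ a, w a) ^ (n + 1) + C * (∑ k ∈ Finset.range (n + 1), η ^ k) * Z A := by
          rw [Finset.sum_range_succ']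
          simp only [pow_succ, ← Finset.sum_mul, pow_zero, S]
          ring

theorem le_mul_of_le_sum_add (hF : ∀ a, Set.MapsTo (F a) U U) (hJ1 : ∀ A, J A ≤ 1)
    (hJ : ∀ A ∈ U, J A ≤ (∑ a, w a * J (F a A)) + C * Z A)
    (hZ : ∀ A ∈ U, ∑ a, w a * Z (F a A) ≤ η * Z A) (hw : ∑ a, w a < 1) {A : X} (hA : A ∈ U) :
    J A ≤ C * (1 - η)⁻¹ * Z A := by
  have hlim : Tendsto (fun n : ℕ => (∑ a, w a) ^ n + C * (1 - η)⁻¹ * Z A) atTop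
      (𝓝 (0 + C * (1 - η)⁻¹ * Z A)) :=
    (ENNReal.tendsto_pow_atTop_nhds_zero_of_lt_one hw).add_const _
  rw [zero_add] at hlim
  refine ge_of_tendsto' hlim fun n => (le_pow_add_of_le_sum_add hF hJ1 hJ hZ n hA).trans ?_
  gcongr
  rw [← ENNReal.tsum_geometric]
  exact ENNReal.sum_le_tsum _

end Recursion

theorem iterate_transfer_le_rpow (hp : ∀ i, 0 < p i) (hx : 1 < x) (k : ℕ) (A : E N →L[ℝ] E N) :
    (transfer T p (x - 1))^[k] (phiNegPow s (x - 1)) A ≤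
      ((transfer T p x)^[k] (phiNegPow s x) A) ^ ((x - 1) / x) := by
  have hx0 : 0 < x := by linarith
  have ht0 : 0 < (x - 1) / x := div_pos (by linarith) hx0
  induction k generalizing A with
  | zero =>
    simp only [Function.iterate_zero, id_eq, phiNegPow]
    rw [← ENNReal.rpow_mul]
    refine le_of_eq ?_
    congr 1
    field_simp
  | succ k ih =>
    rw [Function.iterate_succ_apply', Function.iterate_succ_apply']
    set Y := (transfer T p x)^[k] (phiNegPow s x)
    have hmean : transfer T p (x - 1) ((transfer T p (x - 1))^[k] (phiNegPow s (x - 1))) A ≤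
        ∑ a, p a * (p a ^ x * Y (A * T a)) ^ ((x - 1) / x) := by
      refine Finset.sum_le_sum fun a _ => ?_
      refine (mul_le_mul_right (ih (A * T a)) _).trans (le_of_eq ?_)
      rw [ENNReal.mul_rpow_of_nonneg _ _ ht0.le, ← ENNReal.rpow_mul, ← mul_assoc]
      congr 1
      rw [show x * ((x - 1) / x) = x - 1 by field_simp, mul_comm,
        ENNReal.rpow_add _ _ (hp a).ne' (p.apply_ne_top a), ENNReal.rpow_one]
    refine hmean.trans ?_
    rw [← ENNReal.rpow_inv_le_iff ht0]
    have hinv : 1 ≤ ((x - 1) / x)⁻¹ := by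
      rw [one_le_inv₀ ht0, div_le_one hx0]
      linarith
    refine (ENNReal.rpow_arith_mean_le_arith_mean_rpow _ _ _ (sum_pmf p) hinv).trans
      (le_of_eq ?_)
    refine Finset.sum_congr rfl fun a _ => ?_
    rw [← ENNReal.rpow_mul, mul_inv_cancel₀ ht0.ne', ENNReal.rpow_one, ← mul_assoc, add_comm x,
      ENNReal.rpow_add _ _ (hp a).ne' (p.apply_ne_top a), ENNReal.rpow_one]

theorem phiNegPow_one_mul_iterate_transfer_le (hp : ∀ i, 0 < p i) (hx : 1 < x) (hθ0 : θ ≠ 0)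
    (hθt : θ ≠ ⊤) (k : ℕ) (A : E N →L[ℝ] E N) :
    phiNegPow s 1 A * (transfer T p (x - 1))^[k] (phiNegPow s (x - 1)) A ≤
      (θ ^ ((x - 1) / x))⁻¹ ^ k * potential T p s x θ A := by
  have hx0 : 0 < x := by linarith
  have ht0 : 0 < (x - 1) / x := div_pos (by linarith) hx0
  set Z := potential T p s x θ A
  have hroot : phiNegPow s 1 A = phiNegPow s x A ^ (1 / x) := by
    rw [phiNegPow, phiNegPow, ← ENNReal.rpow_mul, neg_mul, mul_one_div_cancel hx0.ne']
  have hiter : (transfer T p x)^[k] (phiNegPow s x) A ≤ (θ ^ k)⁻¹ * Z :=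
    (ENNReal.mul_le_iff_le_inv (pow_ne_zero k hθ0) (ENNReal.pow_ne_top hθt)).1
      (pow_mul_iterate_le_potential k A)
  calc phiNegPow s 1 A * (transfer T p (x - 1))^[k] (phiNegPow s (x - 1)) A
      ≤ Z ^ (1 / x) * ((θ ^ k)⁻¹ * Z) ^ ((x - 1) / x) := by
        rw [hroot]
        gcongr
        · exact phiNegPow_le_potential A
        · exact (iterate_transfer_le_rpow hp hx k A).trans (ENNReal.rpow_le_rpow hiter ht0.le)
    _ = (θ ^ ((x - 1) / x))⁻¹ ^ k * (Z ^ (1 / x) * Z ^ ((x - 1) / x)) := by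
        rw [ENNReal.mul_rpow_of_nonneg _ _ ht0.le, ENNReal.inv_rpow, ← ENNReal.rpow_natCast_mul,
          mul_comm (k : ℝ), ENNReal.rpow_mul_natCast, ENNReal.inv_pow, mul_left_comm]
    _ = (θ ^ ((x - 1) / x))⁻¹ ^ k * Z := by
        rw [← ENNReal.rpow_add_of_nonneg _ _ (by positivity) ht0.le,
          show 1 / x + (x - 1) / x = 1 by field_simp; ring, ENNReal.rpow_one]

theorem exists_phiNegPow_one_mul_potential_le (hp : ∀ i, 0 < p i) (hx : 1 < x) (hθ : 1 < θ)
    (hθt : θ ≠ ⊤) :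
    ∃ θ' C : ℝ≥0∞, 1 < θ' ∧ θ' ≠ ⊤ ∧ C ≠ ⊤ ∧ ∀ A : E N →L[ℝ] E N,
      phiNegPow s 1 A * potential T p s (x - 1) θ' A ≤ C * potential T p s x θ A := by
  have ht0 : 0 < (x - 1) / x := div_pos (by linarith) (by linarith)
  have hη1 : 1 < θ ^ ((x - 1) / x / 2) := ENNReal.one_lt_rpow hθ (half_pos ht0)
  have hηt : θ ^ ((x - 1) / x / 2) ≠ ⊤ := ENNReal.rpow_ne_top_of_nonneg (half_pos ht0).le hθt
  have hsq : θ ^ ((x - 1) / x) = θ ^ ((x - 1) / x / 2) * θ ^ ((x - 1) / x / 2) := by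
    rw [← ENNReal.rpow_add _ _ (by positivity) hθt, add_halves]
  set η := θ ^ ((x - 1) / x / 2)
  have hη0 : η ≠ 0 := (zero_lt_one.trans hη1).ne'
  have hη : η * (η * η)⁻¹ = η⁻¹ := by
    rw [ENNReal.mul_inv (Or.inl hη0) (Or.inl hηt), ← mul_assoc,
      ENNReal.mul_inv_cancel hη0 hηt, one_mul]
  refine ⟨η, (1 - η⁻¹)⁻¹, hη1, hηt,
    ENNReal.inv_ne_top.2 (tsub_pos_of_lt (ENNReal.inv_lt_one.2 hη1)).ne', fun A => ?_⟩
  calc phiNegPow s 1 A * potential T p s (x - 1) η A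
      = ∑' k : ℕ,
          η ^ k * (phiNegPow s 1 A * (transfer T p (x - 1))^[k] (phiNegPow s (x - 1)) A) := by
        rw [potential, ← ENNReal.tsum_mul_left]
        exact tsum_congr fun k => mul_left_comm _ _ _
    _ ≤ ∑' k : ℕ, η ^ k * ((η * η)⁻¹ ^ k * potential T p s x θ A) := by
        refine ENNReal.tsum_le_tsum fun k => ?_
        rw [← hsq]
        refine mul_le_mul_right ?_ _
        exact phiNegPow_one_mul_iterate_transfer_le hp hx (zero_lt_one.trans hθ).ne' hθt k A
    _ = (1 - η⁻¹)⁻¹ * potential T p s x θ A := by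
        rw [← ENNReal.tsum_geometric, ← ENNReal.tsum_mul_right]
        exact tsum_congr fun k => by rw [← mul_assoc, ← mul_pow, hη]

theorem exists_phiNegPow_one_mul_le (hT : NormBounds T ρ c) (hs : 0 < s) :
    ∃ K : ℝ≥0∞, K ≠ ⊤ ∧ ∀ (A : E N →L[ℝ] E N), Function.Injective A → ∀ a,
      phiNegPow s 1 (A * T a) ≤ K * phiNegPow s 1 A := by
  choose K hK0 hK using fun a => exists_singularValueFunction_le_mul (hT.injective a) hs
  refine ⟨ENNReal.ofReal (∑ a, K a), ENNReal.ofReal_ne_top, fun A hA a => ?_⟩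
  have hφA := singularValueFunction_pos hA hs
  have hφAT := singularValueFunction_pos (hT.mul_injective hA a) hs
  have hKa : K a ≤ ∑ a, K a :=
    Finset.single_le_sum (f := K) (fun a _ => (hK0 a).le) (Finset.mem_univ a)
  rw [phiNegPow, phiNegPow, ENNReal.rpow_neg_one, ENNReal.rpow_neg_one,
    ← ENNReal.ofReal_inv_of_pos hφA, ← ENNReal.ofReal_inv_of_pos hφAT,
    ← ENNReal.ofReal_mul (Finset.sum_nonneg fun a _ => (hK0 a).le)]
  refine ENNReal.ofReal_le_ofReal ?_
  rw [inv_le_iff_one_le_mul₀ hφAT, ← div_eq_mul_inv, div_mul_eq_mul_div, one_le_div hφA]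
  exact (hK a A).trans (mul_le_mul_of_nonneg_right hKa hφAT.le)

theorem exists_potential_mul_le (hp : ∀ i, 0 < p i) (hx : 0 < x) (hθ : 1 ≤ θ) :
    ∃ K : ℝ≥0∞, K ≠ ⊤ ∧ ∀ (A : E N →L[ℝ] E N) (a : Fin m),
      potential T p s x θ (A * T a) ≤ K * potential T p s x θ A := by
  have hpa : ∀ a, p a ^ (x + 1) ≠ 0 := fun a =>
    (ENNReal.rpow_pos (hp a) (p.apply_ne_top a)).ne'
  have hpt : ∀ a, p a ^ (x + 1) ≠ ⊤ := fun a =>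
    ENNReal.rpow_ne_top_of_nonneg (by linarith) (p.apply_ne_top a)
  refine ⟨∑ a, (p a ^ (x + 1))⁻¹, ?_, fun A a => ?_⟩
  · rw [ENNReal.sum_ne_top]
    exact fun a _ => ENNReal.inv_ne_top.2 (hpa a)
  · have hterm : p a ^ (x + 1) * potential T p s x θ (A * T a) ≤ potential T p s x θ A :=
      calc p a ^ (x + 1) * potential T p s x θ (A * T a)
          ≤ transfer T p x (potential T p s x θ) A :=
            Finset.single_le_sum (f := fun a => p a ^ (x + 1) * potential T p s x θ (A * T a))
              (fun _ _ => zero_le) (Finset.mem_univ a)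
        _ ≤ θ * transfer T p x (potential T p s x θ) A := le_mul_of_one_le_left zero_le hθ
        _ ≤ potential T p s x θ A := mul_transfer_potential_le A
    refine ((ENNReal.mul_le_iff_le_inv (hpa a) (hpt a)).1 hterm).trans (mul_le_mul_left ?_ _)
    exact Finset.single_le_sum (f := fun a => (p a ^ (x + 1))⁻¹) (fun _ _ => zero_le)
      (Finset.mem_univ a)

theorem exists_add_rpow_le {κ : ℝ≥0∞} (hx : 0 < x) (hκ : 1 < κ) (hκt : κ ≠ ⊤) :
    ∃ C : ℝ≥0∞, C ≠ ⊤ ∧ ∀ a b : ℝ≥0∞, (a + b) ^ x ≤ κ * a ^ x + C * b ^ x := by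
  have hroot : 1 < κ ^ (1 / x) := ENNReal.one_lt_rpow hκ (by positivity)
  have hroot_top : κ ^ (1 / x) ≠ ⊤ := ENNReal.rpow_ne_top_of_nonneg (by positivity) hκt
  set η := κ ^ (1 / x) - 1
  have hη0 : η ≠ 0 := (tsub_pos_of_lt hroot).ne'
  have hηt : η ≠ ⊤ := ENNReal.sub_ne_top hroot_top
  have hη1 : 1 + η = κ ^ (1 / x) := add_tsub_cancel_of_le hroot.le
  refine ⟨(η⁻¹ + 1) ^ x, ENNReal.rpow_ne_top_of_nonneg hx.le
    (ENNReal.add_ne_top.2 ⟨ENNReal.inv_ne_top.2 hη0, ENNReal.one_ne_top⟩), fun a b => ?_⟩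
  rcases le_total b (η * a) with hb | hb
  · refine le_trans ?_ le_self_add
    calc (a + b) ^ x ≤ (κ ^ (1 / x) * a) ^ x := by
          refine ENNReal.rpow_le_rpow ?_ hx.le
          rw [← hη1, add_mul, one_mul]
          gcongr
      _ = κ * a ^ x := by
          rw [ENNReal.mul_rpow_of_nonneg _ _ hx.le, ← ENNReal.rpow_mul, one_div_mul_cancel hx.ne',
            ENNReal.rpow_one]
  · refine le_trans ?_ le_add_self
    rw [← ENNReal.mul_rpow_of_nonneg _ _ hx.le]
    refine ENNReal.rpow_le_rpow ?_ hx.le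
    rw [add_mul, one_mul]
    gcongr
    exact (ENNReal.mul_le_iff_le_inv hη0 hηt).1 hb

theorem lintegral_rpow_le_rpow {Ω : Type*} [MeasurableSpace Ω] (P : Measure Ω)
    [IsProbabilityMeasure P] {f : Ω → ℝ≥0∞} (hf : Measurable f) {a b : ℝ} (ha : 0 < a)
    (hab : a ≤ b) : ∫⁻ ω, f ω ^ a ∂P ≤ (∫⁻ ω, f ω ^ b ∂P) ^ (a / b) := by
  have hLp := eLpNorm'_le_eLpNorm'_of_exponent_le (f := f) ha hab P hf.aestronglyMeasurable
  simp only [eLpNorm'_eq_lintegral_enorm, enorm_eq_self] at hLp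
  have hpow := ENNReal.rpow_le_rpow hLp ha.le
  rwa [← ENNReal.rpow_mul, ← ENNReal.rpow_mul, one_div_mul_cancel ha.ne', ENNReal.rpow_one,
    one_div_mul_eq_div] at hpow

theorem rpow_eq_rpow_sub_one_mul {q : ℝ} (hq : 1 ≤ q) (a : ℝ≥0∞) : a ^ q = a ^ (q - 1) * a := by
  have h := ENNReal.rpow_add_of_nonneg (x := a) (q - 1) 1 (by linarith) zero_le_one
  rwa [sub_add_cancel, ENNReal.rpow_one] at h

end Transfer

section Correlation

variable {N m : ℕ}

/-- The mass of the infinite words projected into the ellipsoid `{z | ‖A (y - z)‖ ≤ r}`. -/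
noncomputable def nearMass (T : Fin m → E N →L[ℝ] E N) (p : PMF (Fin m)) (R : ℝ)
    (A : E N →L[ℝ] E N) (r : ℝ) (y : E N) (ω : List (Fin m) → E N) : ℝ≥0∞ :=
  bernoulliMeasure p {j | ‖A (y - clippedProjection T R ω j)‖ ≤ r}

/-- The `x`-th correlation moment of the projected measure, at scale `A⁻¹ B(0, r)`, for a given
family `ω` of displacements. -/
noncomputable def sampleCorrMoment (T : Fin m → E N →L[ℝ] E N) (p : PMF (Fin m)) (R x : ℝ)
    (A : E N →L[ℝ] E N) (r : ℝ) (ω : List (Fin m) → E N) : ℝ≥0∞ :=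
  ∫⁻ i, nearMass T p R A r (clippedProjection T R ω i) ω ^ x ∂(bernoulliMeasure p)

/-- The expected `x`-th correlation moment of the projected measure at scale `A⁻¹ B(0, r)`. -/
noncomputable def corrMoment (T : Fin m → E N →L[ℝ] E N) (p : PMF (Fin m)) (R : ℝ)
    (ν : Measure (E N)) [IsProbabilityMeasure ν] (x : ℝ) (A : E N →L[ℝ] E N) (r : ℝ) : ℝ≥0∞ :=
  ∫⁻ ω, sampleCorrMoment T p R x A r ω ∂(displacementLaw m ν)

/-- The largest expected `x`-th moment of the mass of a translate of `A⁻¹ B(0, r)`. -/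
noncomputable def concMoment (T : Fin m → E N →L[ℝ] E N) (p : PMF (Fin m)) (R : ℝ)
    (ν : Measure (E N)) [IsProbabilityMeasure ν] (x : ℝ) (A : E N →L[ℝ] E N) (r : ℝ) : ℝ≥0∞ :=
  ⨆ y : E N, ∫⁻ ω, nearMass T p R A r y ω ^ x ∂(displacementLaw m ν)

variable {T : Fin m → E N →L[ℝ] E N} {ρ c R : ℝ} {p : PMF (Fin m)} {ν : Measure (E N)}
  [IsProbabilityMeasure ν] {x r : ℝ} {A : E N →L[ℝ] E N}

theorem measurable_clippedProjection_comp (hT : NormBounds T ρ c) (hR : 0 ≤ R) {α : Type*}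
    [MeasurableSpace α] {f : α → List (Fin m) → E N} {g : α → ℕ → Fin m} (hf : Measurable f)
    (hg : Measurable g) : Measurable fun a => clippedProjection T R (f a) (g a) := by
  simpa only [Function.comp_def] using
    (measurable_clippedProjection (T := T) hT hR).comp (hf.prodMk hg)

theorem measurableSet_near (hT : NormBounds T ρ c) (hR : 0 ≤ R) (A : E N →L[ℝ] E N) (r : ℝ)
    {α : Type*} [MeasurableSpace α] {y : α → E N} {f : α → List (Fin m) → E N}
    {g : α → ℕ → Fin m} (hy : Measurable y) (hf : Measurable f) (hg : Measurable g) :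
    MeasurableSet {a | ‖A (y a - clippedProjection T R (f a) (g a))‖ ≤ r} :=
  measurableSet_le
    (A.measurable.comp (hy.sub (measurable_clippedProjection_comp hT hR hf hg))).norm
    measurable_const

theorem measurable_nearMass (hT : NormBounds T ρ c) (hR : 0 ≤ R) (p : PMF (Fin m))
    (A : E N →L[ℝ] E N) (r : ℝ) {α : Type*} [MeasurableSpace α] {y : α → E N}
    {f : α → List (Fin m) → E N} (hy : Measurable y) (hf : Measurable f) :
    Measurable fun a => nearMass T p R A r (y a) (f a) :=
  measurable_measure_prodMk_left (ν := bernoulliMeasure p)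
    (measurableSet_near hT hR A r (hy.comp measurable_fst) (hf.comp measurable_fst)
      (measurable_snd (α := α)))

theorem nearMass_le_one (y : E N) (ω : List (Fin m) → E N) : nearMass T p R A r y ω ≤ 1 :=
  prob_le_one

theorem corrMoment_le_one (hx : 0 ≤ x) : corrMoment T p R ν x A r ≤ 1 := by
  refine (lintegral_mono fun ω => lintegral_mono fun i =>
    ENNReal.rpow_le_one (nearMass_le_one _ _) hx).trans ?_
  simp

theorem concMoment_le_one (hx : 0 ≤ x) : concMoment T p R ν x A r ≤ 1 := by
  refine iSup_le fun y => (lintegral_mono fun ω =>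
    ENNReal.rpow_le_one (nearMass_le_one _ _) hx).trans ?_
  simp

theorem clippedProjection_congr {ω ω' : List (Fin m) → E N} {i : ℕ → Fin m}
    (h : ∀ k, ω (curtail i (k + 1)) = ω' (curtail i (k + 1))) :
    clippedProjection T R ω i = clippedProjection T R ω' i := by
  unfold clippedProjection projection
  refine tsum_congr fun k => ?_
  simp only [clip, h k]

theorem lintegral_shift (b : Fin m) {F : (List (Fin m) → E N) → ℝ≥0∞} (hF : Measurable F) :
    ∫⁻ ω, F (fun w => ω (b :: w)) ∂(displacementLaw m ν) = ∫⁻ ω, F ω ∂(displacementLaw m ν) := by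
  unfold displacementLaw
  conv_rhs => rw [← map_comp_infinitePi ν (List.cons_injective (a := b))]
  rw [lintegral_map hF (by fun_prop)]

theorem lintegral_merge (S : Set (List (Fin m))) [DecidablePred (· ∈ S)]
    {F : (List (Fin m) → E N) → ℝ≥0∞} (hF : Measurable F) :
    ∫⁻ ω, F ω ∂(displacementLaw m ν) =
      ∫⁻ ω, ∫⁻ ω', F (fun w => if w ∈ S then ω w else ω' w) ∂(displacementLaw m ν)
        ∂(displacementLaw m ν) := by
  have hmeas : Measurable fun (x : (List (Fin m) → E N) × (List (Fin m) → E N)) w =>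
      if w ∈ S then x.1 w else x.2 w := by
    refine measurable_pi_lambda _ fun i => ?_
    split_ifs <;> fun_prop
  unfold displacementLaw
  conv_lhs => rw [← map_ite_mem_prod_infinitePi ν S]
  rw [lintegral_map hF hmeas]
  exact lintegral_prod _ (hF.comp hmeas).aemeasurable

theorem nearMass_eq_sum (hT : NormBounds T ρ c) (hR : 0 ≤ R) {S : Fin m → E N →L[ℝ] E N}
    (hS : ∀ b, T b * S b = 1) (y : E N) (ω : List (Fin m) → E N) :
    nearMass T p R A r y ω =
      ∑ b, p b * nearMass T p R (A * T b) r (S b (y - clip R ω [b])) fun w => ω (b :: w) := by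
  unfold nearMass
  have hset : MeasurableSet {j | ‖A (y - clippedProjection T R ω j)‖ ≤ r} :=
    measurableSet_near hT hR A r measurable_const measurable_const measurable_id
  rw [bernoulliMeasure_apply p hset]
  refine Finset.sum_congr rfl fun b _ => ?_
  congr 2
  ext j
  have hinv : T b (S b (y - clip R ω [b])) = y - clip R ω [b] := by
    rw [← mul_apply_eq_comp, hS]
    rfl
  simp only [Set.mem_preimage, Set.mem_ofPred_eq]
  rw [clippedProjection_consWord hT hR, mul_apply_eq_comp, map_sub (T b), hinv, sub_sub]

section BoundedDensity

variable {X : Type*} [MeasurableSpace X] {τ μ : Measure X} [IsFiniteMeasure τ]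

theorem exists_measure_rnDeriv_gt_lt (hτ : τ ≪ μ) {δ : ℝ≥0∞} (hδ : δ ≠ 0) :
    ∃ n : ℕ, τ {z | (n : ℝ≥0∞) < τ.rnDeriv μ z} < δ := by
  let G : ℕ → Set X := fun n => {z | (n : ℝ≥0∞) < τ.rnDeriv μ z}
  have hG : ∀ n, NullMeasurableSet (G n) τ := fun n =>
    (measurableSet_lt measurable_const (Measure.measurable_rnDeriv _ _)).nullMeasurableSet
  have hanti : Antitone G := fun n k hnk z (hz : (k : ℝ≥0∞) < τ.rnDeriv μ z) =>
    (Nat.cast_le.2 hnk).trans_lt hz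
  have hzero : τ (⋂ n, G n) = 0 := by
    refine measure_mono_null (fun z hz => ?_) (hτ.ae_le (Measure.rnDeriv_lt_top τ μ))
    have hz' : ∀ n : ℕ, (n : ℝ≥0∞) < τ.rnDeriv μ z := fun n => Set.mem_iInter.1 hz n
    intro htop
    obtain ⟨n, hn⟩ := ENNReal.exists_nat_gt htop.ne
    exact lt_asymm hn (hz' n)
  have hlim := tendsto_measure_iInter_atTop hG hanti ⟨0, measure_ne_top _ _⟩
  rw [hzero] at hlim
  exact (hlim.eventually (gt_mem_nhds (pos_iff_ne_zero.2 hδ))).exists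

variable [SigmaFinite μ]

theorem setLIntegral_compl_rnDeriv_gt_le (hτ : τ ≪ μ) (M : ℝ≥0∞) {H : X → ℝ≥0∞}
    (hH : Measurable H) :
    ∫⁻ z in {z | M < τ.rnDeriv μ z}ᶜ, H z ∂τ ≤ M * ∫⁻ z, H z ∂μ := by
  have hdens : Measurable (τ.rnDeriv μ) := Measure.measurable_rnDeriv _ _
  have hG : MeasurableSet {z | M < τ.rnDeriv μ z}ᶜ :=
    (measurableSet_lt measurable_const hdens).compl
  calc ∫⁻ z in {z | M < τ.rnDeriv μ z}ᶜ, H z ∂τ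
      = ∫⁻ z in {z | M < τ.rnDeriv μ z}ᶜ, τ.rnDeriv μ z * H z ∂μ :=
        (setLIntegral_rnDeriv_mul hτ hH.aemeasurable hG).symm
    _ ≤ ∫⁻ z in {z | M < τ.rnDeriv μ z}ᶜ, M * H z ∂μ :=
        setLIntegral_mono (measurable_const.mul hH) fun z hz =>
          mul_le_mul_left (not_lt.1 (Set.mem_compl_iff _ _ |>.1 hz)) _
    _ ≤ ∫⁻ z, M * H z ∂μ := setLIntegral_le_lintegral _ _
    _ = M * ∫⁻ z, H z ∂μ := lintegral_const_mul _ hH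

theorem exists_lintegral_le_of_absolutelyContinuous (hτ : τ ≪ μ) {δ : ℝ≥0∞} (hδ : δ ≠ 0) :
    ∃ M : ℝ≥0∞, M ≠ ⊤ ∧ ∀ (H : X → ℝ≥0∞) (B : ℝ≥0∞), Measurable H → (∀ z, H z ≤ B) →
      ∫⁻ z, H z ∂τ ≤ M * ∫⁻ z, H z ∂μ + δ * B := by
  obtain ⟨n, hn⟩ := exists_measure_rnDeriv_gt_lt hτ hδ
  refine ⟨n, ENNReal.natCast_ne_top n, fun H B hH hB => ?_⟩
  have hG : MeasurableSet {z | (n : ℝ≥0∞) < τ.rnDeriv μ z} :=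
    measurableSet_lt measurable_const (Measure.measurable_rnDeriv _ _)
  rw [← lintegral_add_compl H hG, add_comm]
  refine add_le_add (setLIntegral_compl_rnDeriv_gt_le hτ n hH) ?_
  calc ∫⁻ z in {z | (n : ℝ≥0∞) < τ.rnDeriv μ z}, H z ∂τ
      ≤ ∫⁻ _ in {z | (n : ℝ≥0∞) < τ.rnDeriv μ z}, B ∂τ := lintegral_mono hB
    _ = B * τ {z | (n : ℝ≥0∞) < τ.rnDeriv μ z} := setLIntegral_const _ _
    _ ≤ δ * B := by
        rw [mul_comm]
        gcongr

end BoundedDensity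

theorem nearMass_le_nearMass_two_mul {y : E N} {ω : List (Fin m) → E N} {i : ℕ → Fin m}
    (hi : ‖A (y - clippedProjection T R ω i)‖ ≤ r) :
    nearMass T p R A r y ω ≤ nearMass T p R A (2 * r) (clippedProjection T R ω i) ω := by
  refine measure_mono fun j (hj : ‖A (y - clippedProjection T R ω j)‖ ≤ r) => ?_
  have hsub : A (clippedProjection T R ω i - clippedProjection T R ω j) =
      A (y - clippedProjection T R ω j) - A (y - clippedProjection T R ω i) := by
    rw [← map_sub, sub_sub_sub_cancel_left]
  change ‖A (clippedProjection T R ω i - clippedProjection T R ω j)‖ ≤ 2 * r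
  rw [hsub]
  exact (norm_sub_le _ _).trans (by linarith)

theorem nearMass_rpow_le_lintegral_indicator (hT : NormBounds T ρ c) (hR : 0 ≤ R) (hx : 1 ≤ x)
    (y : E N) (ω : List (Fin m) → E N) :
    nearMass T p R A r y ω ^ x ≤
      ∫⁻ i, {i | ‖A (y - clippedProjection T R ω i)‖ ≤ r}.indicator
        (fun i => nearMass T p R A (2 * r) (clippedProjection T R ω i) ω ^ (x - 1)) i
        ∂(bernoulliMeasure p) := by
  have hset : MeasurableSet {i | ‖A (y - clippedProjection T R ω i)‖ ≤ r} :=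
    measurableSet_near hT hR A r measurable_const measurable_const measurable_id
  have hpow : nearMass T p R A r y ω ^ x = nearMass T p R A r y ω ^ (x - 1) *
      bernoulliMeasure p {i | ‖A (y - clippedProjection T R ω i)‖ ≤ r} :=
    rpow_eq_rpow_sub_one_mul hx _
  rw [hpow, ← lintegral_indicator_const hset]
  refine lintegral_mono fun i => Set.indicator_le_indicator' fun hi => ?_
  exact ENNReal.rpow_le_rpow (nearMass_le_nearMass_two_mul hi) (by linarith)

theorem volume_restrict_near_le {T₀ S : E N →L[ℝ] E N} (hS : T₀ * S = 1) {v : ℝ≥0∞}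
    (hv : ∀ y, volume {z : E N | ‖z‖ ≤ R ∧ ‖A (y - z)‖ ≤ r} ≤ v) (y u : E N) :
    volume.restrict (Metric.closedBall 0 R) {z | ‖(A * T₀) (S (y - z) - u)‖ ≤ r} ≤ v := by
  rw [Measure.restrict_apply' measurableSet_closedBall]
  refine (measure_mono ?_).trans (hv (y - T₀ u))
  rintro z ⟨hz, hzR⟩
  have hinv : T₀ (S (y - z)) = y - z := by
    rw [← mul_apply_eq_comp, hS]
    rfl
  rw [Set.mem_ofPred_eq, mul_apply_eq_comp, map_sub, hinv, sub_right_comm] at hz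
  exact ⟨by simpa using hzR, hz⟩

theorem measurable_nearMass_clippedProjection (hT : NormBounds T ρ c) (hR : 0 ≤ R)
    (p : PMF (Fin m)) (A : E N →L[ℝ] E N) (r : ℝ) {α : Type*} [MeasurableSpace α]
    {f : α → List (Fin m) → E N} {g : α → ℕ → Fin m} (hf : Measurable f) (hg : Measurable g) :
    Measurable fun a => nearMass T p R A r (clippedProjection T R (f a) (g a)) (f a) :=
  measurable_nearMass hT hR p A r (measurable_clippedProjection_comp hT hR hf hg) hf

theorem measurable_sampleCorrMoment (hT : NormBounds T ρ c) (hR : 0 ≤ R) (p : PMF (Fin m))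
    (x : ℝ) (A : E N →L[ℝ] E N) (r : ℝ) : Measurable (sampleCorrMoment T p R x A r) :=
  Measurable.lintegral_prod_right' (f := fun q : (List (Fin m) → E N) × (ℕ → Fin m) =>
    nearMass T p R A r (clippedProjection T R q.1 q.2) q.1 ^ x)
    ((measurable_nearMass_clippedProjection hT hR p A r measurable_fst measurable_snd).pow_const x)

theorem lintegral_nearMass_rpow_le (hT : NormBounds T ρ c) (hR : 0 ≤ R) (hx : 1 ≤ x)
    {T₀ S : E N →L[ℝ] E N} (hS : T₀ * S = 1) {v : ℝ≥0∞}
    (hv : ∀ y, volume {z : E N | ‖z‖ ≤ R ∧ ‖A (y - z)‖ ≤ r} ≤ v) (y : E N)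
    (ω : List (Fin m) → E N) :
    ∫⁻ z in Metric.closedBall 0 R, nearMass T p R (A * T₀) r (S (y - z)) ω ^ x ≤
      v * sampleCorrMoment T p R (x - 1) (A * T₀) (2 * r) ω := by
  let K : (ℕ → Fin m) → ℝ≥0∞ := fun i =>
    nearMass T p R (A * T₀) (2 * r) (clippedProjection T R ω i) ω ^ (x - 1)
  let Q : Set (E N × (ℕ → Fin m)) :=
    {q | ‖(A * T₀) (S (y - q.1) - clippedProjection T R ω q.2)‖ ≤ r}
  have hK : Measurable K := (measurable_nearMass_clippedProjection hT hR p _ _ measurable_const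
    measurable_id).pow_const _
  have hQ : MeasurableSet Q := measurableSet_near hT hR _ r
    (S.measurable.comp (measurable_const.sub measurable_fst)) measurable_const measurable_snd
  calc ∫⁻ z in Metric.closedBall 0 R, nearMass T p R (A * T₀) r (S (y - z)) ω ^ x
      ≤ ∫⁻ z in Metric.closedBall 0 R, ∫⁻ i, Q.indicator (fun q => K q.2) (z, i)
          ∂(bernoulliMeasure p) :=
        lintegral_mono fun z => nearMass_rpow_le_lintegral_indicator hT hR hx (S (y - z)) ω
    _ = ∫⁻ i, (∫⁻ z in Metric.closedBall 0 R, Q.indicator (fun q => K q.2) (z, i))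
          ∂(bernoulliMeasure p) :=
        lintegral_lintegral_swap (f := fun z i => Q.indicator (fun q => K q.2) (z, i))
          ((hK.comp measurable_snd).indicator hQ).aemeasurable
    _ ≤ ∫⁻ i, v * K i ∂(bernoulliMeasure p) := by
        refine lintegral_mono fun i => ?_
        calc ∫⁻ z in Metric.closedBall 0 R, {z | (z, i) ∈ Q}.indicator (fun _ => K i) z
            = K i * volume.restrict (Metric.closedBall 0 R) {z | (z, i) ∈ Q} :=
              lintegral_indicator_const (measurable_prodMk_right hQ) _
          _ ≤ v * K i := by
              rw [mul_comm]
              gcongr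
              exact volume_restrict_near_le hS hv y (clippedProjection T R ω i)
    _ = v * ∫⁻ i, K i ∂(bernoulliMeasure p) := lintegral_const_mul _ hK

end Correlation

section Recursion

variable {N m : ℕ} {T : Fin m → E N →L[ℝ] E N} {ρ c R : ℝ} {p : PMF (Fin m)}
  {ν : Measure (E N)} [IsProbabilityMeasure ν] {x r : ℝ} {A : E N →L[ℝ] E N}

theorem measurable_shift (b : Fin m) :
    Measurable fun (ω : List (Fin m) → E N) (w : List (Fin m)) => ω (b :: w) := by
  fun_prop

theorem measurable_consWord_right (b : Fin m) : Measurable (consWord b) :=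
  measurable_consWord.comp measurable_prodMk_left

theorem head?_curtail_succ (j : ℕ → Fin m) (k : ℕ) : (curtail j (k + 1)).head? = some (j 0) := by
  simp [curtail, List.ofFn_succ]

theorem nearMass_congr {ω ω' : List (Fin m) → E N} (h : ∀ w, w ≠ [] → ω w = ω' w) (y : E N) :
    nearMass T p R A r y ω = nearMass T p R A r y ω' := by
  have hproj : ∀ j, clippedProjection T R ω j = clippedProjection T R ω' j := fun j =>
    clippedProjection_congr fun k => h _ (List.ne_nil_of_length_pos (by simp [length_curtail]))
  simp only [nearMass, hproj]

theorem lintegral_eval_nil {G : E N → (List (Fin m) → E N) → ℝ≥0∞}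
    (hG : Measurable (Function.uncurry G))
    (hcongr : ∀ z ω ω', (∀ w, w ≠ [] → ω w = ω' w) → G z ω = G z ω') :
    ∫⁻ ω, G (ω []) ω ∂(displacementLaw m ν) = ∫⁻ z, ∫⁻ ω, G z ω ∂(displacementLaw m ν) ∂ν := by
  classical
  have hmerge : ∀ ω ω' : List (Fin m) → E N,
      G (if [] ∈ ({[]} : Set (List (Fin m))) then ω [] else ω' [])
        (fun w => if w ∈ ({[]} : Set (List (Fin m))) then ω w else ω' w) = G (ω []) ω' :=
    fun ω ω' => by
      rw [if_pos (Set.mem_singleton _)]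
      exact hcongr _ _ _ fun w hw => if_neg hw
  have heval : MeasurePreserving (Function.eval ([] : List (Fin m))) (displacementLaw m ν) ν :=
    measurePreserving_eval_infinitePi (fun _ : List (Fin m) => ν) []
  have hpair : Measurable fun ω : List (Fin m) → E N => (ω [], ω) := by fun_prop
  have hdiag : Measurable fun ω : List (Fin m) → E N => G (ω []) ω := hG.comp hpair
  rw [lintegral_merge {[]} hdiag]
  simp only [hmerge]
  exact heval.lintegral_comp (hG.lintegral_prod_right' (ν := displacementLaw m ν))

theorem measurable_nearMass_sub_rpow (hT : NormBounds T ρ c) (hR : 0 ≤ R)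
    (S : E N →L[ℝ] E N) (y : E N) {α : Type*} [MeasurableSpace α] {u : α → E N}
    {f : α → List (Fin m) → E N} (hu : Measurable u) (hf : Measurable f) :
    Measurable fun a => nearMass T p R A r (S (y - u a)) (f a) ^ x :=
  (measurable_nearMass hT hR p A r (S.measurable.comp (measurable_const.sub hu)) hf).pow_const x

theorem lintegral_nearMass_clip_nil (hT : NormBounds T ρ c) (hR : 0 ≤ R)
    (hνR : ∀ᵐ z ∂ν, ‖z‖ ≤ R) (S : E N →L[ℝ] E N) (y : E N) :
    ∫⁻ ω, nearMass T p R A r (S (y - clip R ω [])) ω ^ x ∂(displacementLaw m ν) =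
      ∫⁻ z, ∫⁻ ω, nearMass T p R A r (S (y - z)) ω ^ x ∂(displacementLaw m ν) ∂ν := by
  have heval : MeasurePreserving (Function.eval ([] : List (Fin m))) (displacementLaw m ν) ν :=
    measurePreserving_eval_infinitePi (fun _ : List (Fin m) => ν) []
  rw [← lintegral_eval_nil (G := fun z ω => nearMass T p R A r (S (y - z)) ω ^ x)
    (measurable_nearMass_sub_rpow hT hR S y measurable_fst measurable_snd)
    fun z ω ω' h => by rw [nearMass_congr h]]
  refine lintegral_congr_ae ?_
  filter_upwards [heval.quasiMeasurePreserving.ae hνR] with ω hω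
  rw [show clip R ω [] = ω [] from if_pos hω]

theorem lintegral_nearMass_rpow_le_sum (hT : NormBounds T ρ c) (hR : 0 ≤ R) (hx : 1 ≤ x)
    (hνR : ∀ᵐ z ∂ν, ‖z‖ ≤ R) {S : Fin m → E N →L[ℝ] E N} (hS : ∀ b, T b * S b = 1) (y : E N) :
    ∫⁻ ω, nearMass T p R A r y ω ^ x ∂(displacementLaw m ν) ≤
      ∑ b, p b * ∫⁻ z, ∫⁻ ω, nearMass T p R (A * T b) r (S b (y - z)) ω ^ x
        ∂(displacementLaw m ν) ∂ν := by
  have hmeas : ∀ b, Measurable fun ω : List (Fin m) → E N =>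
      nearMass T p R (A * T b) r (S b (y - clip R ω [b])) (fun w => ω (b :: w)) ^ x := fun b =>
    measurable_nearMass_sub_rpow hT hR (S b) y (measurable_clip_apply R [b]) (measurable_shift b)
  calc ∫⁻ ω, nearMass T p R A r y ω ^ x ∂(displacementLaw m ν)
      ≤ ∫⁻ ω, ∑ b, p b * nearMass T p R (A * T b) r (S b (y - clip R ω [b]))
          (fun w => ω (b :: w)) ^ x ∂(displacementLaw m ν) := by
        refine lintegral_mono fun ω => ?_
        rw [nearMass_eq_sum hT hR hS]
        exact ENNReal.rpow_arith_mean_le_arith_mean_rpow _ _ _ (sum_pmf p) hx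
    _ = ∑ b, p b * ∫⁻ ω, nearMass T p R (A * T b) r (S b (y - clip R ω [b]))
          (fun w => ω (b :: w)) ^ x ∂(displacementLaw m ν) := by
        rw [lintegral_finsetSum _ fun b _ => (hmeas b).const_mul _]
        exact Finset.sum_congr rfl fun b _ => lintegral_const_mul _ (hmeas b)
    _ = _ := by
        refine Finset.sum_congr rfl fun b _ => ?_
        have hroot : Measurable fun ω : List (Fin m) → E N =>
            nearMass T p R (A * T b) r (S b (y - clip R ω [])) ω ^ x :=
          measurable_nearMass_sub_rpow hT hR (S b) y (measurable_clip_apply R []) measurable_id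
        rw [← lintegral_nearMass_clip_nil hT hR hνR (S b) y, ← lintegral_shift b hroot]
        rfl

theorem setLIntegral_lintegral_nearMass_rpow_le (hT : NormBounds T ρ c) (hR : 0 ≤ R) (hx : 1 ≤ x)
    {T₀ S : E N →L[ℝ] E N} (hS : T₀ * S = 1) {v : ℝ≥0∞}
    (hv : ∀ y, volume {z : E N | ‖z‖ ≤ R ∧ ‖A (y - z)‖ ≤ r} ≤ v) (y : E N) :
    ∫⁻ z in Metric.closedBall 0 R, ∫⁻ ω, nearMass T p R (A * T₀) r (S (y - z)) ω ^ x
        ∂(displacementLaw m ν) ≤ v * corrMoment T p R ν (x - 1) (A * T₀) (2 * r) := by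
  rw [lintegral_lintegral_swap (f := fun z ω => nearMass T p R (A * T₀) r (S (y - z)) ω ^ x)
      (measurable_nearMass_sub_rpow hT hR S y measurable_fst measurable_snd).aemeasurable,
    corrMoment, ← lintegral_const_mul _ (measurable_sampleCorrMoment hT hR p (x - 1) _ _)]
  exact lintegral_mono fun ω => lintegral_nearMass_rpow_le hT hR hx hS hv y ω

theorem lintegral_nearMass_rpow_le_concMoment (y : E N) :
    ∫⁻ ω, nearMass T p R A r y ω ^ x ∂(displacementLaw m ν) ≤ concMoment T p R ν x A r :=
  le_iSup (fun y : E N => ∫⁻ ω, nearMass T p R A r y ω ^ x ∂(displacementLaw m ν)) y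

theorem concMoment_le (hT : NormBounds T ρ c) (hR : 0 ≤ R) (hx : 1 ≤ x)
    (hνR : ∀ᵐ z ∂ν, ‖z‖ ≤ R) {M δ v : ℝ≥0∞}
    (hM : ∀ (H : E N → ℝ≥0∞) (B : ℝ≥0∞), Measurable H → (∀ z, H z ≤ B) →
      ∫⁻ z, H z ∂ν ≤ M * (∫⁻ z in Metric.closedBall 0 R, H z) + δ * B)
    (hv : ∀ y, volume {z : E N | ‖z‖ ≤ R ∧ ‖A (y - z)‖ ≤ r} ≤ v) :
    concMoment T p R ν x A r ≤ ∑ b, p b * (M * (v * corrMoment T p R ν (x - 1) (A * T b) (2 * r)) +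
      δ * concMoment T p R ν x (A * T b) r) := by
  choose S _ hS _ using fun b => exists_injective_mul_eq_one (hT.injective b)
  refine iSup_le fun y => (lintegral_nearMass_rpow_le_sum hT hR hx hνR hS y).trans ?_
  refine Finset.sum_le_sum fun b _ => mul_le_mul_right ?_ _
  have hjoint : Measurable fun q : E N × (List (Fin m) → E N) =>
      nearMass T p R (A * T b) r (S b (y - q.1)) q.2 ^ x :=
    measurable_nearMass_sub_rpow hT hR (S b) y measurable_fst measurable_snd
  refine (hM _ (concMoment T p R ν x (A * T b) r) hjoint.lintegral_prod_right'
    fun z => lintegral_nearMass_rpow_le_concMoment (S b (y - z))).trans ?_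
  gcongr
  exact setLIntegral_lintegral_nearMass_rpow_le hT hR hx (hS b) hv y

/-- The mass of the infinite words that start with a letter other than `a` and are projected into
the ellipsoid `{z | ‖A (y - z)‖ ≤ r}`. -/
noncomputable def nearMassNe (T : Fin m → E N →L[ℝ] E N) (p : PMF (Fin m)) (R : ℝ) (a : Fin m)
    (A : E N →L[ℝ] E N) (r : ℝ) (y : E N) (ω : List (Fin m) → E N) : ℝ≥0∞ :=
  bernoulliMeasure p {j | j 0 ≠ a ∧ ‖A (y - clippedProjection T R ω j)‖ ≤ r}

theorem measurable_nearMassNe (hT : NormBounds T ρ c) (hR : 0 ≤ R) (p : PMF (Fin m))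
    (a : Fin m) (A : E N →L[ℝ] E N) (r : ℝ) {α : Type*} [MeasurableSpace α] {y : α → E N}
    {f : α → List (Fin m) → E N} (hy : Measurable y) (hf : Measurable f) :
    Measurable fun z => nearMassNe T p R a A r (y z) (f z) := by
  have hfirst : Measurable fun q : α × (ℕ → Fin m) => q.2 0 := by fun_prop
  exact measurable_measure_prodMk_left (ν := bernoulliMeasure p)
    ((hfirst (MeasurableSet.of_discrete (s := {a}ᶜ))).inter
      (measurableSet_near hT hR A r (hy.comp measurable_fst) (hf.comp measurable_fst)
        (measurable_snd (α := α))))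

theorem measurable_nearMassNe_consWord_rpow (hT : NormBounds T ρ c) (hR : 0 ≤ R)
    (p : PMF (Fin m)) (a : Fin m) (A : E N →L[ℝ] E N) (r x : ℝ) {α : Type*} [MeasurableSpace α]
    {f g : α → List (Fin m) → E N} {j : α → ℕ → Fin m} (hf : Measurable f) (hg : Measurable g)
    (hj : Measurable j) :
    Measurable fun z =>
      nearMassNe T p R a A r (clippedProjection T R (f z) (consWord a (j z))) (g z) ^ x :=
  (measurable_nearMassNe hT hR p a A r (measurable_clippedProjection_comp hT hR hf
    ((measurable_consWord_right a).comp hj)) hg).pow_const x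

theorem nearMassNe_le_nearMass (a : Fin m) (y : E N) (ω : List (Fin m) → E N) :
    nearMassNe T p R a A r y ω ≤ nearMass T p R A r y ω :=
  measure_mono fun _ hj => hj.2

theorem lintegral_nearMassNe_rpow_le_concMoment (hx : 0 ≤ x) (a : Fin m) (y : E N) :
    ∫⁻ ω, nearMassNe T p R a A r y ω ^ x ∂(displacementLaw m ν) ≤ concMoment T p R ν x A r :=
  (lintegral_mono fun ω => ENNReal.rpow_le_rpow (nearMassNe_le_nearMass a y ω) hx).trans
    (lintegral_nearMass_rpow_le_concMoment y)

theorem nearMassNe_congr {a : Fin m} {ω ω' : List (Fin m) → E N}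
    (h : ∀ w, w.head? ≠ some a → ω w = ω' w) (y : E N) :
    nearMassNe T p R a A r y ω = nearMassNe T p R a A r y ω' := by
  unfold nearMassNe
  congr 1
  ext j
  refine and_congr_right fun hj => ?_
  rw [clippedProjection_congr fun k => h _ (by simpa [head?_curtail_succ] using hj)]

theorem nearMass_consWord_le (hT : NormBounds T ρ c) (hR : 0 ≤ R) (a : Fin m)
    (i : ℕ → Fin m) (ω : List (Fin m) → E N) :
    nearMass T p R A r (clippedProjection T R ω (consWord a i)) ω ≤
      p a * nearMass T p R (A * T a) r (clippedProjection T R (fun w => ω (a :: w)) i)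
        (fun w => ω (a :: w)) +
      nearMassNe T p R a A r (clippedProjection T R ω (consWord a i)) ω := by
  let Q : Set (ℕ → Fin m) :=
    {j | ‖A (clippedProjection T R ω (consWord a i) - clippedProjection T R ω j)‖ ≤ r}
  let D : Set (ℕ → Fin m) := {j | j 0 = a}
  have hQ : MeasurableSet Q :=
    measurableSet_near hT hR A r measurable_const measurable_const measurable_id
  have hD : MeasurableSet D :=
    measurableSet_eq_fun (measurable_pi_apply (X := fun _ : ℕ => Fin m) 0) measurable_const
  have hsplit : bernoulliMeasure p Q ≤ bernoulliMeasure p (Q ∩ D) +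
      nearMassNe T p R a A r (clippedProjection T R ω (consWord a i)) ω :=
    (measure_mono fun j hj => (em (j 0 = a)).imp (⟨hj, ·⟩) (⟨·, hj⟩)).trans (measure_union_le _ _)
  refine hsplit.trans (add_le_add_left (le_of_eq ?_) _)
  rw [bernoulliMeasure_apply p (hQ.inter hD), Finset.sum_eq_single a _ (by simp)]
  · congr 2
    ext j
    change ‖A (clippedProjection T R ω (consWord a i) - clippedProjection T R ω (consWord a j))‖ ≤ r
      ∧ a = a ↔ ‖(A * T a) (_ - _)‖ ≤ r
    rw [clippedProjection_consWord hT hR, clippedProjection_consWord hT hR,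
      add_sub_add_left_eq_sub, ← map_sub, ← mul_apply_eq_comp]
    exact and_iff_left rfl
  · intro b _ hb
    have hempty : consWord b ⁻¹' (Q ∩ D) = ∅ :=
      Set.eq_empty_of_forall_notMem fun j hj => hb hj.2
    rw [hempty, measure_empty, mul_zero]

theorem lintegral_nearMassNe_le (hT : NormBounds T ρ c) (hR : 0 ≤ R) (hx : 0 ≤ x)
    (a : Fin m) :
    ∫⁻ ω, ∫⁻ i, nearMassNe T p R a A r (clippedProjection T R ω (consWord a i)) ω ^ x
      ∂(bernoulliMeasure p) ∂(displacementLaw m ν) ≤ concMoment T p R ν x A r := by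
  classical
  -- The displacements along words starting with `a` are independent of all the others.
  let S : Set (List (Fin m)) := {w | w.head? = some a}
  have hmerge : ∀ (ω ω' : List (Fin m) → E N) (i : ℕ → Fin m),
      nearMassNe T p R a A r
          (clippedProjection T R (fun w => if w ∈ S then ω w else ω' w) (consWord a i))
          (fun w => if w ∈ S then ω w else ω' w) =
        nearMassNe T p R a A r (clippedProjection T R ω (consWord a i)) ω' := fun ω ω' i => by
    have hcenter : clippedProjection T R (fun w => if w ∈ S then ω w else ω' w) (consWord a i) =
        clippedProjection T R ω (consWord a i) :=
      clippedProjection_congr fun k => if_pos (head?_curtail_succ (consWord a i) k)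
    rw [hcenter]
    exact nearMassNe_congr (fun w hw => if_neg hw) _
  have hjoint : Measurable fun q : (List (Fin m) → E N) × (ℕ → Fin m) =>
      nearMassNe T p R a A r (clippedProjection T R q.1 (consWord a q.2)) q.1 ^ x :=
    measurable_nearMassNe_consWord_rpow hT hR p a A r x measurable_fst measurable_fst
      measurable_snd
  rw [lintegral_merge S hjoint.lintegral_prod_right']
  simp only [hmerge]
  have hinner : ∀ ω : List (Fin m) → E N,
      ∫⁻ ω', ∫⁻ i, nearMassNe T p R a A r (clippedProjection T R ω (consWord a i)) ω' ^ x
        ∂(bernoulliMeasure p) ∂(displacementLaw m ν) ≤ concMoment T p R ν x A r := fun ω => by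
    rw [lintegral_lintegral_swap (f := fun (ω' : List (Fin m) → E N) (i : ℕ → Fin m) =>
      nearMassNe T p R a A r (clippedProjection T R ω (consWord a i)) ω' ^ x)
      (measurable_nearMassNe_consWord_rpow hT hR p a A r x measurable_const measurable_fst
        measurable_snd).aemeasurable]
    refine lintegral_le_const (.of_forall fun i => ?_)
    exact lintegral_nearMassNe_rpow_le_concMoment hx a (clippedProjection T R ω (consWord a i))
  exact lintegral_le_const (.of_forall hinner)

theorem lintegral_nearMass_consWord_rpow_le (hT : NormBounds T ρ c) (hR : 0 ≤ R) (hx : 0 ≤ x)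
    {κ C : ℝ≥0∞} (hC : ∀ a b : ℝ≥0∞, (a + b) ^ x ≤ κ * a ^ x + C * b ^ x) (a : Fin m)
    (ω : List (Fin m) → E N) :
    ∫⁻ i, nearMass T p R A r (clippedProjection T R ω (consWord a i)) ω ^ x ∂(bernoulliMeasure p) ≤
      κ * p a ^ x * sampleCorrMoment T p R x (A * T a) r (fun w => ω (a :: w)) +
        C * ∫⁻ i, nearMassNe T p R a A r (clippedProjection T R ω (consWord a i)) ω ^ x
          ∂(bernoulliMeasure p) := by
  have hnear : Measurable fun i => nearMass T p R (A * T a) r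
      (clippedProjection T R (fun w => ω (a :: w)) i) (fun w => ω (a :: w)) ^ x :=
    (measurable_nearMass_clippedProjection hT hR p _ _ measurable_const measurable_id).pow_const _
  have hne : Measurable fun i =>
      nearMassNe T p R a A r (clippedProjection T R ω (consWord a i)) ω ^ x :=
    measurable_nearMassNe_consWord_rpow hT hR p a A r x measurable_const measurable_const
      measurable_id
  rw [sampleCorrMoment, ← lintegral_const_mul _ hnear, ← lintegral_const_mul _ hne,
    ← lintegral_add_left (hnear.const_mul _)]
  refine lintegral_mono fun i => ?_
  refine (ENNReal.rpow_le_rpow (nearMass_consWord_le hT hR a i ω) hx).trans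
    ((hC _ _).trans (le_of_eq ?_))
  rw [ENNReal.mul_rpow_of_nonneg _ _ hx, mul_assoc]

theorem sampleCorrMoment_le (hT : NormBounds T ρ c) (hR : 0 ≤ R) (hx : 0 ≤ x)
    (hp : ∀ i, 0 < p i) {κ C : ℝ≥0∞}
    (hC : ∀ a b : ℝ≥0∞, (a + b) ^ x ≤ κ * a ^ x + C * b ^ x) (ω : List (Fin m) → E N) :
    sampleCorrMoment T p R x A r ω ≤
      ∑ a, (κ * p a ^ (x + 1) * sampleCorrMoment T p R x (A * T a) r (fun w => ω (a :: w)) +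
        C * (p a * ∫⁻ i, nearMassNe T p R a A r (clippedProjection T R ω (consWord a i)) ω ^ x
          ∂(bernoulliMeasure p))) := by
  have hnear : Measurable fun i => nearMass T p R A r (clippedProjection T R ω i) ω ^ x :=
    (measurable_nearMass_clippedProjection hT hR p A r measurable_const measurable_id).pow_const x
  rw [sampleCorrMoment, lintegral_bernoulliMeasure p hnear]
  refine Finset.sum_le_sum fun a _ => (mul_le_mul_right
    (lintegral_nearMass_consWord_rpow_le hT hR hx hC a ω) _).trans (le_of_eq ?_)
  rw [ENNReal.rpow_add _ _ (hp a).ne' (p.apply_ne_top a), ENNReal.rpow_one]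
  ring

theorem corrMoment_le (hT : NormBounds T ρ c) (hR : 0 ≤ R) (hx : 0 ≤ x)
    (hp : ∀ i, 0 < p i) {κ C : ℝ≥0∞}
    (hC : ∀ a b : ℝ≥0∞, (a + b) ^ x ≤ κ * a ^ x + C * b ^ x) :
    corrMoment T p R ν x A r ≤ (∑ a, κ * p a ^ (x + 1) * corrMoment T p R ν x (A * T a) r) +
      C * concMoment T p R ν x A r := by
  let F : Fin m → (List (Fin m) → E N) → ℝ≥0∞ := fun a => sampleCorrMoment T p R x (A * T a) r
  let G : Fin m → (List (Fin m) → E N) → ℝ≥0∞ := fun a ω =>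
    ∫⁻ i, nearMassNe T p R a A r (clippedProjection T R ω (consWord a i)) ω ^ x
      ∂(bernoulliMeasure p)
  have hF : ∀ a, Measurable (F a) := fun a => measurable_sampleCorrMoment hT hR p x (A * T a) r
  have hFshift : ∀ a, Measurable fun ω : List (Fin m) → E N => F a (fun w => ω (a :: w)) :=
    fun a => (hF a).comp (measurable_shift a)
  have hG : ∀ a, Measurable (G a) := fun a => (measurable_nearMassNe_consWord_rpow hT hR p a A r x
    measurable_fst measurable_fst measurable_snd).lintegral_prod_right'
  calc corrMoment T p R ν x A r
      ≤ ∫⁻ ω, ∑ a, (κ * p a ^ (x + 1) * F a (fun w => ω (a :: w)) + C * (p a * G a ω))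
          ∂(displacementLaw m ν) := lintegral_mono (sampleCorrMoment_le hT hR hx hp hC)
    _ = ∑ a, (κ * p a ^ (x + 1) * corrMoment T p R ν x (A * T a) r +
          C * (p a * ∫⁻ ω, G a ω ∂(displacementLaw m ν))) := by
        have hsum : ∀ a ∈ Finset.univ, Measurable fun ω : List (Fin m) → E N =>
            κ * p a ^ (x + 1) * F a (fun w => ω (a :: w)) + C * (p a * G a ω) := fun a _ =>
          ((hFshift a).const_mul _).add (((hG a).const_mul _).const_mul _)
        rw [lintegral_finsetSum _ hsum]
        refine Finset.sum_congr rfl fun a _ => ?_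
        rw [lintegral_add_left ((hFshift a).const_mul _), lintegral_const_mul _ (hFshift a),
          lintegral_const_mul _ ((hG a).const_mul _), lintegral_const_mul _ (hG a),
          lintegral_shift a (hF a)]
        rfl
    _ ≤ ∑ a, (κ * p a ^ (x + 1) * corrMoment T p R ν x (A * T a) r +
          C * (p a * concMoment T p R ν x A r)) := by
        gcongr with a
        exact lintegral_nearMassNe_le hT hR hx a
    _ = _ := by
        rw [Finset.sum_add_distrib, ← Finset.mul_sum, ← Finset.sum_mul, sum_pmf, one_mul]

end Recursion

section MomentBounds

variable {N m : ℕ} {T : Fin m → E N →L[ℝ] E N} {ρ c R : ℝ} {p : PMF (Fin m)}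
  {ν : Measure (E N)} {s x : ℝ} {θ : ℝ≥0∞}

/-- `F A r = O(r ^ t * V A)` uniformly over injective `A` and `r > 0`; this is the form of all
bounds on the moments `corrMoment` and `concMoment`. -/
def IsScaleBounded (F : (E N →L[ℝ] E N) → ℝ → ℝ≥0∞) (t : ℝ) (V : (E N →L[ℝ] E N) → ℝ≥0∞) : Prop :=
  ∃ C : ℝ≥0∞, C ≠ ⊤ ∧ ∀ A : E N →L[ℝ] E N, Function.Injective A → ∀ r, 0 < r →
    F A r ≤ C * ENNReal.ofReal (r ^ t) * V A

theorem IsScaleBounded.mono {F : (E N →L[ℝ] E N) → ℝ → ℝ≥0∞} {t : ℝ}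
    {V W : (E N →L[ℝ] E N) → ℝ≥0∞} (hF : IsScaleBounded F t V) {K : ℝ≥0∞} (hK : K ≠ ⊤)
    (hVW : ∀ A, V A ≤ K * W A) : IsScaleBounded F t W := by
  obtain ⟨C, hC, hle⟩ := hF
  refine ⟨C * K, ENNReal.mul_ne_top hC hK, fun A hA r hr => ?_⟩
  calc F A r ≤ C * ENNReal.ofReal (r ^ t) * V A := hle A hA r hr
    _ ≤ C * ENNReal.ofReal (r ^ t) * (K * W A) := by
        gcongr
        exact hVW A
    _ = C * K * ENNReal.ofReal (r ^ t) * W A := by ring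

theorem sum_rpow_lt_one (hm : 2 ≤ m) (hp : ∀ i, 0 < p i) (hx : 0 < x) :
    ∑ a, p a ^ (x + 1) < 1 := by
  have hreal := sum_weight_rpow_lt_one hm hp (by linarith : 1 < x + 1)
  have hcoe : ∑ a, p a ^ (x + 1) = ENNReal.ofReal (∑ i, (p i).toReal ^ (x + 1)) := by
    rw [ENNReal.ofReal_sum_of_nonneg fun i _ => by positivity]
    refine Finset.sum_congr rfl fun a _ => ?_
    rw [← ENNReal.ofReal_rpow_of_pos (weight_pos hp a), ENNReal.ofReal_toReal (p.apply_ne_top a)]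
  rw [hcoe, ← ENNReal.ofReal_one]
  exact (ENNReal.ofReal_lt_ofReal_iff zero_lt_one).2 hreal

theorem exists_mul_lt_one {a b : ℝ≥0∞} (ha : 1 < a) (hb : b < 1) :
    ∃ κ, 1 < κ ∧ κ < a ∧ κ * b < 1 := by
  obtain ⟨κ, hκ, hκ_lt⟩ := exists_between (lt_min ha (ENNReal.one_lt_inv.2 hb))
  refine ⟨κ, hκ, hκ_lt.trans_le (min_le_left _ _), ENNReal.mul_lt_of_lt_div ?_⟩
  rw [one_div]
  exact hκ_lt.trans_le (min_le_right _ _)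

theorem sum_mul_potential_le (hθ0 : θ ≠ 0) (hθt : θ ≠ ⊤) (κ : ℝ≥0∞) (A : E N →L[ℝ] E N) :
    ∑ a, κ * p a ^ (x + 1) * potential T p s x θ (A * T a) ≤ κ / θ * potential T p s x θ A := by
  calc ∑ a, κ * p a ^ (x + 1) * potential T p s x θ (A * T a)
      = κ / θ * (θ * transfer T p x (potential T p s x θ) A) := by
        rw [← mul_assoc, ENNReal.div_mul_cancel hθ0 hθt, transfer, Finset.mul_sum]
        exact Finset.sum_congr rfl fun a _ => by ring
    _ ≤ κ / θ * potential T p s x θ A := by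
        gcongr
        exact mul_transfer_potential_le A

theorem exists_ne_zero_lt_one_mul_lt_one {K : ℝ≥0∞} (hK : K ≠ ⊤) :
    ∃ δ : ℝ≥0∞, δ ≠ 0 ∧ δ < 1 ∧ δ * K < 1 := by
  have hK1 : (K + 1)⁻¹ ≠ 0 := ENNReal.inv_ne_zero.2 (ENNReal.add_ne_top.2 ⟨hK, ENNReal.one_ne_top⟩)
  obtain ⟨δ, hδ0, hδ⟩ := exists_between (pos_iff_ne_zero.2 hK1)
  have hδ_lt : δ * (K + 1) < 1 := ENNReal.mul_lt_of_lt_div (by rwa [one_div])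
  exact ⟨δ, hδ0.ne', hδ.trans_le (ENNReal.inv_le_one.2 le_add_self),
    (mul_le_mul_right le_self_add δ).trans_lt hδ_lt⟩

theorem absolutelyContinuous_restrict_closedBall (hν : ν ≪ volume) (hνR : ∀ᵐ z ∂ν, ‖z‖ ≤ R) :
    ν ≪ volume.restrict (Metric.closedBall 0 R) := by
  have hmem : ∀ᵐ z ∂ν, z ∈ Metric.closedBall (0 : E N) R := by
    simpa only [mem_closedBall_zero_iff] using hνR
  rw [← Measure.restrict_eq_self_of_ae_mem hmem]
  exact hν.restrict _

theorem volume_ellipsoid_le_phiNegPow (hN : 1 ≤ N) (hs : 0 < s) (hsN : s ≤ N) (hR : 0 ≤ R)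
    {A : E N →L[ℝ] E N} (hA : Function.Injective A) (y : E N) {r : ℝ} (hr : 0 < r) :
    volume {z : E N | ‖z‖ ≤ R ∧ ‖A (y - z)‖ ≤ r} ≤
      ENNReal.ofReal ((2 * (R + 1)) ^ N) * ENNReal.ofReal (r ^ s) * phiNegPow s 1 A := by
  refine (volume_ellipsoid_le hN hs hsN hR hA y hr).trans_eq ?_
  rw [phiNegPow, ENNReal.rpow_neg_one, ENNReal.ofReal_mul (by positivity), mul_assoc,
    ENNReal.ofReal_div_of_pos (singularValueFunction_pos hA hs), div_eq_mul_inv]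

variable [IsProbabilityMeasure ν]

theorem isScaleBounded_corrMoment_of_concMoment (hm : 2 ≤ m) (hT : NormBounds T ρ c)
    (hp : ∀ i, 0 < p i) (hR : 0 ≤ R) (hx : 0 < x) (hθ : 1 < θ) (hθt : θ ≠ ⊤)
    (hconc : IsScaleBounded (concMoment T p R ν x) (s * x) (potential T p s x θ)) :
    IsScaleBounded (corrMoment T p R ν x) (s * x) (potential T p s x θ) := by
  obtain ⟨C₁, hC₁, hconc⟩ := hconc
  obtain ⟨κ, hκ1, hκθ, hκsum⟩ := exists_mul_lt_one hθ (sum_rpow_lt_one hm hp hx)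
  obtain ⟨C₂, hC₂, hadd⟩ := exists_add_rpow_le hx hκ1 hκθ.ne_top
  have hη : κ / θ < 1 := ENNReal.div_lt_of_lt_mul (by rwa [one_mul])
  refine ⟨C₂ * C₁ * (1 - κ / θ)⁻¹, ENNReal.mul_ne_top (ENNReal.mul_ne_top hC₂ hC₁)
    (ENNReal.inv_ne_top.2 (tsub_pos_of_lt hη).ne'), fun A hA r hr => ?_⟩
  have hrec : ∀ B ∈ {B : E N →L[ℝ] E N | Function.Injective B}, corrMoment T p R ν x B r ≤
      (∑ a, κ * p a ^ (x + 1) * corrMoment T p R ν x (B * T a) r) +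
        C₂ * C₁ * ENNReal.ofReal (r ^ (s * x)) * potential T p s x θ B := fun B hB => by
    refine (corrMoment_le hT hR hx.le hp hadd).trans (add_le_add le_rfl ?_)
    exact (mul_le_mul_right (hconc B hB r hr) C₂).trans_eq (by ring)
  refine (le_mul_of_le_sum_add (U := {B | Function.Injective B}) (F := fun a B => B * T a)
    (fun a B hB => hT.mul_injective hB a)
    (fun B => corrMoment_le_one hx.le) hrec
    (fun B _ => sum_mul_potential_le (zero_lt_one.trans hθ).ne' hθt κ B)
    (by rwa [← Finset.mul_sum]) hA).trans_eq ?_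
  ring

theorem concMoment_le_of_corrMoment_le (hN : 1 ≤ N) (hT : NormBounds T ρ c) (hR : 0 ≤ R)
    (hνR : ∀ᵐ z ∂ν, ‖z‖ ≤ R) (hs : 0 < s) (hsN : s ≤ N) (hx : 1 ≤ x) {M δ D : ℝ≥0∞}
    (hM : ∀ (H : E N → ℝ≥0∞) (B : ℝ≥0∞), Measurable H → (∀ z, H z ≤ B) →
      ∫⁻ z, H z ∂ν ≤ M * (∫⁻ z in Metric.closedBall 0 R, H z) + δ * B)
    {A : E N →L[ℝ] E N} (hA : Function.Injective A) {r : ℝ} (hr : 0 < r)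
    (hcorr : ∀ b, phiNegPow s 1 A * corrMoment T p R ν (x - 1) (A * T b) (2 * r) ≤
      ENNReal.ofReal (r ^ (s * (x - 1))) * D) :
    concMoment T p R ν x A r ≤ (∑ b, δ * p b * concMoment T p R ν x (A * T b) r) +
      M * ENNReal.ofReal ((2 * (R + 1)) ^ N) * ENNReal.ofReal (r ^ (s * x)) * D := by
  set K := ENNReal.ofReal ((2 * (R + 1)) ^ N)
  set L := M * K * ENNReal.ofReal (r ^ (s * x)) * D with hL
  have hpow : ENNReal.ofReal (r ^ (s * x)) =
      ENNReal.ofReal (r ^ s) * ENNReal.ofReal (r ^ (s * (x - 1))) := by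
    rw [← ENNReal.ofReal_mul (by positivity), ← Real.rpow_add hr]
    congr 2
    ring
  have hmain : ∀ b, M * (K * ENNReal.ofReal (r ^ s) * phiNegPow s 1 A *
      corrMoment T p R ν (x - 1) (A * T b) (2 * r)) ≤ L := fun b => by
    calc _ = M * K * ENNReal.ofReal (r ^ s) *
          (phiNegPow s 1 A * corrMoment T p R ν (x - 1) (A * T b) (2 * r)) := by ring
      _ ≤ M * K * ENNReal.ofReal (r ^ s) * (ENNReal.ofReal (r ^ (s * (x - 1))) * D) :=
          mul_le_mul_right (hcorr b) _
      _ = L := by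
          rw [hL, hpow]
          ring
  calc concMoment T p R ν x A r
      ≤ ∑ b, p b * (M * (K * ENNReal.ofReal (r ^ s) * phiNegPow s 1 A *
          corrMoment T p R ν (x - 1) (A * T b) (2 * r)) +
          δ * concMoment T p R ν x (A * T b) r) := concMoment_le hT hR hx hνR hM fun y =>
        volume_ellipsoid_le_phiNegPow hN hs hsN hR hA y hr
    _ ≤ ∑ b, p b * (L + δ * concMoment T p R ν x (A * T b) r) := by
        gcongr with b
        exact hmain b
    _ = (∑ b, δ * p b * concMoment T p R ν x (A * T b) r) + L := by
        simp_rw [mul_add, Finset.sum_add_distrib, ← Finset.sum_mul, sum_pmf, one_mul, add_comm L,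
          mul_left_comm (p _) δ, mul_assoc]

theorem isScaleBounded_concMoment_of_corrMoment_le (hN : 1 ≤ N) (hT : NormBounds T ρ c)
    (hR : 0 ≤ R) (hν : ν ≪ volume) (hνR : ∀ᵐ z ∂ν, ‖z‖ ≤ R) (hs : 0 < s) (hsN : s ≤ N)
    (hx : 1 ≤ x) {V : (E N →L[ℝ] E N) → ℝ≥0∞} {K C₁ : ℝ≥0∞} (hK : K ≠ ⊤) (hC₁ : C₁ ≠ ⊤)
    (hV : ∀ A : E N →L[ℝ] E N, Function.Injective A → ∀ a, V (A * T a) ≤ K * V A)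
    (hcorr : ∀ A : E N →L[ℝ] E N, Function.Injective A → ∀ r, 0 < r → ∀ b,
      phiNegPow s 1 A * corrMoment T p R ν (x - 1) (A * T b) (2 * r) ≤
        ENNReal.ofReal (r ^ (s * (x - 1))) * (C₁ * V A)) :
    IsScaleBounded (concMoment T p R ν x) (s * x) V := by
  obtain ⟨δ, hδ0, hδ1, hδK⟩ := exists_ne_zero_lt_one_mul_lt_one hK
  obtain ⟨M, hMt, hM⟩ := exists_lintegral_le_of_absolutelyContinuous
    (absolutelyContinuous_restrict_closedBall hν hνR) hδ0
  set c₀ := ENNReal.ofReal ((2 * (R + 1)) ^ N)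
  refine ⟨M * c₀ * C₁ * (1 - δ * K)⁻¹,
    ENNReal.mul_ne_top (ENNReal.mul_ne_top (ENNReal.mul_ne_top hMt ENNReal.ofReal_ne_top) hC₁)
      (ENNReal.inv_ne_top.2 (tsub_pos_of_lt hδK).ne'), fun A hA r hr => ?_⟩
  have hrec : ∀ B ∈ {B : E N →L[ℝ] E N | Function.Injective B}, concMoment T p R ν x B r ≤
      (∑ b, δ * p b * concMoment T p R ν x (B * T b) r) +
        M * c₀ * ENNReal.ofReal (r ^ (s * x)) * C₁ * V B := fun B hB => by
    rw [mul_assoc _ C₁]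
    exact concMoment_le_of_corrMoment_le hN hT hR hνR hs hsN hx hM hB hr (hcorr B hB r hr)
  have hVsum : ∀ B ∈ {B : E N →L[ℝ] E N | Function.Injective B},
      ∑ b, δ * p b * V (B * T b) ≤ δ * K * V B := fun B hB => by
    calc ∑ b, δ * p b * V (B * T b) ≤ ∑ b, δ * p b * (K * V B) := by
          gcongr with b
          exact hV B hB b
      _ = δ * K * V B := by rw [← Finset.sum_mul, ← Finset.mul_sum, sum_pmf, mul_one, mul_assoc]
  refine (le_mul_of_le_sum_add (U := {B | Function.Injective B}) (F := fun a B => B * T a)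
    (fun a B hB => hT.mul_injective hB a)
    (fun B => concMoment_le_one (by linarith)) hrec hVsum ?_ hA).trans_eq (by ring)
  rwa [← Finset.mul_sum, sum_pmf, mul_one]

theorem isScaleBounded_concMoment_one (hN : 1 ≤ N) (hT : NormBounds T ρ c) (hR : 0 ≤ R)
    (hν : ν ≪ volume) (hνR : ∀ᵐ z ∂ν, ‖z‖ ≤ R) (hs : 0 < s) (hsN : s ≤ N) :
    IsScaleBounded (concMoment T p R ν 1) s (phiNegPow s 1) := by
  obtain ⟨K, hK, hV⟩ := exists_phiNegPow_one_mul_le hT hs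
  have hbound := isScaleBounded_concMoment_of_corrMoment_le (p := p) (x := 1)
    hN hT hR hν hνR hs hsN le_rfl hK ENNReal.one_ne_top hV fun A _ r _ b => by
      simp only [sub_self, mul_zero, Real.rpow_zero, ENNReal.ofReal_one, one_mul]
      exact mul_le_of_le_one_right' (corrMoment_le_one le_rfl)
  rwa [mul_one] at hbound

theorem concMoment_le_rpow (hT : NormBounds T ρ c) (hR : 0 ≤ R) (hx : 0 < x) (hx1 : x ≤ 1)
    (A : E N →L[ℝ] E N) (r : ℝ) :
    concMoment T p R ν x A r ≤ concMoment T p R ν 1 A r ^ x := by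
  refine iSup_le fun y => ?_
  refine (lintegral_rpow_le_rpow _
    (measurable_nearMass hT hR p A r measurable_const measurable_id) hx hx1).trans ?_
  rw [div_one]
  exact ENNReal.rpow_le_rpow (lintegral_nearMass_rpow_le_concMoment y) hx.le

theorem isScaleBounded_concMoment_of_le_one (hN : 1 ≤ N) (hT : NormBounds T ρ c) (hR : 0 ≤ R)
    (hν : ν ≪ volume) (hνR : ∀ᵐ z ∂ν, ‖z‖ ≤ R) (hs : 0 < s) (hsN : s ≤ N) (hx : 0 < x)
    (hx1 : x ≤ 1) : IsScaleBounded (concMoment T p R ν x) (s * x) (phiNegPow s x) := by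
  obtain ⟨C, hC, hle⟩ := isScaleBounded_concMoment_one (p := p) hN hT hR hν hνR hs hsN
  refine ⟨C ^ x, ENNReal.rpow_ne_top_of_nonneg hx.le hC, fun A hA r hr => ?_⟩
  calc concMoment T p R ν x A r ≤ concMoment T p R ν 1 A r ^ x :=
        concMoment_le_rpow hT hR hx hx1 A r
    _ ≤ (C * ENNReal.ofReal (r ^ s) * phiNegPow s 1 A) ^ x :=
        ENNReal.rpow_le_rpow (hle A hA r hr) hx.le
    _ = C ^ x * ENNReal.ofReal (r ^ (s * x)) * phiNegPow s x A := by
        rw [ENNReal.mul_rpow_of_nonneg _ _ hx.le, ENNReal.mul_rpow_of_nonneg _ _ hx.le,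
          ENNReal.ofReal_rpow_of_pos (by positivity), ← Real.rpow_mul hr.le, phiNegPow,
          phiNegPow, ← ENNReal.rpow_mul, neg_one_mul]

theorem isScaleBounded_concMoment_of_corrMoment_sub_one (hN : 1 ≤ N) (hT : NormBounds T ρ c)
    (hp : ∀ i, 0 < p i) (hR : 0 ≤ R) (hν : ν ≪ volume) (hνR : ∀ᵐ z ∂ν, ‖z‖ ≤ R) (hs : 0 < s)
    (hsN : s ≤ N) (hx : 1 < x) (hθ : 1 ≤ θ)
    (hcorr : IsScaleBounded (corrMoment T p R ν (x - 1)) (s * (x - 1))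
      (potential T p s (x - 1) θ)) :
    IsScaleBounded (concMoment T p R ν x) (s * x)
      (fun A => phiNegPow s 1 A * potential T p s (x - 1) θ A) := by
  obtain ⟨C, hC, hcorr⟩ := hcorr
  obtain ⟨K₁, hK₁, hphi⟩ := exists_phiNegPow_one_mul_le hT hs
  obtain ⟨K₂, hK₂, hpot⟩ := exists_potential_mul_le (T := T) (s := s) hp (sub_pos.2 hx) hθ
  set Z := potential T p s (x - 1) θ
  set κ := ENNReal.ofReal (2 ^ (s * (x - 1)))
  refine isScaleBounded_concMoment_of_corrMoment_le (K := K₁ * K₂) (C₁ := C * κ * K₂) hN hT hR hν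
    hνR hs hsN hx.le (ENNReal.mul_ne_top hK₁ hK₂)
    (ENNReal.mul_ne_top (ENNReal.mul_ne_top hC ENNReal.ofReal_ne_top) hK₂)
    (fun A hA a => ?_) (fun A hA r hr b => ?_)
  · exact (mul_le_mul' (hphi A hA a) (hpot A a)).trans_eq (by ring)
  · have hscale : ENNReal.ofReal ((2 * r) ^ (s * (x - 1))) =
        κ * ENNReal.ofReal (r ^ (s * (x - 1))) := by
      rw [Real.mul_rpow (by norm_num) hr.le, ENNReal.ofReal_mul (by positivity)]
    calc phiNegPow s 1 A * corrMoment T p R ν (x - 1) (A * T b) (2 * r)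
        ≤ phiNegPow s 1 A * (C * ENNReal.ofReal ((2 * r) ^ (s * (x - 1))) * Z (A * T b)) := by
          gcongr
          exact hcorr (A * T b) (hT.mul_injective hA b) (2 * r) (by positivity)
      _ ≤ phiNegPow s 1 A * (C * ENNReal.ofReal ((2 * r) ^ (s * (x - 1))) * (K₂ * Z A)) := by
          gcongr
          exact hpot A b
      _ = ENNReal.ofReal (r ^ (s * (x - 1))) * (C * κ * K₂ * (phiNegPow s 1 A * Z A)) := by
          rw [hscale]
          ring

-- Induction on `⌈x⌉`: the concentration moment of order `x` is controlled by the correlation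
-- moment of order `x - 1`, and Jensen's inequality starts the induction on `(0, 1]`.
theorem isScaleBounded_corrMoment (hN : 1 ≤ N) (hm : 2 ≤ m) (hT : NormBounds T ρ c)
    (hp : ∀ i, 0 < p i) (hR : 0 ≤ R) (hν : ν ≪ volume) (hνR : ∀ᵐ z ∂ν, ‖z‖ ≤ R) (hs : 0 < s)
    (hsN : s ≤ N) (hx : 0 < x) (hθ : 1 < θ) (hθt : θ ≠ ⊤) :
    IsScaleBounded (corrMoment T p R ν x) (s * x) (potential T p s x θ) := by
  obtain ⟨n, hn⟩ := exists_nat_ge x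
  induction n generalizing x θ with
  | zero => exact absurd hx (by exact_mod_cast hn.not_gt)
  | succ n ih =>
    refine isScaleBounded_corrMoment_of_concMoment hm hT hp hR hx hθ hθt ?_
    rcases le_or_gt x 1 with hx1 | hx1
    · refine (isScaleBounded_concMoment_of_le_one hN hT hR hν hνR hs hsN hx hx1).mono
        ENNReal.one_ne_top fun A => ?_
      rw [one_mul]
      exact phiNegPow_le_potential A
    · obtain ⟨θ', K, hθ', hθ't, hK, hpot⟩ :=
        exists_phiNegPow_one_mul_potential_le (T := T) (s := s) hp hx1 hθ hθt
      have hcorr := ih (sub_pos.2 hx1) hθ' hθ't (by push_cast at hn; linarith)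
      exact (isScaleBounded_concMoment_of_corrMoment_sub_one hN hT hp hR hν hνR hs hsN hx1 hθ'.le
        hcorr).mono hK hpot

end MomentBounds

section PowerBounds

/-- `g r = O(r ^ a)` on `(0, 1]`. -/
def IsRpowBounded (g : ℝ → ℝ≥0∞) (a : ℝ) : Prop :=
  ∃ C : ℝ≥0∞, C ≠ ⊤ ∧ ∀ r, 0 < r → r ≤ 1 → g r ≤ C * ENNReal.ofReal (r ^ a)

variable {g : ℝ → ℝ≥0∞} {a b : ℝ}

theorem IsRpowBounded.mono_exponent (hg : IsRpowBounded g a) (hba : b ≤ a) :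
    IsRpowBounded g b := by
  obtain ⟨C, hC, hle⟩ := hg
  refine ⟨C, hC, fun r hr hr1 => (hle r hr hr1).trans ?_⟩
  have hrpow := Real.rpow_le_rpow_of_exponent_ge hr hr1 hba
  gcongr

theorem IsRpowBounded.of_le_rpow {f : ℝ → ℝ≥0∞} (hg : IsRpowBounded g a) {y : ℝ} (hy : 0 ≤ y)
    (hfg : ∀ r, f r ≤ g r ^ y) : IsRpowBounded f (a * y) := by
  obtain ⟨C, hC, hle⟩ := hg
  refine ⟨C ^ y, ENNReal.rpow_ne_top_of_nonneg hy hC, fun r hr hr1 => ?_⟩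
  calc f r ≤ g r ^ y := hfg r
    _ ≤ (C * ENNReal.ofReal (r ^ a)) ^ y := ENNReal.rpow_le_rpow (hle r hr hr1) hy
    _ = C ^ y * ENNReal.ofReal (r ^ (a * y)) := by
        rw [ENNReal.mul_rpow_of_nonneg _ _ hy, ENNReal.ofReal_rpow_of_pos (by positivity),
          ← Real.rpow_mul hr.le]

theorem isRpowBounded_of_forall_half_pow (hg : Monotone g) (ha : 0 ≤ a) {K : ℝ≥0∞} (hK : K ≠ ⊤)
    (hle : ∀ n : ℕ, g ((1 / 2) ^ n) ≤ K * ENNReal.ofReal (((1 / 2) ^ n) ^ a)) :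
    IsRpowBounded g a := by
  refine ⟨K * ENNReal.ofReal (2 ^ a), ENNReal.mul_ne_top hK ENNReal.ofReal_ne_top,
    fun r hr hr1 => ?_⟩
  obtain ⟨n, hn_lt, hn_le⟩ := exists_nat_pow_near_of_lt_one hr hr1
    (by norm_num : (0 : ℝ) < 1 / 2) (by norm_num)
  have hn : (1 / 2 : ℝ) ^ n ≤ 2 * r := by
    rw [pow_succ] at hn_lt
    linarith
  calc g r ≤ g ((1 / 2) ^ n) := hg hn_le
    _ ≤ K * ENNReal.ofReal (((1 / 2) ^ n) ^ a) := hle n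
    _ ≤ K * ENNReal.ofReal ((2 * r) ^ a) := by gcongr
    _ = K * ENNReal.ofReal (2 ^ a) * ENNReal.ofReal (r ^ a) := by
        rw [Real.mul_rpow (by norm_num) hr.le, ENNReal.ofReal_mul (by positivity), mul_assoc]

variable {Ω : Type*} [MeasurableSpace Ω] {P : Measure Ω} {f : ℝ → Ω → ℝ≥0∞}

theorem tsum_lintegral_half_pow_ne_top {C : ℝ≥0∞} (hC : C ≠ ⊤)
    (hf : ∀ r, 0 < r → ∫⁻ ω, f r ω ∂P ≤ C * ENNReal.ofReal (r ^ a)) (hba : b < a) :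
    ∑' n : ℕ, ENNReal.ofReal (((1 / 2 : ℝ) ^ n) ^ (-b)) * ∫⁻ ω, f ((1 / 2) ^ n) ω ∂P ≠ ⊤ := by
  have hterm : ∀ n : ℕ, ENNReal.ofReal (((1 / 2 : ℝ) ^ n) ^ (-b)) * ∫⁻ ω, f ((1 / 2) ^ n) ω ∂P ≤
      C * ENNReal.ofReal (((1 / 2 : ℝ) ^ (a - b)) ^ n) := fun n => by
    have hpow : ((1 / 2 : ℝ) ^ (a - b)) ^ n = ((1 / 2 : ℝ) ^ n) ^ (-b) * ((1 / 2 : ℝ) ^ n) ^ a := by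
      rw [← Real.rpow_add (by positivity), ← Real.rpow_natCast, ← Real.rpow_natCast,
        ← Real.rpow_mul (by norm_num), ← Real.rpow_mul (by norm_num)]
      congr 1
      ring
    refine (mul_le_mul_right (hf _ (by positivity)) _).trans_eq ?_
    rw [hpow, ENNReal.ofReal_mul (by positivity)]
    ring
  refine ne_top_of_le_ne_top ?_ (ENNReal.tsum_le_tsum hterm)
  rw [ENNReal.tsum_mul_left]
  refine ENNReal.mul_ne_top hC (Summable.tsum_ofReal_ne_top ?_)
  exact summable_geometric_of_lt_one (by positivity)
    (Real.rpow_lt_one (by norm_num) (by norm_num) (sub_pos.2 hba))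

theorem ae_isRpowBounded_of_lintegral_le (hmeas : ∀ r, Measurable (f r))
    (hmono : ∀ ω, Monotone fun r => f r ω) {C : ℝ≥0∞} (hC : C ≠ ⊤)
    (hf : ∀ r, 0 < r → ∫⁻ ω, f r ω ∂P ≤ C * ENNReal.ofReal (r ^ a)) (hb : 0 ≤ b) (hba : b < a) :
    ∀ᵐ ω ∂P, IsRpowBounded (fun r => f r ω) b := by
  let F : ℕ → Ω → ℝ≥0∞ := fun n ω => ENNReal.ofReal (((1 / 2 : ℝ) ^ n) ^ (-b)) * f ((1 / 2) ^ n) ω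
  have hF : ∀ n, Measurable (F n) := fun n => (hmeas _).const_mul _
  have hsum : ∫⁻ ω, ∑' n, F n ω ∂P ≠ ⊤ := by
    rw [lintegral_tsum fun n => (hF n).aemeasurable]
    simp only [F, lintegral_const_mul _ (hmeas _)]
    exact tsum_lintegral_half_pow_ne_top hC hf hba
  filter_upwards [ae_lt_top (Measurable.tsum hF) hsum] with ω hω
  refine isRpowBounded_of_forall_half_pow (hmono ω) hb hω.ne fun n => ?_
  have hcancel : ENNReal.ofReal (((1 / 2 : ℝ) ^ n) ^ (-b)) *
      ENNReal.ofReal (((1 / 2 : ℝ) ^ n) ^ b) = 1 := by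
    rw [← ENNReal.ofReal_mul (by positivity), ← Real.rpow_add (by positivity), neg_add_cancel,
      Real.rpow_zero, ENNReal.ofReal_one]
  calc f ((1 / 2) ^ n) ω = F n ω * ENNReal.ofReal (((1 / 2) ^ n) ^ b) := by
        rw [mul_right_comm, hcancel, one_mul]
    _ ≤ (∑' n, F n ω) * ENNReal.ofReal (((1 / 2) ^ n) ^ b) := by
        gcongr
        exact ENNReal.le_tsum n

end PowerBounds

section SampleCorrMoment

variable {N m : ℕ} {T : Fin m → E N →L[ℝ] E N} {ρ c R : ℝ} {p : PMF (Fin m)} {q s x : ℝ}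
  {A : E N →L[ℝ] E N}

theorem sum_ofFn_succ {M : Type*} [AddCommMonoid M] (k : ℕ) (f : List (Fin m) → M) :
    ∑ w : Fin (k + 1) → Fin m, f (List.ofFn w) =
      ∑ a, ∑ w : Fin k → Fin m, f (a :: List.ofFn w) := by
  rw [← Fintype.sum_prod_type']
  refine (Fintype.sum_equiv (Fin.consEquiv fun _ : Fin (k + 1) => Fin m) _ _ fun v => ?_).symm
  exact congrArg f (List.ofFn_cons v.1 v.2).symm

theorem iterate_transfer_eq_sum (hp : ∀ i, 0 < p i) (f : (E N →L[ℝ] E N) → ℝ≥0∞) (k : ℕ)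
    (A : E N →L[ℝ] E N) :
    (transfer T p x)^[k] f A = ∑ w : Fin k → Fin m,
      ENNReal.ofReal (wordWeight p (List.ofFn w)) ^ (x + 1) * f (A * wordMap T (List.ofFn w)) := by
  induction k generalizing A with
  | zero => simp [wordWeight_nil, wordMap_nil]
  | succ k ih =>
    rw [Function.iterate_succ_apply', transfer, sum_ofFn_succ k fun w =>
      ENNReal.ofReal (wordWeight p w) ^ (x + 1) * f (A * wordMap T w)]
    refine Finset.sum_congr rfl fun a _ => ?_
    rw [ih, Finset.mul_sum]
    refine Finset.sum_congr rfl fun w _ => ?_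
    have ha : ENNReal.ofReal (p a).toReal ≠ 0 := by simpa using weight_pos hp a
    have hw : ENNReal.ofReal (wordWeight p (List.ofFn w)) ≠ 0 := by simpa using wordWeight_pos hp _
    rw [wordWeight_cons, wordMap_cons, ENNReal.ofReal_mul (weight_pos hp a).le,
      ENNReal.mul_rpow_of_ne_zero ha hw, ENNReal.ofReal_toReal (p.apply_ne_top a), mul_assoc A,
      mul_assoc]

theorem iterate_transfer_one (hT : NormBounds T ρ c) (hp : ∀ i, 0 < p i) (hs : 0 < s) (k : ℕ) :
    (transfer T p (q - 1))^[k] (phiNegPow s (q - 1)) 1 =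
      ENNReal.ofReal (levelSum T (bernoulliMeasure p) q s k) := by
  rw [iterate_transfer_eq_sum hp, levelSum_eq,
    ENNReal.ofReal_sum_of_nonneg fun w _ => (wordTerm_pos hT hp hs _).le]
  refine Finset.sum_congr rfl fun w _ => ?_
  have hφ := singularValueFunction_pos (hT.wordMap_injective (List.ofFn w)) hs
  have hw := wordWeight_pos hp (List.ofFn w)
  rw [wordTerm, ENNReal.ofReal_mul (by positivity), ← ENNReal.ofReal_rpow_of_pos hφ,
    ← ENNReal.ofReal_rpow_of_pos hw, phiNegPow, one_mul, sub_add_cancel, mul_comm, neg_sub]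

theorem eventually_levelSum_lt_exp (hN : 1 ≤ N) (hm : 1 ≤ m) (hT : NormBounds T ρ c)
    (hp : ∀ i, 0 < p i) (hs : 0 < s) (hq : 1 ≤ q) {P : ℝ} (hP : pressure T p q s < P) :
    ∀ᶠ k : ℕ in atTop, levelSum T (bernoulliMeasure p) q s k < Real.exp (P * k) := by
  filter_upwards [(tendsto_pressure hN hm hT hp hs hq).eventually (gt_mem_nhds hP),
    eventually_ge_atTop 1] with k hk hk1
  have hk0 : (0 : ℝ) < k := by exact_mod_cast hk1
  rwa [div_lt_iff₀ hk0, Real.log_lt_iff_lt_exp (levelSum_pos hm hT hp hs k)] at hk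

theorem exists_potential_one_ne_top (hN : 1 ≤ N) (hm : 1 ≤ m) (hT : NormBounds T ρ c)
    (hp : ∀ i, 0 < p i) (hs : 0 < s) (hq : 1 ≤ q) (hP : pressure T p q s < 0) :
    ∃ θ : ℝ≥0∞, 1 < θ ∧ θ ≠ ⊤ ∧ potential T p s (q - 1) θ 1 ≠ ⊤ := by
  set P := pressure T p q s
  refine ⟨ENNReal.ofReal (Real.exp (-P / 4)), ?_, ENNReal.ofReal_ne_top, ?_⟩
  · rw [ENNReal.one_lt_ofReal, Real.one_lt_exp_iff]
    linarith
  have hterm : ∀ k, ENNReal.ofReal (Real.exp (-P / 4)) ^ k *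
      (transfer T p (q - 1))^[k] (phiNegPow s (q - 1)) 1 =
      ENNReal.ofReal (Real.exp (-P / 4) ^ k * levelSum T (bernoulliMeasure p) q s k) := fun k => by
    rw [iterate_transfer_one hT hp hs, ENNReal.ofReal_mul (by positivity),
      ENNReal.ofReal_pow (by positivity)]
  simp only [potential, hterm]
  refine Summable.tsum_ofReal_ne_top (Summable.of_norm_bounded_eventually_nat
    (summable_geometric_of_lt_one (Real.exp_pos (P / 4)).le
      (Real.exp_lt_one_iff.2 (by linarith : P / 4 < 0))) ?_)
  filter_upwards [eventually_levelSum_lt_exp hN hm hT hp hs hq (by linarith : P < P / 2)] with k hk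
  have hS := levelSum_pos hm hT hp hs (q := q) k
  rw [Real.norm_of_nonneg (by positivity)]
  calc Real.exp (-P / 4) ^ k * levelSum T (bernoulliMeasure p) q s k
      ≤ Real.exp (-P / 4) ^ k * Real.exp (P / 2 * k) := by gcongr
    _ = Real.exp (P / 4) ^ k := by
        rw [← Real.exp_nat_mul, ← Real.exp_nat_mul, ← Real.exp_add]
        congr 1
        ring

theorem monotone_sampleCorrMoment (hx : 0 ≤ x) (ω : List (Fin m) → E N) :
    Monotone fun r => sampleCorrMoment T p R x A r ω := fun _ _ hrr' =>
  lintegral_mono fun _ => ENNReal.rpow_le_rpow (measure_mono fun _ hj => le_trans hj hrr') hx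

theorem sampleCorrMoment_le_rpow (hT : NormBounds T ρ c) (hR : 0 ≤ R) {y : ℝ} (hx : 0 < x)
    (hxy : x ≤ y) (r : ℝ) (ω : List (Fin m) → E N) :
    sampleCorrMoment T p R x A r ω ≤ sampleCorrMoment T p R y A r ω ^ (x / y) :=
  lintegral_rpow_le_rpow _
    (measurable_nearMass_clippedProjection hT hR p A r measurable_const measurable_id) hx hxy

theorem ae_isRpowBounded_sampleCorrMoment (hN : 1 ≤ N) (hm : 2 ≤ m) (hT : NormBounds T ρ c)
    (hp : ∀ i, 0 < p i) (hR : 0 ≤ R) {ν : Measure (E N)} [IsProbabilityMeasure ν]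
    (hν : ν ≪ volume) (hνR : ∀ᵐ z ∂ν, ‖z‖ ≤ R) (hsN : s ≤ N) (hq : 1 < q)
    (hP : pressure T p q s < 0) {t : ℝ} (ht : 0 < t) (hts : t < s) :
    ∀ᵐ ω ∂(displacementLaw m ν),
      IsRpowBounded (fun r => sampleCorrMoment T p R (q - 1) 1 r ω) (t * (q - 1)) := by
  have hs : 0 < s := ht.trans hts
  have hx : 0 < q - 1 := sub_pos.2 hq
  obtain ⟨θ, hθ, hθt, hpot⟩ := exists_potential_one_ne_top hN (by lia) hT hp hs hq.le hP
  obtain ⟨C, hC, hcorr⟩ := isScaleBounded_corrMoment hN hm hT hp hR hν hνR hs hsN hx hθ hθt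
  refine ae_isRpowBounded_of_lintegral_le (measurable_sampleCorrMoment hT hR p (q - 1) 1)
    (monotone_sampleCorrMoment hx.le) (ENNReal.mul_ne_top hC hpot) (fun r hr => ?_)
    (by positivity) (mul_lt_mul_of_pos_right hts hx)
  rw [mul_right_comm]
  exact hcorr 1 Function.injective_id r hr

theorem exists_rat_pressure_neg (hN : 1 ≤ N) (hm : 1 ≤ m) (hT : NormBounds T ρ c)
    (hp : ∀ i, 0 < p i) (hq : 1 < q) (hP : pressure T p q s < 0) {t : ℝ} (ht : 0 < t)
    (hts : t < s) :
    ∃ Q S t' : ℚ, q < Q ∧ S < s ∧ t < t' ∧ (t' : ℝ) < S ∧ pressure T p Q S < 0 := by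
  obtain ⟨S, htS, hSs⟩ := exists_rat_btwn hts
  obtain ⟨t', htt', ht'S⟩ := exists_rat_btwn htS
  have hS : (0 : ℝ) < S := ht.trans htS
  have hPS : pressure T p q S < 0 :=
    (strictMonoOn_pressure hN hm hT hp hq hS (hS.trans hSs) hSs).trans hP
  have hSc : S * Real.log c < 0 :=
    mul_neg_of_pos_of_neg hS (Real.log_neg hT.lower_pos hT.lower_lt_one)
  obtain ⟨Q, hqQ, hQ⟩ := exists_rat_btwn (lt_add_of_pos_right q (div_pos_of_neg_of_neg hPS hSc))
  refine ⟨Q, S, t', hqQ, hSs, htt', ht'S, ?_⟩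
  have hexp := pressure_exponent_add_le hN hm hT hp hS hq.le (sub_nonneg.2 hqQ.le)
  rw [add_sub_cancel] at hexp
  have hQ' : (Q : ℝ) - q < pressure T p q S / (S * Real.log c) := by linarith
  rw [lt_div_iff_of_neg hSc] at hQ'
  nlinarith

-- Rational parameters suffice: the pressure is strictly monotone in `s` and Lipschitz in `q`, and
-- Hölder's inequality carries a bound from a larger moment order to a smaller one.
theorem ae_forall_isRpowBounded_sampleCorrMoment (hN : 1 ≤ N) (hm : 2 ≤ m)
    (hT : NormBounds T ρ c) (hp : ∀ i, 0 < p i) (hR : 0 ≤ R) {ν : Measure (E N)}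
    [IsProbabilityMeasure ν] (hν : ν ≪ volume) (hνR : ∀ᵐ z ∂ν, ‖z‖ ≤ R) :
    ∀ᵐ ω ∂(displacementLaw m ν), ∀ q s t : ℝ, 1 < q → s ≤ N → pressure T p q s < 0 → 0 < t →
      t < s → IsRpowBounded (fun r => sampleCorrMoment T p R (q - 1) 1 r ω) (t * (q - 1)) := by
  have hrat : ∀ᵐ ω ∂(displacementLaw m ν), ∀ Q S t : ℚ, (1 : ℝ) < Q → (S : ℝ) ≤ N →
      pressure T p Q S < 0 → (0 : ℝ) < t → (t : ℝ) < S →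
        IsRpowBounded (fun r => sampleCorrMoment T p R (Q - 1) 1 r ω) (t * (Q - 1)) := by
    simp only [ae_all_iff]
    intro Q S t hQ hS hP ht hts
    exact ae_isRpowBounded_sampleCorrMoment hN hm hT hp hR hν hνR hS hQ hP ht hts
  filter_upwards [hrat] with ω hω q s t hq hsN hP ht hts
  obtain ⟨Q, S, t', hqQ, hSs, htt', ht'S, hPQ⟩ :=
    exists_rat_pressure_neg hN (by lia) hT hp hq hP ht hts
  have hx : 0 < q - 1 := sub_pos.2 hq
  have hX : 0 < (Q : ℝ) - 1 := sub_pos.2 (hq.trans hqQ)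
  have hQ := hω Q S t' (hq.trans hqQ) (hSs.le.trans hsN) hPQ (ht.trans htt') ht'S
  refine (hQ.of_le_rpow (y := (q - 1) / (Q - 1)) (by positivity) fun r =>
    sampleCorrMoment_le_rpow hT hR hx (by linarith) r ω).mono_exponent ?_
  rw [mul_assoc, mul_div_cancel₀ _ hX.ne']
  gcongr

end SampleCorrMoment

section MomentSum

variable {N m : ℕ} {T : Fin m → E N →L[ℝ] E N} {ρ c R : ℝ} {p : PMF (Fin m)} {q r : ℝ}
  {ω : List (Fin m) → E N}

theorem clippedProjection_eq_projection (hω : ∀ w, ‖ω w‖ ≤ R) :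
    clippedProjection T R ω = projection T ω := by
  funext i
  rw [clippedProjection, clip_eq_self hω]

theorem measurable_projection (hT : NormBounds T ρ c) (hR : 0 ≤ R) (hω : ∀ w, ‖ω w‖ ≤ R) :
    Measurable (projection T ω) := by
  rw [← clippedProjection_eq_projection hω]
  exact measurable_clippedProjection_comp hT hR measurable_const measurable_id

theorem isProbabilityMeasure_projectedMeasure (hT : NormBounds T ρ c) (hR : 0 ≤ R)
    (hω : ∀ w, ‖ω w‖ ≤ R) :
    IsProbabilityMeasure (projectedMeasure T (bernoulliMeasure p) ω) :=
  Measure.isProbabilityMeasure_map (measurable_projection hT hR hω).aemeasurable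

theorem tsum_measure_meshCube (τ : Measure (E N)) [IsProbabilityMeasure τ] (hr : 0 < r) :
    ∑' j : Fin N → ℤ, τ (meshCube r j) = 1 := by
  rw [← measure_iUnion (pairwise_disjoint_meshCube hr) fun j => measurableSet_meshCube r j,
    iUnion_meshCube hr, measure_univ]

theorem tsum_measure_meshCube_rpow_le_one (τ : Measure (E N)) [IsProbabilityMeasure τ]
    (hr : 0 < r) (hq : 1 ≤ q) : ∑' j : Fin N → ℤ, τ (meshCube r j) ^ q ≤ 1 := by
  rw [← tsum_measure_meshCube τ hr]
  exact ENNReal.tsum_le_tsum fun j => ENNReal.rpow_le_self_of_le_one prob_le_one hq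

theorem ofReal_momentSum (τ : Measure (E N)) [IsProbabilityMeasure τ] (hr : 0 < r) (hq : 1 ≤ q) :
    ENNReal.ofReal (momentSum τ q r) = ∑' j : Fin N → ℤ, τ (meshCube r j) ^ q := by
  have hfin : ∑' j : Fin N → ℤ, τ (meshCube r j) ^ q ≠ ⊤ :=
    ne_top_of_le_ne_top ENNReal.one_ne_top (tsum_measure_meshCube_rpow_le_one τ hr hq)
  rw [← ENNReal.ofReal_toReal hfin, ENNReal.tsum_toReal_eq fun j =>
    ENNReal.rpow_ne_top_of_nonneg (by linarith) (measure_ne_top τ _)]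
  simp only [momentSum, Measure.real, ENNReal.toReal_rpow]

theorem measure_preimage_meshCube_rpow_le (hT : NormBounds T ρ c) (hR : 0 ≤ R)
    (hω : ∀ w, ‖ω w‖ ≤ R) (hr : 0 ≤ r) (hq : 1 ≤ q) (j : Fin N → ℤ) :
    bernoulliMeasure p (projection T ω ⁻¹' meshCube r j) ^ q ≤
      ∫⁻ i in projection T ω ⁻¹' meshCube r j,
        nearMass T p R 1 (Real.sqrt N * r) (clippedProjection T R ω i) ω ^ (q - 1)
        ∂(bernoulliMeasure p) := by
  rw [rpow_eq_rpow_sub_one_mul hq, ← setLIntegral_const]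
  refine setLIntegral_mono' (measurable_projection hT hR hω (measurableSet_meshCube r j))
    fun i hi => ENNReal.rpow_le_rpow (measure_mono fun k hk => ?_) (by linarith)
  rw [Set.mem_ofPred_eq, clippedProjection_eq_projection hω]
  exact norm_sub_le_of_mem_meshCube hi hk hr

theorem tsum_projectedMeasure_rpow_le_sampleCorrMoment (hT : NormBounds T ρ c) (hR : 0 ≤ R)
    (hω : ∀ w, ‖ω w‖ ≤ R) (hr : 0 < r) (hq : 1 ≤ q) :
    ∑' j : Fin N → ℤ, projectedMeasure T (bernoulliMeasure p) ω (meshCube r j) ^ q ≤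
      sampleCorrMoment T p R (q - 1) 1 (Real.sqrt N * r) ω := by
  have hmeas := measurable_projection hT hR hω
  have hcover : ⋃ j : Fin N → ℤ, projection T ω ⁻¹' meshCube r j = Set.univ := by
    rw [← Set.preimage_iUnion, iUnion_meshCube hr, Set.preimage_univ]
  rw [sampleCorrMoment, ← setLIntegral_univ, ← hcover,
    lintegral_iUnion (fun j => hmeas (measurableSet_meshCube r j))
      fun j k hjk => (pairwise_disjoint_meshCube hr hjk).preimage _]
  refine ENNReal.tsum_le_tsum fun j => ?_
  rw [projectedMeasure, Measure.map_apply hmeas (measurableSet_meshCube r j)]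
  exact measure_preimage_meshCube_rpow_le hT hR hω hr.le hq j

theorem exists_momentSum_le (hN : 1 ≤ N) (hT : NormBounds T ρ c) (hR : 0 ≤ R)
    (hω : ∀ w, ‖ω w‖ ≤ R) (hq : 1 ≤ q) {a : ℝ}
    (hcorr : IsRpowBounded (fun r => sampleCorrMoment T p R (q - 1) 1 r ω) a) :
    ∃ K : ℝ, 0 < K ∧ ∀ᶠ r in 𝓝[>] 0,
      momentSum (projectedMeasure T (bernoulliMeasure p) ω) q r ≤ K * r ^ a := by
  have := isProbabilityMeasure_projectedMeasure (p := p) hT hR hω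
  obtain ⟨C, hC, hle⟩ := hcorr
  have hN0 : 0 < Real.sqrt N := Real.sqrt_pos.2 (by exact_mod_cast hN)
  refine ⟨(C.toReal + 1) * Real.sqrt N ^ a, by positivity, ?_⟩
  filter_upwards [Ioc_mem_nhdsGT (inv_pos.2 hN0)] with r ⟨hr0, hr1⟩
  have hscale : Real.sqrt N * r ≤ 1 := by rwa [← le_inv_mul_iff₀ hN0, mul_one]
  refine (ENNReal.ofReal_le_ofReal_iff (by positivity)).1 ?_
  calc ENNReal.ofReal (momentSum (projectedMeasure T (bernoulliMeasure p) ω) q r)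
      ≤ C * ENNReal.ofReal ((Real.sqrt N * r) ^ a) := by
        rw [ofReal_momentSum _ hr0 hq]
        exact (tsum_projectedMeasure_rpow_le_sampleCorrMoment hT hR hω hr0 hq).trans
          (hle _ (by positivity) hscale)
    _ = ENNReal.ofReal (C.toReal * Real.sqrt N ^ a * r ^ a) := by
        rw [Real.mul_rpow hN0.le hr0.le, mul_assoc, ENNReal.ofReal_mul ENNReal.toReal_nonneg,
          ENNReal.ofReal_toReal hC]
    _ ≤ ENNReal.ofReal ((C.toReal + 1) * Real.sqrt N ^ a * r ^ a) := by
        gcongr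
        linarith

end MomentSum

section Counting

variable {N m : ℕ} {T : Fin m → E N →L[ℝ] E N} {ρ c R : ℝ} {p : PMF (Fin m)} {q r s : ℝ}
  {ω : List (Fin m) → E N}

theorem prod_singularValue_le_pow (A : E N →L[ℝ] E N) {b : ℝ} (hb : ‖A‖ ≤ b) (j : ℕ) :
    ∏ i ∈ Finset.range j, singularValue A i ≤ b ^ j := by
  simpa using Finset.prod_le_prod (s := Finset.range j) (fun i _ => singularValue_nonneg A i)
    fun i _ => (singularValue_le_norm A i).trans hb

-- Compare the products of the first `i` and `i + 1` singular values of `A`, `A * B` and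
-- `A = (A * B) * B⁻¹`.
theorem pow_mul_singularValue_le_singularValue_mul {A B : E N →L[ℝ] E N}
    (hA : Function.Injective A) (hB : Function.Injective B) (hB1 : ‖B‖ ≤ 1) {d : ℝ} (hd0 : 0 < d)
    (hd1 : d ≤ 1) (hd : ∀ x, d * ‖x‖ ≤ ‖B x‖) {i : ℕ} (hi : i < N) :
    d ^ N * singularValue A i ≤ singularValue (A * B) i := by
  obtain ⟨C, -, hBC, -⟩ := exists_injective_mul_eq_one hB
  have hC : ‖C‖ ≤ d⁻¹ := by
    refine ContinuousLinearMap.opNorm_le_bound _ (by positivity) fun y => ?_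
    have hBCy : B (C y) = y := by
      rw [← mul_apply_eq_comp, hBC]
      rfl
    rw [le_inv_mul_iff₀ hd0]
    exact (hd (C y)).trans_eq (by rw [hBCy])
  set a := ∏ k ∈ Finset.range i, singularValue A k
  have ha : 0 < a :=
    Finset.prod_pos fun k hk => singularValue_pos hA ((Finset.mem_range.1 hk).trans hi)
  have hprodAB : ∏ k ∈ Finset.range i, singularValue (A * B) k ≤ a := by
    refine (prod_singularValue_mul_le A B hi.le).trans (mul_le_of_le_one_right ha.le ?_)
    simpa using prod_singularValue_le_pow B hB1 i
  have hprodC : ∏ k ∈ Finset.range (i + 1), singularValue C k ≤ d⁻¹ ^ N :=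
    (prod_singularValue_le_pow C hC (i + 1)).trans
      (pow_le_pow_right₀ (one_le_inv_iff₀.2 ⟨hd0, hd1⟩) hi)
  have hmul : a * singularValue A i ≤ a * (singularValue (A * B) i * d⁻¹ ^ N) := by
    calc a * singularValue A i = ∏ k ∈ Finset.range (i + 1), singularValue (A * B * C) k := by
          rw [mul_assoc, hBC, mul_one, Finset.prod_range_succ]
      _ ≤ (∏ k ∈ Finset.range (i + 1), singularValue (A * B) k) *
            ∏ k ∈ Finset.range (i + 1), singularValue C k := prod_singularValue_mul_le _ _ hi
      _ ≤ a * (singularValue (A * B) i * d⁻¹ ^ N) := by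
          have hAB := singularValue_nonneg (A * B) i
          rw [Finset.prod_range_succ _ i, ← mul_assoc]
          gcongr
          exact prod_singularValue_nonneg C (i + 1)
  have hle := le_of_mul_le_mul_left hmul ha
  rwa [inv_pow, ← div_eq_mul_inv, le_div_iff₀ (by positivity), mul_comm] at hle

theorem pow_mul_singularValue_wordMap_le (hT : NormBounds T ρ c) (u v : List (Fin m)) {i : ℕ}
    (hi : i < N) :
    (c ^ v.length) ^ N * singularValue (wordMap T u) i ≤ singularValue (wordMap T (u ++ v)) i := by
  have hc := hT.lower_pos
  rw [wordMap_append]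
  exact pow_mul_singularValue_le_singularValue_mul (hT.wordMap_injective u)
    (hT.wordMap_injective v)
    ((hT.norm_wordMap_le v).trans (pow_le_one₀ hT.upper_pos.le hT.upper_lt_one.le))
    (by positivity) (pow_le_one₀ hc.le hT.lower_lt_one.le) (hT.mul_norm_le_wordMap v) hi

/-- The cylinder of the infinite words that start with `u`, for `u` given as a list. -/
def wordCylinder (u : List (Fin m)) : Set (ℕ → Fin m) :=
  {i | curtail i u.length = u}

theorem wordCylinder_ofFn {k : ℕ} (w : Fin k → Fin m) :
    wordCylinder (List.ofFn w) = cylinder w := by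
  ext i
  simp only [wordCylinder, cylinder, Set.mem_ofPred_eq, curtail]
  rw [List.ofFn_congr (List.length_ofFn (f := w)), List.ofFn_inj, funext_iff]
  rfl

theorem wordCylinder_nil : wordCylinder ([] : List (Fin m)) = Set.univ :=
  Set.eq_univ_of_forall fun i => curtail_zero i

theorem measurableSet_wordCylinder (u : List (Fin m)) : MeasurableSet (wordCylinder u) := by
  have hcyl : cylinder u.get = ⋂ j : Fin u.length, {i : ℕ → Fin m | i j = u.get j} :=
    Set.ofPred_forall _
  rw [← List.ofFn_get u, wordCylinder_ofFn, hcyl]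
  exact MeasurableSet.iInter fun j => measurable_pi_apply (j : ℕ) (measurableSet_singleton _)

theorem bernoulliMeasure_wordCylinder (p : PMF (Fin m)) (u : List (Fin m)) :
    bernoulliMeasure p (wordCylinder u) = ENNReal.ofReal (wordWeight p u) := by
  conv_lhs => rw [← List.ofFn_get u]
  rw [wordCylinder_ofFn, ← ENNReal.ofReal_toReal (measure_ne_top (bernoulliMeasure p) _),
    ← Measure.real, bernoulliMeasure_real_cylinder, List.ofFn_get]

theorem take_curtail (i : ℕ → Fin m) {k l : ℕ} (hkl : k ≤ l) :
    (curtail i l).take k = curtail i k :=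
  List.ext_getElem (by simp [curtail, hkl]) fun n _ _ => by simp [curtail]

theorem wordCylinder_append_subset (u v : List (Fin m)) :
    wordCylinder (u ++ v) ⊆ wordCylinder u := by
  intro i (hi : curtail i (u ++ v).length = u ++ v)
  change curtail i u.length = u
  rw [← take_curtail i (by simp : u.length ≤ (u ++ v).length), hi, List.take_left]

theorem disjoint_wordCylinder {u v : List (Fin m)} (hl : u.length = v.length) (huv : u ≠ v) :
    Disjoint (wordCylinder u) (wordCylinder v) := by
  refine Set.disjoint_left.2 fun i (hu : curtail i u.length = u) hv => huv ?_
  change curtail i v.length = v at hv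
  rw [← hu, hl, hv]

theorem exists_projection_eq_add (hT : NormBounds T ρ c) (u : List (Fin m))
    (hω : ∀ w, ‖ω w‖ ≤ R) :
    ∃ y : E N, ∀ i ∈ wordCylinder u, ∃ x, ‖x‖ ≤ R * (1 - ρ)⁻¹ ∧
      projection T ω i = y + wordMap T u x := by
  induction u generalizing ω with
  | nil =>
    refine ⟨0, fun i _ => ⟨projection T ω i, norm_projection_le hT hω i, ?_⟩⟩
    rw [wordMap_nil, zero_add]
    rfl
  | cons b v ih =>
    obtain ⟨y, hy⟩ := ih fun w => hω (b :: w)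
    refine ⟨ω [b] + T b y, fun i hi => ?_⟩
    have hcons : i = consWord (i 0) fun n => i (n + 1) := by
      funext n
      cases n <;> rfl
    rw [wordCylinder, Set.mem_ofPred_eq, List.length_cons, hcons, curtail_consWord,
      List.cons.injEq] at hi
    obtain ⟨x, hx, hproj⟩ := hy _ hi.2
    refine ⟨x, hx, ?_⟩
    rw [hcons, hi.1, projection_consWord hT hω, hproj, wordMap_cons, map_add, mul_apply_eq_comp,
      add_assoc]

/-- The constant in the bound for the number of `r`-mesh cubes that meet the projection of a
cylinder, when the displacements have norm at most `R` and the maps norm at most `ρ`. -/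
noncomputable def cubeCountConst (N : ℕ) (R ρ : ℝ) : ℝ :=
  (2 * (R * (1 - ρ)⁻¹ + Real.sqrt N)) ^ N

theorem cubeCountConst_pos (hN : 1 ≤ N) (hT : NormBounds T ρ c) (hR : 0 ≤ R) :
    0 < cubeCountConst N R ρ := by
  have hρ : 0 ≤ (1 - ρ)⁻¹ := inv_nonneg.2 (sub_nonneg.2 hT.upper_lt_one.le)
  rw [cubeCountConst]
  positivity

theorem card_meshCube_wordCylinder_le (hT : NormBounds T ρ c) (hR : 0 ≤ R)
    (hω : ∀ w, ‖ω w‖ ≤ R) (hr : 0 < r) (u : List (Fin m)) (F : Finset (Fin N → ℤ))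
    (hF : ∀ j ∈ F, (wordCylinder u ∩ projection T ω ⁻¹' meshCube r j).Nonempty) :
    (F.card : ℝ) ≤ cubeCountConst N R ρ *
      ∏ i ∈ Finset.range N, max 1 (singularValue (wordMap T u) i / r) := by
  obtain ⟨y, hy⟩ := exists_projection_eq_add hT u hω
  refine card_meshCube_le (mul_nonneg hR (inv_nonneg.2 (sub_nonneg.2 hT.upper_lt_one.le)))
    (wordMap T u) y hr F fun j hj => ?_
  obtain ⟨i, hiu, hij⟩ := hF j hj
  obtain ⟨x, hx, hproj⟩ := hy i hiu
  exact ⟨x, hx, hproj ▸ hij⟩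

/-- The moment sum of the projection of the Bernoulli measure restricted to a cylinder. -/
noncomputable def cylinderMoment (T : Fin m → E N →L[ℝ] E N) (p : PMF (Fin m))
    (ω : List (Fin m) → E N) (q r : ℝ) (u : List (Fin m)) : ℝ≥0∞ :=
  ∑' j : Fin N → ℤ, bernoulliMeasure p (wordCylinder u ∩ projection T ω ⁻¹' meshCube r j) ^ q

theorem cylinderMoment_nil (hT : NormBounds T ρ c) (hR : 0 ≤ R) (hω : ∀ w, ‖ω w‖ ≤ R)
    (hr : 0 < r) (hq : 1 ≤ q) :
    cylinderMoment T p ω q r [] =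
      ENNReal.ofReal (momentSum (projectedMeasure T (bernoulliMeasure p) ω) q r) := by
  have := isProbabilityMeasure_projectedMeasure (p := p) hT hR hω
  rw [ofReal_momentSum _ hr hq]
  refine tsum_congr fun j => ?_
  rw [wordCylinder_nil, Set.univ_inter, projectedMeasure,
    Measure.map_apply (measurable_projection hT hR hω) (measurableSet_meshCube r j)]

theorem sum_rpow_le_of_sum_le {ι : Type*} {F : Finset ι} {f : ι → ℝ≥0∞} {a : ℝ≥0∞} (hq : 1 ≤ q)
    (hle : ∑ i ∈ F, f i ≤ a) : ∑ i ∈ F, f i ^ q ≤ a ^ q :=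
  calc ∑ i ∈ F, f i ^ q ≤ ∑ i ∈ F, a ^ (q - 1) * f i := by
        refine Finset.sum_le_sum fun i hi => ?_
        have hia : f i ≤ a := (Finset.single_le_sum (fun _ _ => zero_le) hi).trans hle
        rw [rpow_eq_rpow_sub_one_mul hq]
        gcongr
    _ ≤ a ^ q := by
        rw [← Finset.mul_sum, rpow_eq_rpow_sub_one_mul hq a]
        gcongr

theorem sum_cylinderMoment_append_le (hT : NormBounds T ρ c) (hR : 0 ≤ R) (hω : ∀ w, ‖ω w‖ ≤ R)
    (hq : 1 ≤ q) (u : List (Fin m)) (k : ℕ) :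
    ∑ w : Fin k → Fin m, cylinderMoment T p ω q r (u ++ List.ofFn w) ≤
      cylinderMoment T p ω q r u := by
  unfold cylinderMoment
  rw [← Summable.tsum_finsetSum fun _ _ => ENNReal.summable]
  refine ENNReal.tsum_le_tsum fun j => sum_rpow_le_of_sum_le hq ?_
  rw [← measure_biUnion_finset]
  · exact measure_mono (Set.iUnion₂_subset fun w _ =>
      Set.inter_subset_inter_left _ (wordCylinder_append_subset u _))
  · intro w _ w' _ hww
    refine Disjoint.mono Set.inter_subset_left Set.inter_subset_left
      (disjoint_wordCylinder (by simp) fun heq => hww ?_)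
    exact List.ofFn_injective (List.append_cancel_left heq)
  · exact fun w _ => (measurableSet_wordCylinder _).inter
      (measurable_projection hT hR hω (measurableSet_meshCube r j))

theorem tsum_rpow_le_of_card_le {ι : Type*} {f : ι → ℝ≥0∞} {b : ℝ≥0∞} (hq : 1 ≤ q)
    (hb : ∀ F : Finset ι, (∀ i ∈ F, f i ≠ 0) → F.card ≤ b) :
    (∑' i, f i) ^ q ≤ b ^ (q - 1) * ∑' i, f i ^ q := by
  classical
  rw [← ENNReal.le_rpow_inv_iff (by linarith), ENNReal.tsum_eq_iSup_sum]
  refine iSup_le fun F => ?_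
  rw [ENNReal.le_rpow_inv_iff (by linarith), ← Finset.sum_filter_ne_zero]
  refine (ENNReal.rpow_sum_le_const_mul_sum_rpow _ _ hq).trans
    (mul_le_mul' (ENNReal.rpow_le_rpow (hb _ fun i hi => ?_) (by linarith))
      (ENNReal.sum_le_tsum _))
  exact (Finset.mem_filter.1 hi).2

theorem ofReal_wordWeight_eq_tsum (hT : NormBounds T ρ c) (hR : 0 ≤ R) (hω : ∀ w, ‖ω w‖ ≤ R)
    (hr : 0 < r) (u : List (Fin m)) :
    ENNReal.ofReal (wordWeight p u) =
      ∑' j : Fin N → ℤ, bernoulliMeasure p (wordCylinder u ∩ projection T ω ⁻¹' meshCube r j) := by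
  rw [← bernoulliMeasure_wordCylinder, ← measure_iUnion, ← Set.inter_iUnion,
    ← Set.preimage_iUnion, iUnion_meshCube hr, Set.preimage_univ, Set.inter_univ]
  · exact fun j k hjk => Disjoint.mono Set.inter_subset_right Set.inter_subset_right
      ((pairwise_disjoint_meshCube hr hjk).preimage _)
  · exact fun j => (measurableSet_wordCylinder u).inter
      (measurable_projection hT hR hω (measurableSet_meshCube r j))

theorem wordWeight_rpow_le_cylinderMoment (hT : NormBounds T ρ c) (hR : 0 ≤ R)
    (hω : ∀ w, ‖ω w‖ ≤ R) (hq : 1 ≤ q) (hr : 0 < r) (u : List (Fin m)) :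
    ENNReal.ofReal (wordWeight p u) ^ q ≤
      ENNReal.ofReal (cubeCountConst N R ρ *
        ∏ i ∈ Finset.range N, max 1 (singularValue (wordMap T u) i / r)) ^ (q - 1) *
      cylinderMoment T p ω q r u := by
  rw [ofReal_wordWeight_eq_tsum hT hR hω hr]
  refine tsum_rpow_le_of_card_le hq fun F hF => ?_
  rw [← ENNReal.ofReal_natCast]
  exact ENNReal.ofReal_le_ofReal (card_meshCube_wordCylinder_le hT hR hω hr u F
    fun j hj => nonempty_of_measure_ne_zero (hF j hj))

theorem rpow_mul_wordWeight_rpow_le_cylinderMoment (hT : NormBounds T ρ c)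
    (hp : ∀ i, 0 < p i) (hR : 0 ≤ R) (hω : ∀ w, ‖ω w‖ ≤ R) (hq : 1 ≤ q) (hr : 0 < r)
    (u : List (Fin m)) {K : ℝ} (hK : 0 < K)
    (hcount : cubeCountConst N R ρ *
      ∏ i ∈ Finset.range N, max 1 (singularValue (wordMap T u) i / r) ≤ K) :
    ENNReal.ofReal (K ^ (1 - q) * wordWeight p u ^ q) ≤ cylinderMoment T p ω q r u := by
  have hK0 : ENNReal.ofReal K ≠ 0 := by simpa using hK
  rw [ENNReal.ofReal_mul (by positivity), ← ENNReal.ofReal_rpow_of_pos hK,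
    ← ENNReal.ofReal_rpow_of_pos (wordWeight_pos hp u)]
  calc ENNReal.ofReal K ^ (1 - q) * ENNReal.ofReal (wordWeight p u) ^ q
      ≤ ENNReal.ofReal K ^ (1 - q) *
          (ENNReal.ofReal K ^ (q - 1) * cylinderMoment T p ω q r u) := by
        refine mul_le_mul_right ((wordWeight_rpow_le_cylinderMoment hT hR hω hq hr u).trans ?_) _
        gcongr
    _ = cylinderMoment T p ω q r u := by
        rw [← mul_assoc, ← ENNReal.rpow_add _ _ hK0 ENNReal.ofReal_ne_top]
        simp

theorem mul_wordTerm_le_cylinderMoment_of_singularValue_le (hN : 1 ≤ N) (hT : NormBounds T ρ c)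
    (hp : ∀ i, 0 < p i) (hR : 0 ≤ R) (hω : ∀ w, ‖ω w‖ ≤ R) (hq : 1 ≤ q) (hr : 0 < r) (hs : 0 < s)
    (hsN : s ≤ N) {l : ℕ} (hls : l < s) (hsl : s ≤ l + 1) {b : ℝ} (hb : 0 < b) (hb1 : b ≤ 1)
    {u : List (Fin m)} (hbu : b * r ≤ singularValue (wordMap T u) l)
    (hur : singularValue (wordMap T u) l ≤ r) :
    ENNReal.ofReal ((cubeCountConst N R ρ * b⁻¹ ^ N) ^ (1 - q) * r ^ (s * (q - 1)) *
      wordTerm T p q s u) ≤ cylinderMoment T p ω q r u := by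
  have hD := cubeCountConst_pos hN hT hR
  have hφ := singularValueFunction_pos (hT.wordMap_injective u) hs
  have hcount := mul_le_mul_of_nonneg_left (prod_max_le_inv_pow_mul_singularValueFunction hN hs
    hsN hr hb hb1 hls hsl hbu hur) hD.le
  refine le_of_eq_of_le (congrArg ENNReal.ofReal ?_)
    (rpow_mul_wordWeight_rpow_le_cylinderMoment hT hp hR hω hq hr u (by positivity) hcount)
  rw [wordTerm, ← mul_assoc (cubeCountConst N R ρ),
    Real.mul_rpow (y := _ / _) (by positivity) (by positivity),
    Real.div_rpow hφ.le (by positivity), ← Real.rpow_mul hr.le,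
    show s * (q - 1) = -(s * (1 - q)) by ring, Real.rpow_neg hr.le]
  ring

theorem wordTerm_le_sum_wordTerm_append (hT : NormBounds T ρ c) (hp : ∀ i, 0 < p i) (hs : 0 < s)
    (hq : 1 ≤ q) {k : ℕ} (hS : 1 ≤ levelSum T (bernoulliMeasure p) q s k) (u : List (Fin m)) :
    wordTerm T p q s u ≤ ∑ w : Fin k → Fin m, wordTerm T p q s (u ++ List.ofFn w) :=
  calc wordTerm T p q s u ≤ wordTerm T p q s u * levelSum T (bernoulliMeasure p) q s k :=
        le_mul_of_one_le_right (wordTerm_pos hT hp hs u).le hS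
    _ ≤ ∑ w : Fin k → Fin m, wordTerm T p q s (u ++ List.ofFn w) := by
        rw [levelSum_eq, Finset.mul_sum]
        exact Finset.sum_le_sum fun w _ => wordTerm_mul_le hT hs hq u _

-- The tree of words is explored `k` letters at a time, and a branch is stopped once the singular
-- value of index `l` drops to `r`; it is then still at least `(c ^ k) ^ N * r`.
theorem mul_wordTerm_le_cylinderMoment (hN : 1 ≤ N) (hT : NormBounds T ρ c)
    (hp : ∀ i, 0 < p i) (hR : 0 ≤ R) (hω : ∀ w, ‖ω w‖ ≤ R) (hq : 1 ≤ q) (hr : 0 < r) (hs : 0 < s)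
    (hsN : s ≤ N) {l : ℕ} (hls : l < s) (hsl : s ≤ l + 1) {k : ℕ} (hk : 1 ≤ k)
    (hS : 1 ≤ levelSum T (bernoulliMeasure p) q s k) (n : ℕ) (u : List (Fin m))
    (hn : ρ ^ (u.length + n) ≤ r) (hu : (c ^ k) ^ N * r ≤ singularValue (wordMap T u) l) :
    ENNReal.ofReal ((cubeCountConst N R ρ * ((c ^ k) ^ N)⁻¹ ^ N) ^ (1 - q) * r ^ (s * (q - 1)) *
      wordTerm T p q s u) ≤ cylinderMoment T p ω q r u := by
  have hc := hT.lower_pos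
  have hD := cubeCountConst_pos hN hT hR
  have hlN : l < N := by exact_mod_cast hls.trans_le hsN
  have hck : (c ^ k) ^ N ≤ 1 := pow_le_one₀ (by positivity) (pow_le_one₀ hc.le hT.lower_lt_one.le)
  induction n generalizing u with
  | zero =>
    exact mul_wordTerm_le_cylinderMoment_of_singularValue_le hN hT hp hR hω hq hr hs hsN hls hsl
      (by positivity) hck hu
      (((singularValue_le_norm _ _).trans (hT.norm_wordMap_le u)).trans (by simpa using hn))
  | succ n ih =>
    rcases le_or_gt (singularValue (wordMap T u) l) r with hur | hru
    · exact mul_wordTerm_le_cylinderMoment_of_singularValue_le hN hT hp hR hω hq hr hs hsN hls hsl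
        (by positivity) hck hu hur
    have hext : ∀ w : Fin k → Fin m, ENNReal.ofReal ((cubeCountConst N R ρ *
        ((c ^ k) ^ N)⁻¹ ^ N) ^ (1 - q) * r ^ (s * (q - 1)) *
          wordTerm T p q s (u ++ List.ofFn w)) ≤
        cylinderMoment T p ω q r (u ++ List.ofFn w) := fun w => by
      refine ih _ (le_trans (pow_le_pow_of_le_one hT.upper_pos.le hT.upper_lt_one.le ?_) hn) ?_
      · rw [List.length_append, List.length_ofFn]
        omega
      · have hsv := pow_mul_singularValue_wordMap_le hT u (List.ofFn w) hlN
        rw [List.length_ofFn] at hsv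
        exact (mul_le_mul_of_nonneg_left hru.le (by positivity)).trans hsv
    refine le_trans ?_ ((Finset.sum_le_sum fun w _ => hext w).trans
      (sum_cylinderMoment_append_le hT hR hω hq u k))
    rw [← ENNReal.ofReal_sum_of_nonneg fun w _ =>
      mul_nonneg (by positivity) (wordTerm_pos hT hp hs _).le, ← Finset.mul_sum]
    gcongr
    exact wordTerm_le_sum_wordTerm_append hT hp hs hq hS u

theorem exists_one_le_levelSum (hN : 1 ≤ N) (hm : 1 ≤ m) (hT : NormBounds T ρ c)
    (hp : ∀ i, 0 < p i) (hs : 0 < s) (hq : 1 ≤ q) (hP : 0 < pressure T p q s) :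
    ∃ k, 1 ≤ k ∧ 1 ≤ levelSum T (bernoulliMeasure p) q s k := by
  obtain ⟨k, hk, hk1⟩ := (((tendsto_pressure hN hm hT hp hs hq).eventually
    (lt_mem_nhds hP)).and (eventually_ge_atTop 1)).exists
  have hk0 : (0 : ℝ) < k := by exact_mod_cast hk1
  rw [lt_div_iff₀ hk0, zero_mul, Real.log_pos_iff (levelSum_pos hm hT hp hs k).le] at hk
  exact ⟨k, hk1, hk.le⟩

theorem exists_mul_rpow_le_momentSum_of_pressure_pos (hN : 1 ≤ N) (hm : 1 ≤ m)
    (hT : NormBounds T ρ c) (hp : ∀ i, 0 < p i) (hR : 0 ≤ R) (hω : ∀ w, ‖ω w‖ ≤ R) (hq : 1 ≤ q)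
    (hs : 0 < s) (hsN : s ≤ N) (hP : 0 < pressure T p q s) :
    ∃ K : ℝ, 0 < K ∧ ∀ᶠ r in 𝓝[>] 0,
      K * r ^ (s * (q - 1)) ≤ momentSum (projectedMeasure T (bernoulliMeasure p) ω) q r := by
  have hc := hT.lower_pos
  have hD := cubeCountConst_pos hN hT hR
  obtain ⟨k, hk, hS⟩ := exists_one_le_levelSum hN hm hT hp hs hq hP
  obtain ⟨l, -, hls, hsl⟩ := exists_ceil_eq_add_one hs
  refine ⟨(cubeCountConst N R ρ * ((c ^ k) ^ N)⁻¹ ^ N) ^ (1 - q), by positivity, ?_⟩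
  filter_upwards [Ioc_mem_nhdsGT one_pos] with r ⟨hr0, hr1⟩
  obtain ⟨n, hn⟩ := exists_pow_lt_of_lt_one hr0 hT.upper_lt_one
  have hnil : (c ^ k) ^ N * r ≤ singularValue (wordMap T []) l := by
    rw [wordMap_nil, singularValue_one (by exact_mod_cast hls.trans_le hsN)]
    exact mul_le_one₀ (pow_le_one₀ (by positivity) (pow_le_one₀ hc.le hT.lower_lt_one.le))
      hr0.le hr1
  have hle := mul_wordTerm_le_cylinderMoment hN hT hp hR hω hq hr0 hs hsN hls hsl hk hS n []
    (by simpa using hn.le) hnil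
  rw [cylinderMoment_nil hT hR hω hr0 hq, wordTerm, wordMap_nil, wordWeight_nil,
    singularValueFunction_one hs, Real.one_rpow, Real.one_rpow, one_mul, mul_one] at hle
  exact (ENNReal.ofReal_le_ofReal_iff (tsum_nonneg fun j => by positivity)).1 hle

theorem exists_mul_rpow_natCast_le_momentSum (hN : 1 ≤ N) (hT : NormBounds T ρ c)
    (hp : ∀ i, 0 < p i) (hR : 0 ≤ R) (hω : ∀ w, ‖ω w‖ ≤ R) (hq : 1 ≤ q) :
    ∃ K : ℝ, 0 < K ∧ ∀ᶠ r in 𝓝[>] 0,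
      K * r ^ (N * (q - 1)) ≤ momentSum (projectedMeasure T (bernoulliMeasure p) ω) q r := by
  have hD := cubeCountConst_pos hN hT hR
  refine ⟨cubeCountConst N R ρ ^ (1 - q), by positivity, ?_⟩
  filter_upwards [Ioc_mem_nhdsGT one_pos] with r ⟨hr0, hr1⟩
  have hprod : ∏ i ∈ Finset.range N, max 1 (singularValue (wordMap T []) i / r) = r⁻¹ ^ N := by
    rw [Finset.prod_congr rfl fun i hi => ?_, Finset.prod_const, Finset.card_range]
    rw [wordMap_nil, singularValue_one (Finset.mem_range.1 hi), one_div,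
      max_eq_right (one_le_inv_iff₀.2 ⟨hr0, hr1⟩)]
  have hle := rpow_mul_wordWeight_rpow_le_cylinderMoment hT hp hR hω hq hr0 []
    (K := cubeCountConst N R ρ * r⁻¹ ^ N) (by positivity) (by rw [hprod])
  have hpow : (r⁻¹ ^ N) ^ (1 - q) = r ^ (N * (q - 1)) := by
    rw [← Real.rpow_natCast, Real.inv_rpow hr0.le, ← Real.rpow_neg hr0.le, ← Real.rpow_mul hr0.le]
    congr 1
    ring
  rw [cylinderMoment_nil hT hR hω hr0 hq, wordWeight_nil, Real.one_rpow, mul_one,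
    Real.mul_rpow hD.le (by positivity), hpow] at hle
  exact (ENNReal.ofReal_le_ofReal_iff (tsum_nonneg fun j => by positivity)).1 hle

end Counting

section Dimension

variable {N m : ℕ} {T : Fin m → E N →L[ℝ] E N} {ρ c R : ℝ} {p : PMF (Fin m)} {q : ℝ}
  {ω : List (Fin m) → E N}

theorem tendsto_add_log_div_log (hq : 1 < q) (K t : ℝ) :
    Tendsto (fun r => t + Real.log K / ((q - 1) * Real.log r)) (𝓝[>] 0) (𝓝 t) := by
  have hlog : Tendsto (fun r => (q - 1) * Real.log r) (𝓝[>] 0) atBot :=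
    Real.tendsto_log_nhdsGT_zero.const_mul_atBot (by linarith)
  simpa using (hlog.const_div_atBot (Real.log K)).const_add t

theorem log_mul_rpow_div {K r : ℝ} (hK : 0 < K) (hr0 : 0 < r) (hr1 : r < 1) (hq : 1 < q) (t : ℝ) :
    Real.log (K * r ^ (t * (q - 1))) / ((q - 1) * Real.log r) =
      t + Real.log K / ((q - 1) * Real.log r) := by
  have hq0 : q - 1 ≠ 0 := (sub_pos.2 hq).ne'
  have hlog : Real.log r ≠ 0 := (Real.log_neg hr0 hr1).ne
  rw [Real.log_mul hK.ne' (Real.rpow_pos_of_pos hr0 _).ne', Real.log_rpow hr0]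
  field_simp
  ring

theorem eventually_log_div_lt {f : ℝ → ℝ} (hq : 1 < q) {K s b : ℝ} (hK : 0 < K)
    (hf : ∀ᶠ r in 𝓝[>] 0, K * r ^ (s * (q - 1)) ≤ f r) (hb : s < b) :
    ∀ᶠ r in 𝓝[>] 0, Real.log (f r) / ((q - 1) * Real.log r) < b := by
  filter_upwards [hf, (tendsto_add_log_div_log hq K s).eventually (gt_mem_nhds hb),
    Ioo_mem_nhdsGT one_pos] with r hle hlt ⟨hr0, hr1⟩
  rw [← log_mul_rpow_div hK hr0 hr1 hq] at hlt
  refine lt_of_le_of_lt (div_le_div_of_nonpos_of_le ?_ (Real.log_le_log (by positivity) hle)) hlt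
  exact (mul_neg_of_pos_of_neg (sub_pos.2 hq) (Real.log_neg hr0 hr1)).le

theorem eventually_lt_log_div {f : ℝ → ℝ} (hq : 1 < q) {K t b : ℝ} (hK : 0 < K)
    (hf0 : ∀ᶠ r in 𝓝[>] 0, 0 < f r) (hf : ∀ᶠ r in 𝓝[>] 0, f r ≤ K * r ^ (t * (q - 1)))
    (hb : b < t) : ∀ᶠ r in 𝓝[>] 0, b < Real.log (f r) / ((q - 1) * Real.log r) := by
  filter_upwards [hf0, hf, (tendsto_add_log_div_log hq K t).eventually (lt_mem_nhds hb),
    Ioo_mem_nhdsGT one_pos] with r hpos hle hlt ⟨hr0, hr1⟩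
  rw [← log_mul_rpow_div hK hr0 hr1 hq] at hlt
  refine hlt.trans_le (div_le_div_of_nonpos_of_le ?_ (Real.log_le_log hpos hle))
  exact (mul_neg_of_pos_of_neg (sub_pos.2 hq) (Real.log_neg hr0 hr1)).le

theorem eventually_log_momentSum_div_lt (hN : 1 ≤ N) (hm : 1 ≤ m) (hT : NormBounds T ρ c)
    (hp : ∀ i, 0 < p i) (hR : 0 ≤ R) (hω : ∀ w, ‖ω w‖ ≤ R) (hq : 1 < q) {d : ℝ} (hd : 0 < d)
    (hP : pressure T p q d = 0) {b : ℝ} (hb : min d N < b) :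
    ∀ᶠ r in 𝓝[>] 0, Real.log (momentSum (projectedMeasure T (bernoulliMeasure p) ω) q r) /
      ((q - 1) * Real.log r) < b := by
  rcases le_or_gt (N : ℝ) d with hNd | hdN
  · rw [min_eq_right hNd] at hb
    obtain ⟨K, hK, hle⟩ := exists_mul_rpow_natCast_le_momentSum hN hT hp hR hω hq.le
    exact eventually_log_div_lt hq hK hle hb
  · rw [min_eq_left hdN.le] at hb
    obtain ⟨s, hds, hs⟩ := exists_between (lt_min hb hdN)
    have hPs : 0 < pressure T p q s :=
      hP ▸ strictMonoOn_pressure hN hm hT hp hq hd (hd.trans hds) hds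
    obtain ⟨K, hK, hle⟩ := exists_mul_rpow_le_momentSum_of_pressure_pos hN hm hT hp hR hω hq.le
      (hd.trans hds) (hs.le.trans (min_le_right _ _)) hPs
    exact eventually_log_div_lt hq hK hle (hs.trans_le (min_le_left _ _))

theorem eventually_lt_log_momentSum_div (hN : 1 ≤ N) (hm : 1 ≤ m) (hT : NormBounds T ρ c)
    (hp : ∀ i, 0 < p i) (hR : 0 ≤ R) (hω : ∀ w, ‖ω w‖ ≤ R) (hq : 1 < q) {d : ℝ} (hd : 0 < d)
    (hP : pressure T p q d = 0)
    (hcorr : ∀ s t : ℝ, s ≤ N → pressure T p q s < 0 → 0 < t → t < s →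
      IsRpowBounded (fun r => sampleCorrMoment T p R (q - 1) 1 r ω) (t * (q - 1)))
    {b : ℝ} (hb : b < min d N) :
    ∀ᶠ r in 𝓝[>] 0, b < Real.log (momentSum (projectedMeasure T (bernoulliMeasure p) ω) q r) /
      ((q - 1) * Real.log r) := by
  have hpos : ∀ᶠ r in 𝓝[>] 0, 0 < momentSum (projectedMeasure T (bernoulliMeasure p) ω) q r := by
    obtain ⟨K, hK, hle⟩ := exists_mul_rpow_natCast_le_momentSum hN hT hp hR hω hq.le
    filter_upwards [hle, self_mem_nhdsWithin] with r hr hr0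
    exact lt_of_lt_of_le (mul_pos hK (Real.rpow_pos_of_pos hr0 _)) hr
  have hN0 : (0 : ℝ) < N := by exact_mod_cast hN
  obtain ⟨t, hbt, ht⟩ := exists_between (max_lt hb (lt_min hd hN0))
  obtain ⟨s, hts, hs⟩ := exists_between ht
  have ht0 : 0 < t := (le_max_right _ _).trans_lt hbt
  have hPs : pressure T p q s < 0 :=
    hP ▸ strictMonoOn_pressure hN hm hT hp hq (ht0.trans hts) hd (hs.trans_le (min_le_left _ _))
  obtain ⟨K, hK, hle⟩ := exists_momentSum_le hN hT hR hω hq.le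
    (hcorr s t (hs.le.trans (min_le_right _ _)) hPs ht0 hts)
  exact eventually_lt_log_div hq hK hpos hle ((le_max_left _ _).trans_lt hbt)

theorem lowerDim_upperDim_eq {τ : Measure (E N)} {D : ℝ}
    (hD : Tendsto (fun r : ℝ => Real.log (momentSum τ q r) / ((q - 1) * Real.log r))
      (𝓝[>] 0) (𝓝 D)) :
    lowerDim q τ = (D : EReal) ∧ upperDim q τ = (D : EReal) :=
  have hcoe := (continuous_coe_real_ereal.tendsto D).comp hD
  ⟨hcoe.liminf_eq, hcoe.limsup_eq⟩

theorem ae_displacementLaw_norm_le {ν : Measure (E N)} [IsProbabilityMeasure ν]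
    (hνR : ∀ᵐ z ∂ν, ‖z‖ ≤ R) : ∀ᵐ ω ∂(displacementLaw m ν), ∀ w, ‖ω w‖ ≤ R :=
  ae_all_iff.2 fun w =>
    (measurePreserving_eval_infinitePi (fun _ : List (Fin m) => ν) w).quasiMeasurePreserving.ae hνR

theorem ae_forall_lowerDim_upperDim_eq (hN : 1 ≤ N) (hm : 2 ≤ m) (hT : NormBounds T ρ c)
    (hp : ∀ i, 0 < p i) (hR : 0 ≤ R) {ν : Measure (E N)} [IsProbabilityMeasure ν]
    (hν : ν ≪ volume) (hνR : ∀ᵐ z ∂ν, ‖z‖ ≤ R) :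
    ∀ᵐ ω ∂(displacementLaw m ν), ∀ q d : ℝ, 1 < q → 0 < d → pressure T p q d = 0 →
      lowerDim q (projectedMeasure T (bernoulliMeasure p) ω) = ((min d N : ℝ) : EReal) ∧
      upperDim q (projectedMeasure T (bernoulliMeasure p) ω) = ((min d N : ℝ) : EReal) := by
  have hm1 : 1 ≤ m := by lia
  filter_upwards [ae_displacementLaw_norm_le (m := m) hνR,
    ae_forall_isRpowBounded_sampleCorrMoment hN hm hT hp hR hν hνR] with ω hω hcorr q d hq hd hP
  refine lowerDim_upperDim_eq (tendsto_order.2 ⟨fun b hb => ?_, fun b hb => ?_⟩)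
  · exact eventually_lt_log_momentSum_div hN hm1 hT hp hR hω hq hd hP (hcorr q · · hq) hb
  · exact eventually_log_momentSum_div_lt hN hm1 hT hp hR hω hq hd hP hb

end Dimension

end AlmostSelfAffine

open AlmostSelfAffine in
theorem corollary8p3 {N m : ℕ} (hN : 1 ≤ N) (hm : 2 ≤ m)
    (T : Fin m → E N →L[ℝ] E N)
    (hT_inj : ∀ i, Function.Injective (T i))
    (hT_norm : ∀ i, ‖T i‖ < 1)
    (p : PMF (Fin m)) (hp : ∀ i, 0 < p i)
    (D : Set (E N)) (hD : Bornology.IsBounded D)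
    (ν : Measure (E N)) [IsProbabilityMeasure ν]
    (hνD : ∀ᵐ x ∂ν, x ∈ D)
    (hν : ν ≪ volume) :
    ∃ d : ℝ → ℝ,
      (∀ q : ℝ, 1 < q →
        IsCriticalExponent T (bernoulliMeasure p) q (d q) ∧
        ∀ s : ℝ, IsCriticalExponent T (bernoulliMeasure p) q s → s = d q) ∧
      ∀ᵐ ω ∂(displacementLaw m ν), ∀ q : ℝ, 1 < q →
        lowerDim q (projectedMeasure T (bernoulliMeasure p) ω) = ((min (d q) N : ℝ) : EReal) ∧
        upperDim q (projectedMeasure T (bernoulliMeasure p) ω) = ((min (d q) N : ℝ) : EReal) := by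
  obtain ⟨ρ, c, hT⟩ := exists_normBounds hT_inj hT_norm
  have hm1 : 1 ≤ m := by lia
  obtain ⟨R, hR, hDR⟩ := hD.exists_pos_norm_le
  have hroot : ∀ q : ℝ, ∃ d : ℝ, 1 < q → 0 < d ∧ pressure T p q d = 0 := fun q => by
    by_cases hq : 1 < q
    · exact (exists_pressure_eq_zero hN hm hT hp hq).imp fun _ hd _ => hd
    · exact ⟨0, fun h => absurd h hq⟩
  choose d hd using hroot
  refine ⟨d, fun q hq => ⟨(isCriticalExponent_iff hN hm1 hT hp hq.le).2 (hd q hq),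
    fun s hs => ?_⟩, ?_⟩
  · obtain ⟨hs0, hPs⟩ := (isCriticalExponent_iff hN hm1 hT hp hq.le).1 hs
    exact (strictMonoOn_pressure hN hm1 hT hp hq).injOn hs0 (hd q hq).1
      (hPs.trans (hd q hq).2.symm)
  · filter_upwards [ae_forall_lowerDim_upperDim_eq hN hm hT hp hR.le hν (hνD.mono hDR)]
      with ω hω q hq
    exact hω q (d q) hq (hd q hq).1 (hd q hq).2
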